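/- **Setting.** Let $L>0$, $V=H^2(0,L;\mathbb R^3)\times H^1(0,L;\mathbb R^3)$, $\|\cdot\|=\|\cdot\|_{L^2(0,L)}$, and $$E[y,b]=\int_0^L \overline Q(|y''|,|b'|)\,dx,\qquad \overline Q(\alpha,\beta)=\begin{cases}(\alpha^2+\beta^2)^2/\alpha^2,&|\alpha|>|\beta|,\\ 4\beta^2,&|\alpha|\le|\beta|.\end{cases}$$ Let $L_{bc}$ be a bounded linear operator on $V$ with values in a normed space that depends only on the values of $y,y',b$ at $0$ and $L$, and let $\ell_{bc}$ be an element of that space. The set of admissible frames is $$\mathcal A=\{(y,b)\in V:\ [y',b,y'\times b]\in SO(3)\ \text{a.e. in }(0,L),\ L_{bc}[y,b]=\ell_{bc}\}.$$ For $\delta\ge0$ let $|\cdot|_\delta:\mathbb R\to\mathbb R_{\ge0}$ satisfy $|\cdot|_\delta\ge c_0\delta$ and $\big||x|_\delta-|x|\big|\le c_{uni}\delta$ for all $x$, and, for $\delta>0$, $|\cdot|_\delta\in C^2(\mathbb R)$ with $|\cdot|_\delta'\le c_1$ and $|\cdot|_\delta''\le c_2\delta^{-1}$, where $c_0>0$ and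 the constants do not depend on $\delta$. Put $$\psi_\delta(\alpha^2,\beta^2)=|\alpha^2-\beta^2|_\delta+\frac{4\beta^4}{\alpha^2+\beta^2+|\alpha^2-\beta^2|_\delta}$$ (with quotient $0$ if $\delta=\alpha=\beta=0$). Let $\mathcal T_n$ be partitions $0=x_0<\dots<x_N=L$ with maximal mesh-size $h=h_n\to0$ which are quasiuniform: every element has length at least $c\,h_n$, with $c>0$ independent of $n$. Let $\varepsilon_1=\varepsilon_{1,n}>0$, $\varepsilon_2=\varepsilon_{2,n}>0$, $\delta=\delta_n\ge0$ be sequences that tend to $0$. A *discrete admissible pair* $(y_h,b_h)$ consists of a $C^1$, piecewise cubic $y_h$ and a continuous, piecewise linear $b_h$ on $\mathcal T_n$, with values in $\mathbb R^3$, such that $|y_h'|^2=|b_h|^2=1$ at all nodes and $L_{bc}[y_h,b_h]=\ell_{bc}$. Its energy is $$E_{\delta,\varepsilon,h}[y_h,b_h]=\frac12\int_0^L|y_h''|^2+5|b_h'|^2+\psi_\delta(|y_h''|^2,|b_h'|^2)\,dx+\frac1{2\varepsilon_1}\int_0^L(y_h'\cdot b_h)^2dx+\frac1{2\varepsilon_2}\int_0^L(y_h'\cdot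 b_h')^2dx .$$ For $(y,b)\in V$ and $\sigma>0$ let $[y,b]_\sigma\in[0,\infty]$ be the infimum of $\|y_\sigma\|_{H^3}+\|b_\sigma\|_{H^2}$ over all frames $(y_\sigma,b_\sigma)\in\mathcal A\cap C^\infty(0,L;\mathbb R^3)^2$ with $y_\sigma\in H^3$, $b_\sigma\in H^2$ and $\|y-y_\sigma\|_{H^2}+\|b-b_\sigma\|_{H^1}+\|y_\sigma'\cdot b_\sigma'\|\le\sigma$ (with $\inf\emptyset=\infty$). **Proposition (Partial $\Gamma$-convergence).** (i) Let $(y,b)\in V$ and let $\sigma=\sigma_n>0$ tend to $0$ such that $$h^2\varepsilon_1^{-1}+\sigma^2\varepsilon_2^{-1}+h^2[y,b]_\sigma^2\,\varepsilon_2^{-1}\to0 .$$ Then there are discrete admissible pairs $(y_h,b_h)$ with $y_h\to y$ in $H^2$, $b_h\to b$ in $H^1$ and $E_{\delta,\varepsilon,h}[y_h,b_h]\to E[y,b]$. (ii) Let $(y_h,b_h)$ be a sequence of discrete admissible pairs that is bounded in $V$. Then it has a subsequence that converges weakly in $V$. If the sequence converges weakly in $V$ to $(y,b)$, then $$E[y,b]\le\liminf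 E_{\delta,\varepsilon,h}[y_h,b_h]\quad\text{in }[-\infty,\infty],$$ and, if this lower limit is not $+\infty$ (in particular if the energies are bounded), then $(y,b)\in\mathcal A$ and $y'\cdot b'=0$ a.e. in $(0,L)$. -/

import Mathlib

open Filter Topology MeasureTheory Matrix
open scoped ENNReal ContDiff

noncomputable section

namespace Ribbon

/-- Euclidean three-space. -/
abbrev E3 : Type := EuclideanSpace ℝ (Fin 3)

/-! ### Sobolev spaces on the interval `(0, L)`

Sobolev functions are represented by their continuous representatives on `[0, L]`: an element of
`H¹` is continuous on `[0, L]`, an element of `H²` is `C¹` on `[0, L]` with derivative in `H¹`, and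
so on. The highest derivative is a weak derivative in `L²`. Values outside `[0, L]` never matter. -/

/-- Lebesgue measure on `(0, L)`. -/
def dom (L : ℝ) : Measure ℝ := volume.restrict (Set.Ioo 0 L)

/-- `g` is a weak derivative of `f` on `(0, L)`: integration by parts holds against every smooth
`φ` with compact support in `(0, L)`. -/
def HasWeakDeriv (L : ℝ) (f g : ℝ → E3) : Prop :=
  ∀ φ : ℝ → ℝ, ContDiff ℝ ∞ φ → HasCompactSupport φ → tsupport φ ⊆ Set.Ioo 0 L →
    ∫ x, deriv φ x • f x ∂(dom L) = - ∫ x, φ x • g x ∂(dom L)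

/-- `f` has a weak derivative in `L²(0, L; ℝ³)`. -/
def HasL2WeakDeriv (L : ℝ) (f : ℝ → E3) : Prop :=
  ∃ g : ℝ → E3, MemLp g 2 (dom L) ∧ HasWeakDeriv L f g

open Classical in
/-- The weak derivative in `L²` (unique up to null sets); it is `0` if there is none. -/
def weakDeriv (L : ℝ) (f : ℝ → E3) : ℝ → E3 :=
  if h : HasL2WeakDeriv L f then h.choose else 0

/-- The classical derivative on `[0, L]` (one-sided at the end points). -/
def cderiv (L : ℝ) (f : ℝ → E3) : ℝ → E3 := derivWithin f (Set.Icc 0 L)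

/-- `f ∈ H¹(0, L; ℝ³)`. -/
def MemH1 (L : ℝ) (f : ℝ → E3) : Prop :=
  ContinuousOn f (Set.Icc 0 L) ∧ HasL2WeakDeriv L f

/-- `f ∈ H²(0, L; ℝ³)`. -/
def MemH2 (L : ℝ) (f : ℝ → E3) : Prop :=
  ContDiffOn ℝ 1 f (Set.Icc 0 L) ∧ MemH1 L (cderiv L f)

/-- `f ∈ H³(0, L; ℝ³)`. -/
def MemH3 (L : ℝ) (f : ℝ → E3) : Prop :=
  ContDiffOn ℝ 1 f (Set.Icc 0 L) ∧ MemH2 L (cderiv L f)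

/-- The second derivative of `y ∈ H²`. -/
def deriv2 (L : ℝ) (y : ℝ → E3) : ℝ → E3 := weakDeriv L (cderiv L y)

/-- The squared `L²(0, L; ℝ³)` norm. -/
def l2Sq (L : ℝ) (f : ℝ → E3) : ℝ := ∫ x, ‖f x‖ ^ 2 ∂(dom L)

/-- The squared `H¹` norm. -/
def h1Sq (L : ℝ) (f : ℝ → E3) : ℝ := l2Sq L f + l2Sq L (weakDeriv L f)

/-- The squared `H²` norm. -/
def h2Sq (L : ℝ) (f : ℝ → E3) : ℝ := l2Sq L f + h1Sq L (cderiv L f)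

/-- The squared `H³` norm. -/
def h3Sq (L : ℝ) (f : ℝ → E3) : ℝ := l2Sq L f + h2Sq L (cderiv L f)

/-- The `H¹` norm. -/
def h1Norm (L : ℝ) (f : ℝ → E3) : ℝ := √(h1Sq L f)

/-- The `H²` norm. -/
def h2Norm (L : ℝ) (f : ℝ → E3) : ℝ := √(h2Sq L f)

/-- The `H³` norm. -/
def h3Norm (L : ℝ) (f : ℝ → E3) : ℝ := √(h3Sq L f)

/-- Weak convergence in `L²(0, L; ℝ³)`. -/
def WeakL2 (L : ℝ) (f : ℕ → ℝ → E3) (g : ℝ → E3) : Prop :=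
  ∀ φ : ℝ → E3, MemLp φ 2 (dom L) →
    Tendsto (fun n => ∫ x, inner ℝ (f n x) (φ x) ∂(dom L)) atTop
      (𝓝 (∫ x, inner ℝ (g x) (φ x) ∂(dom L)))

/-- Weak convergence in `H¹`: functions and weak derivatives converge weakly in `L²`. -/
def WeakH1 (L : ℝ) (f : ℕ → ℝ → E3) (g : ℝ → E3) : Prop :=
  WeakL2 L f g ∧ WeakL2 L (fun n => weakDeriv L (f n)) (weakDeriv L g)

/-- Weak convergence in `H²`. -/
def WeakH2 (L : ℝ) (f : ℕ → ℝ → E3) (g : ℝ → E3) : Prop :=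
  WeakL2 L f g ∧ WeakH1 L (fun n => cderiv L (f n)) (cderiv L g)

/-! ### The ribbon energy and admissible frames -/

/-- The corrected Sadowsky energy density. -/
def Qbar (α β : ℝ) : ℝ :=
  if |α| ≤ |β| then 4 * β ^ 2 else (α ^ 2 + β ^ 2) ^ 2 / α ^ 2

/-- `E[y, b] = ∫₀ᴸ Q(|y''|, |b'|) dx`. -/
def energy (L : ℝ) (y b : ℝ → E3) : ℝ :=
  ∫ x, Qbar ‖deriv2 L y x‖ ‖weakDeriv L b x‖ ∂(dom L)

/-- Boundary values at `0` and `L` of `y`, `y'` and `b`. -/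
abbrev BdryData : Type := (Fin 2 → E3) × (Fin 2 → E3) × (Fin 2 → E3)

/-- The boundary values of `y`, `y'` and `b`. -/
def bdry (L : ℝ) (y b : ℝ → E3) : BdryData :=
  (![y 0, y L], ![cderiv L y 0, cderiv L y L], ![b 0, b L])

/-- The matrix with columns `t`, `b`, `t × b`. -/
def frameMatrix (t b : E3) : Matrix (Fin 3) (Fin 3) ℝ :=
  (Matrix.of ![t.ofLp, b.ofLp, t.ofLp ⨯₃ b.ofLp])ᵀ

/-- The set of admissible frames `(y, b) ∈ H² × H¹`; the boundary operator is the composition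
of the boundary values with the linear map `Λ`. -/
structure IsFrame {W : Type*} [NormedAddCommGroup W] [NormedSpace ℝ W]
    (L : ℝ) (Λ : BdryData →L[ℝ] W) (ell : W) (y b : ℝ → E3) : Prop where
  memH2 : MemH2 L y
  memH1 : MemH1 L b
  frame : ∀ᵐ x ∂(dom L),
    frameMatrix (cderiv L y x) (b x) ∈ Matrix.specialOrthogonalGroup (Fin 3) ℝ
  bc : Λ (bdry L y b) = ell

/-- `(yσ, bσ)` is a smooth admissible frame which approximates `(y, b)` with tolerance `σ`. -/
structure IsSmoothApprox {W : Type*} [NormedAddCommGroup W] [NormedSpace ℝ W]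
    (L : ℝ) (Λ : BdryData →L[ℝ] W) (ell : W) (y b : ℝ → E3) (σ : ℝ) (yσ bσ : ℝ → E3) :
    Prop where
  smooth_y : ContDiffOn ℝ ∞ yσ (Set.Ioo 0 L)
  smooth_b : ContDiffOn ℝ ∞ bσ (Set.Ioo 0 L)
  memH3 : MemH3 L yσ
  memH2 : MemH2 L bσ
  isFrame : IsFrame L Λ ell yσ bσ
  close : h2Norm L (y - yσ) + h1Norm L (b - bσ)
    + √(∫ x, (inner ℝ (cderiv L yσ x) (weakDeriv L bσ x)) ^ 2 ∂(dom L)) ≤ σ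

/-- `[y, b]_σ`: the norm `‖yσ‖_{H³} + ‖bσ‖_{H²}` of smooth frames approximating `(y, b)` with
tolerance `σ`. No particular approximation is singled out: the infimum over all of them is taken,
which is `∞` if there is none. -/
def regNorm {W : Type*} [NormedAddCommGroup W] [NormedSpace ℝ W]
    (L : ℝ) (Λ : BdryData →L[ℝ] W) (ell : W) (y b : ℝ → E3) (σ : ℝ) : ℝ≥0∞ :=
  ⨅ (yσ : ℝ → E3) (bσ : ℝ → E3) (_ : IsSmoothApprox L Λ ell y b σ yσ bσ),
    ENNReal.ofReal (h3Norm L yσ + h2Norm L bσ)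

/-! ### Regularization -/

/-- A family `m δ = |·|_δ`, `δ ≥ 0`, of regularized modulus functions. The smoothness requirements
concern `δ > 0`; for `δ = 0` the function is the modulus by `uniform`. -/
structure IsRegModulus (m : ℝ → ℝ → ℝ) (c₀ c₁ c₂ cuni : ℝ) : Prop where
  c₀_pos : 0 < c₀
  nonneg : ∀ δ, 0 ≤ δ → ∀ x, 0 ≤ m δ x
  contDiff : ∀ δ, 0 < δ → ContDiff ℝ 2 (m δ)
  lower : ∀ δ, 0 ≤ δ → ∀ x, c₀ * δ ≤ m δ x
  deriv_le : ∀ δ, 0 < δ → ∀ x, deriv (m δ) x ≤ c₁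
  deriv2_le : ∀ δ, 0 < δ → ∀ x, iteratedDeriv 2 (m δ) x ≤ c₂ * δ⁻¹
  uniform : ∀ δ, 0 ≤ δ → ∀ x, |m δ x - (|x|)| ≤ cuni * δ

/-- `ψ(α², β²) = |α² - β²|_δ + 4 β⁴ / (α² + β² + |α² - β²|_δ)` as a function of `s = α²` and
`t = β²`, where `mδ = |·|_δ`. -/
def psi (mδ : ℝ → ℝ) (s t : ℝ) : ℝ :=
  mδ (s - t) + 4 * t ^ 2 / (s + t + mδ (s - t))

/-- The penalty functional `P_ε[y, b]` for `ε = (ε₁, ε₂)`. -/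
def penalty (L ε₁ ε₂ : ℝ) (y b : ℝ → E3) : ℝ :=
  1 / (2 * ε₁) * ∫ x, (inner ℝ (cderiv L y x) (b x)) ^ 2 ∂(dom L)
    + 1 / (2 * ε₂) * ∫ x, (inner ℝ (cderiv L y x) (weakDeriv L b x)) ^ 2 ∂(dom L)

/-- The energy `E_{δ,ε,h}` (the mesh enters only through the arguments), where `mδ = |·|_δ`. -/
def discreteEnergy (L : ℝ) (mδ : ℝ → ℝ) (ε₁ ε₂ : ℝ) (y b : ℝ → E3) : ℝ :=
  1 / 2 * ∫ x, (‖deriv2 L y x‖ ^ 2 + 5 * ‖weakDeriv L b x‖ ^ 2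
      + psi mδ (‖deriv2 L y x‖ ^ 2) (‖weakDeriv L b x‖ ^ 2)) ∂(dom L)
    + penalty L ε₁ ε₂ y b

/-! ### Finite element spaces -/

/-- A partition `0 = x₀ < x₁ < ⋯ < x_N = L`. -/
structure Partition (L : ℝ) where
  N : ℕ
  node : Fin (N + 1) → ℝ
  strictMono : StrictMono node
  node_zero : node 0 = 0
  node_last : node (Fin.last N) = L

/-- The length of the element number `j`. -/
def Partition.size {L : ℝ} (T : Partition L) (j : Fin T.N) : ℝ :=
  T.node j.succ - T.node j.castSucc

/-- The maximal mesh-size `h`. -/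
def Partition.mesh {L : ℝ} (T : Partition L) : ℝ := ⨆ j : Fin T.N, T.size j

/-- The vector-valued finite element space `S^{p,k}(T)³`: `C^k` functions which are componentwise
polynomials of degree at most `p` on each element. -/
def Partition.IsSpline {L : ℝ} (T : Partition L) (p k : ℕ) (v : ℝ → E3) : Prop :=
  ContDiffOn ℝ k v (Set.Icc 0 L) ∧
    ∀ (j : Fin T.N) (i : Fin 3), ∃ q : Polynomial ℝ, q.natDegree ≤ p ∧
      ∀ x ∈ Set.Icc (T.node j.castSucc) (T.node j.succ), v x i = q.eval x

/-- Discrete admissible pairs: cubic `C¹` elements for `y`, linear `C⁰` elements for `b`, unit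
length of `y'` and `b` at the nodes, and the boundary conditions. -/
structure Partition.IsAdmissible {W : Type*} [NormedAddCommGroup W] [NormedSpace ℝ W]
    {L : ℝ} (T : Partition L) (Λ : BdryData →L[ℝ] W) (ell : W) (y b : ℝ → E3) : Prop where
  spline_y : T.IsSpline 3 1 y
  spline_b : T.IsSpline 1 0 b
  unit_y : ∀ j, ‖cderiv L y (T.node j)‖ ^ 2 = 1
  unit_b : ∀ j, ‖b (T.node j)‖ ^ 2 = 1
  bc : Λ (bdry L y b) = ell

end Ribbon

end

/-!
The proof rests on two descriptions of the objects involved.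

* A function in `H¹` is a primitive of its square integrable weak derivative (`IsPrimitive`). The
  equivalence consists of integration by parts for absolutely continuous functions and of the lemma
  of du Bois-Reymond (`HasWeakDeriv.isPrimitive`). All estimates are carried out for primitives.
* The density satisfies `Qbar α β = (max_{0 ≤ μ ≤ 1} (1 - μ²) α + 2 μ β)²` for `α, β ≥ 0`. As the
  square of a nonnegative maximum of increasing linear functions it is convex and the square root
  is Lipschitz continuous. Hence the energy is weakly lower semicontinuous
  (`exists_le_integral_Qbar`) and strongly continuous (`tendsto_integral_Qbar`) in `(y'', b')`. The
  regularized density differs from `Qbar` by a multiple of `δ`, uniformly in `α` and `β`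
  (`abs_regularized_sub_le`).

For recovery sequences, a smooth frame that nearly realizes `[y, b]_σ` is interpolated: `b` by its
nodal values, and `y'` by the piecewise quadratic function with the same nodal values and the same
element means, so that its primitive `y_h` interpolates `y` as well. The interpolants inherit unit
length at the nodes and the boundary data, and the errors of `y_h''` and `b_h'` in `L²` are of order
`h [y, b]_σ`. The first penalty term is controlled by `h²`, since `y_h' · b_h` vanishes at the nodes
while its increments on an element are bounded by integrals of `|y_h''|` and `|b_h'|`; in the second
one, `y_h' · b_h'` differs from the corresponding product of the smooth frame by interpolation
errors only. Here `h [y, b]_σ → 0` holds because `ε₂` is bounded, and `[y, b]_σ ≥ √L` ensures that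
a frame with norm at most `2 [y, b]_σ` exists.

For the lower bound, a weakly convergent subsequence of a bounded sequence is obtained from the
sequential Banach–Alaoglu theorem for the second and first derivatives and from the convergence of
the initial values. Weak convergence in `H¹` of bounded sequences implies pointwise convergence,
which transfers the boundary conditions and the unit length (nodal values determine the length up
to `√h`) to the limit. Bounded energies force both products `y_h' · b_h` and `y_h' · b_h'` to vanish
in the limit, and products of a strongly and a weakly convergent sequence have the expected limits
(`inner_ae_eq_zero_of_tendsto`).
-/

namespace Ribbon

noncomputable section

/-! ### Integrals over `(0, L)` -/

variable {L : ℝ} {f g f' g' u : ℝ → E3}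

instance (L : ℝ) : IsFiniteMeasure (dom L) := by unfold dom; infer_instance

theorem integral_dom {F : Type*} [NormedAddCommGroup F] [NormedSpace ℝ F] (hL : 0 < L)
    (f : ℝ → F) : ∫ x, f x ∂(dom L) = ∫ x in (0 : ℝ)..L, f x := by
  rw [intervalIntegral.integral_of_le hL.le, integral_Ioc_eq_integral_Ioo, dom]

theorem ae_dom_iff {p : ℝ → Prop} :
    (∀ᵐ x ∂(dom L), p x) ↔ ∀ᵐ x, x ∈ Set.Ioo 0 L → p x :=
  ae_restrict_iff' measurableSet_Ioo

theorem ae_dom_mem (L : ℝ) : ∀ᵐ x ∂(dom L), x ∈ Set.Ioo 0 L :=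
  ae_restrict_mem measurableSet_Ioo

theorem intervalIntegrable_of_dom {F : Type*} [NormedAddCommGroup F] {f : ℝ → F}
    (hf : Integrable f (dom L)) {a b : ℝ} (ha : a ∈ Set.Icc 0 L) (hb : b ∈ Set.Icc 0 L) :
    IntervalIntegrable f volume a b := by
  have h0L : (0 : ℝ) ≤ L := ha.1.trans ha.2
  have h1 : IntegrableOn f (Set.Icc 0 L) := by
    rw [integrableOn_Icc_iff_integrableOn_Ioo]; exact hf
  have h2 : IntervalIntegrable f volume 0 L :=
    (intervalIntegrable_iff_integrableOn_Icc_of_le h0L).2 h1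
  refine h2.mono_set ?_
  rw [Set.uIcc_of_le h0L]
  exact Set.uIcc_subset_Icc ha hb

theorem integral_le_dom {f : ℝ → ℝ} (hf : Integrable f (dom L)) (h0 : ∀ x, 0 ≤ f x) {a b : ℝ}
    (ha : 0 ≤ a) (hab : a ≤ b) (hb : b ≤ L) :
    ∫ x in a..b, f x ≤ ∫ x, f x ∂(dom L) := by
  rw [intervalIntegral.integral_of_le hab, integral_Ioc_eq_integral_Ioo]
  exact setIntegral_mono_set hf (Eventually.of_forall h0)
    (Set.Ioo_subset_Ioo ha hb).eventuallyLE

theorem integral_dom_const (hL : 0 < L) (c : ℝ) : ∫ _, c ∂(dom L) = L * c := by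
  rw [integral_dom hL]; simp

/-- The Cauchy–Schwarz inequality for integrals of products. -/
theorem sq_integral_mul_le {α : Type*} [MeasurableSpace α] {μ : Measure α} {f g : α → ℝ}
    (hf : MemLp f 2 μ) (hg : MemLp g 2 μ) :
    (∫ x, f x * g x ∂μ) ^ 2 ≤ (∫ x, f x ^ 2 ∂μ) * ∫ x, g x ^ 2 ∂μ := by
  have hfg : Integrable (fun x => f x * g x) μ := hf.integrable_mul hg
  have key : ∀ t : ℝ, 0 ≤ (∫ x, g x ^ 2 ∂μ) * (t * t) + (2 * ∫ x, f x * g x ∂μ) * t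
      + ∫ x, f x ^ 2 ∂μ := by
    intro t
    have h : ∫ x, (f x + t * g x) ^ 2 ∂μ = (∫ x, g x ^ 2 ∂μ) * (t * t)
        + (2 * ∫ x, f x * g x ∂μ) * t + ∫ x, f x ^ 2 ∂μ := by
      have : ∀ x, (f x + t * g x) ^ 2 = (t * t) * g x ^ 2 + (2 * t) * (f x * g x) + f x ^ 2 := by
        intro x; ring
      simp_rw [this]
      rw [integral_add, integral_add, integral_const_mul, integral_const_mul]
      · ring
      · exact hg.integrable_sq.const_mul _
      · exact hfg.const_mul _
      · exact (hg.integrable_sq.const_mul _).add (hfg.const_mul _)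
      · exact hf.integrable_sq
    rw [← h]
    exact integral_nonneg fun x => sq_nonneg _
  have := discrim_le_zero key
  rw [discrim] at this
  nlinarith

theorem abs_integral_mul_le {α : Type*} [MeasurableSpace α] {μ : Measure α} {f g : α → ℝ}
    (hf : MemLp f 2 μ) (hg : MemLp g 2 μ) :
    |∫ x, f x * g x ∂μ| ≤ √(∫ x, f x ^ 2 ∂μ) * √(∫ x, g x ^ 2 ∂μ) := by
  rw [← Real.sqrt_mul (integral_nonneg fun x => sq_nonneg _)]
  exact Real.abs_le_sqrt (sq_integral_mul_le hf hg)

theorem memLp_Ioo_mono {F : Type*} [NormedAddCommGroup F] {f : ℝ → F} (hf : MemLp f 2 (dom L))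
    {a b : ℝ} (ha : 0 ≤ a) (hb : b ≤ L) :
    MemLp f 2 (volume.restrict (Set.Ioo a b)) :=
  hf.mono_measure (Measure.restrict_mono (Set.Ioo_subset_Ioo ha hb) le_rfl)

theorem sq_integral_norm_le {F : Type*} [NormedAddCommGroup F] {f : ℝ → F}
    (hf : MemLp f 2 (dom L)) {a b : ℝ} (ha : 0 ≤ a) (hab : a ≤ b) (hb : b ≤ L) :
    (∫ x in a..b, ‖f x‖) ^ 2 ≤ (b - a) * ∫ x in a..b, ‖f x‖ ^ 2 := by
  rw [intervalIntegral.integral_of_le hab, intervalIntegral.integral_of_le hab,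
    integral_Ioc_eq_integral_Ioo, integral_Ioc_eq_integral_Ioo]
  have h1 : MemLp (fun _ : ℝ => (1 : ℝ)) 2 (volume.restrict (Set.Ioo a b)) := memLp_const 1
  have := sq_integral_mul_le h1 (memLp_Ioo_mono hf ha hb).norm
  simpa [hab] using this

theorem integrable_of_memLp {F : Type*} [NormedAddCommGroup F] {f : ℝ → F}
    (hf : MemLp f 2 (dom L)) : Integrable f (dom L) :=
  hf.integrable (by norm_num)

theorem integrable_norm_sq (hf : MemLp f 2 (dom L)) :
    Integrable (fun x => ‖f x‖ ^ 2) (dom L) := hf.norm.integrable_sq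

theorem l2Sq_nonneg (L : ℝ) (f : ℝ → E3) : 0 ≤ l2Sq L f := integral_nonneg fun _ => sq_nonneg _

theorem l2Sq_congr (h : f =ᵐ[dom L] g) : l2Sq L f = l2Sq L g :=
  integral_congr_ae (by filter_upwards [h] with x hx; rw [hx])

theorem l2Sq_congr_Icc (h : Set.EqOn f g (Set.Icc 0 L)) : l2Sq L f = l2Sq L g :=
  l2Sq_congr (by filter_upwards [ae_dom_mem L] with x hx using h ⟨hx.1.le, hx.2.le⟩)

theorem l2Sq_add_le (hf : MemLp f 2 (dom L)) (hg : MemLp g 2 (dom L)) :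
    l2Sq L (fun x => f x + g x) ≤ 2 * l2Sq L f + 2 * l2Sq L g := by
  unfold l2Sq
  rw [← integral_const_mul, ← integral_const_mul, ← integral_add]
  · refine integral_mono (integrable_norm_sq (hf.add hg)) ?_ ?_
    · exact ((integrable_norm_sq hf).const_mul 2).add ((integrable_norm_sq hg).const_mul 2)
    · intro x
      have := norm_add_le (f x) (g x)
      have h2 := norm_nonneg (f x + g x)
      simp only
      nlinarith [sq_nonneg (‖f x‖ - ‖g x‖)]
  · exact (integrable_norm_sq hf).const_mul 2
  · exact (integrable_norm_sq hg).const_mul 2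

theorem memLp_of_continuousOn (hf : ContinuousOn f (Set.Icc 0 L)) : MemLp f 2 (dom L) := by
  obtain ⟨C, hC⟩ := isCompact_Icc.exists_bound_of_continuousOn hf
  refine MemLp.of_bound ?_ C ?_
  · exact (hf.mono Set.Ioo_subset_Icc_self).aestronglyMeasurable measurableSet_Ioo
  · filter_upwards [ae_dom_mem L] with x hx using hC x ⟨hx.1.le, hx.2.le⟩

theorem integrable_inner (hf : MemLp f 2 (dom L)) (hg : MemLp g 2 (dom L)) :
    Integrable (fun x => inner ℝ (f x) (g x)) (dom L) :=
  (hf.norm.integrable_mul hg.norm).mono (hf.1.inner hg.1)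
    (Eventually.of_forall fun x => by simpa using abs_real_inner_le_norm _ _)

theorem abs_integral_inner_le (hf : MemLp f 2 (dom L)) (hg : MemLp g 2 (dom L)) :
    |∫ x, inner ℝ (f x) (g x) ∂(dom L)| ≤ √(l2Sq L f) * √(l2Sq L g) := by
  refine le_trans ?_ (le_trans (le_abs_self _) (abs_integral_mul_le hf.norm hg.norm))
  rw [← Real.norm_eq_abs]
  refine norm_integral_le_of_norm_le (hf.norm.integrable_mul hg.norm) (Eventually.of_forall ?_)
  intro x
  exact norm_inner_le_norm _ _

/-! ### Primitives and weak derivatives -/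

/-- `f` is a primitive on `[0, L]` of the square integrable function `g`. This describes
`f ∈ H¹(0, L; ℝ³)` with weak derivative `g`, without test functions. -/
structure IsPrimitive (L : ℝ) (f g : ℝ → E3) : Prop where
  memLp : MemLp g 2 (dom L)
  eq : ∀ x ∈ Set.Icc 0 L, f x = f 0 + ∫ t in (0 : ℝ)..x, g t

namespace IsPrimitive

theorem integrable (h : IsPrimitive L f g) : Integrable g (dom L) := integrable_of_memLp h.memLp

theorem sub_eq (h : IsPrimitive L f g) {x z : ℝ} (hx : x ∈ Set.Icc 0 L) (hz : z ∈ Set.Icc 0 L) :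
    f x - f z = ∫ t in z..x, g t := by
  have h0 : (0 : ℝ) ∈ Set.Icc 0 L := ⟨le_rfl, hx.1.trans hx.2⟩
  rw [h.eq x hx, h.eq z hz, add_sub_add_left_eq_sub,
    intervalIntegral.integral_interval_sub_left (intervalIntegrable_of_dom h.integrable h0 hx)
      (intervalIntegrable_of_dom h.integrable h0 hz)]

theorem continuousOn (h : IsPrimitive L f g) : ContinuousOn f (Set.Icc 0 L) := by
  rcases le_or_gt 0 L with hL | hL
  · have h1 : IntegrableOn g (Set.uIcc 0 L) := by
      rw [Set.uIcc_of_le hL]; 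
      rw [integrableOn_Icc_iff_integrableOn_Ioo]; exact h.integrable
    have := (intervalIntegral.continuousOn_primitive_interval h1).const_add (f 0)
    rw [Set.uIcc_of_le hL] at this
    exact this.congr h.eq
  · rw [Set.Icc_eq_empty (not_le.2 hL)]; exact continuousOn_empty _

theorem congr (h : IsPrimitive L f g) (hf : Set.EqOn f' f (Set.Icc 0 L))
    (hg : g' =ᵐ[dom L] g) : IsPrimitive L f' g' where
  memLp := h.memLp.ae_eq hg.symm
  eq x hx := by
    have h0 : (0 : ℝ) ∈ Set.Icc 0 L := ⟨le_rfl, hx.1.trans hx.2⟩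
    rw [hf hx, hf h0, h.eq x hx, intervalIntegral.integral_of_le hx.1,
      intervalIntegral.integral_of_le hx.1, integral_Ioc_eq_integral_Ioo,
      integral_Ioc_eq_integral_Ioo]
    congr 1
    have hg' := ae_restrict_of_ae_restrict_of_subset (Set.Ioo_subset_Ioo le_rfl hx.2) hg
    exact (integral_congr_ae hg').symm

theorem sub (h : IsPrimitive L f g) (h' : IsPrimitive L f' g') :
    IsPrimitive L (f - f') (g - g') where
  memLp := h.memLp.sub h'.memLp
  eq x hx := by
    have h0 : (0 : ℝ) ∈ Set.Icc 0 L := ⟨le_rfl, hx.1.trans hx.2⟩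
    simp only [Pi.sub_apply]
    rw [intervalIntegral.integral_sub (intervalIntegrable_of_dom h.integrable h0 hx)
      (intervalIntegrable_of_dom h'.integrable h0 hx), h.eq x hx, h'.eq x hx]
    abel

theorem norm_sub_le (h : IsPrimitive L f g) {x z : ℝ} (hz : 0 ≤ z) (hzx : z ≤ x) (hx : x ≤ L) :
    ‖f x - f z‖ ≤ ∫ t in z..x, ‖g t‖ := by
  rw [h.sub_eq ⟨hz.trans hzx, hx⟩ ⟨hz, hzx.trans hx⟩]
  exact intervalIntegral.norm_integral_le_integral_norm hzx

theorem sq_norm_sub_le (h : IsPrimitive L f g) {x z : ℝ} (hx : x ∈ Set.Icc 0 L)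
    (hz : z ∈ Set.Icc 0 L) : ‖f x - f z‖ ^ 2 ≤ |x - z| * l2Sq L g := by
  wlog hzx : z ≤ x generalizing x z
  · rw [norm_sub_rev, abs_sub_comm]; exact this hz hx (le_of_not_ge hzx)
  rw [abs_of_nonneg (sub_nonneg.2 hzx)]
  calc ‖f x - f z‖ ^ 2 ≤ (∫ t in z..x, ‖g t‖) ^ 2 := by
        gcongr; exact h.norm_sub_le hz.1 hzx hx.2
    _ ≤ (x - z) * ∫ t in z..x, ‖g t‖ ^ 2 := sq_integral_norm_le h.memLp hz.1 hzx hx.2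
    _ ≤ (x - z) * l2Sq L g :=
        mul_le_mul_of_nonneg_left (integral_le_dom (integrable_norm_sq h.memLp)
          (fun _ => sq_nonneg _) hz.1 hzx hx.2) (sub_nonneg.2 hzx)

theorem memLp_fun (h : IsPrimitive L f g) : MemLp f 2 (dom L) :=
  memLp_of_continuousOn h.continuousOn

/-- The embedding of `H¹` into the bounded functions. -/
theorem sq_norm_le (h : IsPrimitive L f g) (hL : 0 < L) {x : ℝ} (hx : x ∈ Set.Icc 0 L) :
    ‖f x‖ ^ 2 ≤ 2 / L * l2Sq L f + 2 * L * l2Sq L g := by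
  have h1 : ∫ _, ‖f x‖ ^ 2 ∂(dom L) ≤
      ∫ z, (2 * ‖f z‖ ^ 2 + 2 * (L * l2Sq L g)) ∂(dom L) := by
    refine integral_mono_ae (integrable_const _) ?_ ?_
    · exact ((integrable_norm_sq h.memLp_fun).const_mul 2).add (integrable_const _)
    · filter_upwards [ae_dom_mem L] with z hz
      have h2 := h.sq_norm_sub_le hx (Set.Ioo_subset_Icc_self hz)
      have h3 : |x - z| ≤ L := abs_le.2 ⟨by linarith [hx.1, hz.2], by linarith [hx.2, hz.1]⟩
      have h4 : ‖f x - f z‖ ^ 2 ≤ L * l2Sq L g :=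
        h2.trans (mul_le_mul_of_nonneg_right h3 (l2Sq_nonneg _ _))
      have h5 : ‖f x‖ ≤ ‖f x - f z‖ + ‖f z‖ := by
        simpa using norm_add_le (f x - f z) (f z)
      nlinarith [norm_nonneg (f x), sq_nonneg (‖f x - f z‖ - ‖f z‖)]
  rw [integral_dom_const hL, integral_add ((integrable_norm_sq h.memLp_fun).const_mul 2)
    (integrable_const _), integral_const_mul, integral_dom_const hL] at h1
  have h6 : ‖f x‖ ^ 2 = (L * ‖f x‖ ^ 2) / L := by field_simp
  rw [h6, div_le_iff₀ hL]
  calc L * ‖f x‖ ^ 2 ≤ _ := h1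
    _ = _ := by unfold l2Sq; field_simp

theorem sq_norm_le_of_zero (h : IsPrimitive L f g) (hL : 0 < L) (h0 : f 0 = 0) {x : ℝ}
    (hx : x ∈ Set.Icc 0 L) : ‖f x‖ ^ 2 ≤ L * l2Sq L g := by
  have h2 := h.sq_norm_sub_le hx ⟨le_rfl, hL.le⟩
  rw [h0, sub_zero, sub_zero, abs_of_nonneg hx.1] at h2
  exact h2.trans (mul_le_mul_of_nonneg_right hx.2 (l2Sq_nonneg _ _))

theorem l2Sq_le_of_zero (h : IsPrimitive L f g) (hL : 0 < L) (h0 : f 0 = 0) :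
    l2Sq L f ≤ L ^ 2 * l2Sq L g := by
  calc l2Sq L f ≤ ∫ _, L * l2Sq L g ∂(dom L) := by
        refine integral_mono_ae (integrable_norm_sq h.memLp_fun) (integrable_const _) ?_
        filter_upwards [ae_dom_mem L] with x hx
        exact h.sq_norm_le_of_zero hL h0 (Set.Ioo_subset_Icc_self hx)
    _ = L ^ 2 * l2Sq L g := by rw [integral_dom_const hL]; ring

theorem sub_const (h : IsPrimitive L f g) (c : E3) : IsPrimitive L (fun x => f x - c) g where
  memLp := h.memLp
  eq x hx := by rw [h.eq x hx]; abel

end IsPrimitive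

theorem integral_apply_E3 {g : ℝ → E3} {a b : ℝ} (hg : IntervalIntegrable g volume a b)
    (i : Fin 3) : (∫ t in a..b, g t) i = ∫ t in a..b, g t i := by
  have := (EuclideanSpace.proj i : E3 →L[ℝ] ℝ).intervalIntegral_comp_comm hg
  simpa using this.symm

/-- Integration by parts, with test functions that need not have compact support. -/
theorem IsPrimitive.integral_deriv_smul (h : IsPrimitive L f g) (hL : 0 < L) {φ : ℝ → ℝ}
    (hφ : ContDiff ℝ 1 φ) :
    ∫ x in (0 : ℝ)..L, deriv φ x • f x
      = φ L • f L - φ 0 • f 0 - ∫ x in (0 : ℝ)..L, φ x • g x := by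
  have h0 : (0 : ℝ) ∈ Set.Icc 0 L := ⟨le_rfl, hL.le⟩
  have h1 : L ∈ Set.Icc 0 L := ⟨hL.le, le_rfl⟩
  have hgi : IntervalIntegrable g volume 0 L := intervalIntegrable_of_dom h.integrable h0 h1
  have hc : Continuous (deriv φ) := hφ.continuous_deriv le_rfl
  have hi1 : IntervalIntegrable (fun x => deriv φ x • f x) volume 0 L := by
    refine ContinuousOn.intervalIntegrable ?_
    rw [Set.uIcc_of_le hL.le]
    exact hc.continuousOn.smul h.continuousOn
  have hi2 : IntervalIntegrable (fun x => φ x • g x) volume 0 L :=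
    hgi.continuousOn_smul hφ.continuous.continuousOn
  ext i
  simp only [PiLp.sub_apply, PiLp.smul_apply, smul_eq_mul]
  rw [integral_apply_E3 hi1, integral_apply_E3 hi2]
  simp only [PiLp.smul_apply, smul_eq_mul]
  have hgii : IntervalIntegrable (fun x => g x i) volume 0 L := by
    have := (EuclideanSpace.proj i : E3 →L[ℝ] ℝ).integrable_comp
      ((intervalIntegrable_iff_integrableOn_Ioc_of_le hL.le).1 hgi)
    exact (intervalIntegrable_iff_integrableOn_Ioc_of_le hL.le).2 this
  have hac : AbsolutelyContinuousOnInterval (fun x => ∫ t in (0 : ℝ)..x, g t i) 0 L :=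
    hgii.absolutelyContinuousOnInterval_intervalIntegral Set.left_mem_uIcc
  have hφac : AbsolutelyContinuousOnInterval φ 0 L :=
    hφ.contDiffOn.absolutelyContinuousOnInterval
  have hcac : AbsolutelyContinuousOnInterval (fun _ : ℝ => f 0 i) 0 L :=
    (contDiff_const (n := 1) (c := f 0 i)).contDiffOn.absolutelyContinuousOnInterval
  set F : ℝ → ℝ := fun x => f 0 i + ∫ t in (0 : ℝ)..x, g t i with hF
  have hFac : AbsolutelyContinuousOnInterval F 0 L := hcac.fun_add hac
  have hFf : ∀ x ∈ Set.Icc 0 L, f x i = F x := by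
    intro x hx
    rw [h.eq x hx, PiLp.add_apply, integral_apply_E3 (intervalIntegrable_of_dom h.integrable h0 hx)]
  have key := hFac.integral_mul_deriv_eq_deriv_mul hφac
  have e1 : ∫ x in (0 : ℝ)..L, deriv φ x * f x i = ∫ x in (0 : ℝ)..L, F x * deriv φ x := by
    refine intervalIntegral.integral_congr fun x hx => ?_
    rw [Set.uIcc_of_le hL.le] at hx
    simp only [hFf x hx, mul_comm]
  have e2 : ∫ x in (0 : ℝ)..L, deriv F x * φ x = ∫ x in (0 : ℝ)..L, φ x * g x i := by
    refine intervalIntegral.integral_congr_ae ?_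
    filter_upwards [hgii.ae_hasDerivAt_integral] with x hx hx'
    have := (hx (Set.uIoc_subset_uIcc hx') 0 Set.left_mem_uIcc).const_add (f 0 i)
    rw [this.deriv, mul_comm]
  rw [e1, key, e2, ← hFf L h1, ← hFf 0 h0]
  ring

theorem IsPrimitive.hasWeakDeriv (h : IsPrimitive L f g) (hL : 0 < L) : HasWeakDeriv L f g := by
  intro φ hφ _ hsupp
  have hz : ∀ x, x ∉ Set.Ioo 0 L → φ x = 0 := fun x hx => image_eq_zero_of_notMem_tsupport
    fun h' => hx (hsupp h')
  rw [integral_dom hL, integral_dom hL, h.integral_deriv_smul hL (hφ.of_le (mod_cast le_top)),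
    hz 0 (by simp), hz L (by simp)]
  simp

theorem ae_eq_zero_of_integral_smul (hf : Integrable u (dom L))
    (h : ∀ φ : ℝ → ℝ, ContDiff ℝ ∞ φ → HasCompactSupport φ → tsupport φ ⊆ Set.Ioo 0 L →
      ∫ x, φ x • u x ∂(dom L) = 0) : u =ᵐ[dom L] 0 := by
  refine ae_dom_iff.2 ?_
  refine isOpen_Ioo.ae_eq_zero_of_integral_contDiff_smul_eq_zero
    (IntegrableOn.locallyIntegrableOn hf) ?_
  intro φ h1 h2 h3
  rw [← h φ h1 h2 h3, dom]
  symm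
  refine setIntegral_eq_integral_of_forall_compl_eq_zero fun x hx => ?_
  rw [image_eq_zero_of_notMem_tsupport fun h' => hx (h3 h'), zero_smul]

theorem integrable_smul_of_test {φ : ℝ → ℝ} (hφ : Continuous φ) (hc : HasCompactSupport φ)
    (hg : Integrable g (dom L)) : Integrable (fun x => φ x • g x) (dom L) := by
  obtain ⟨C, hC⟩ := hφ.bounded_above_of_compact_support hc
  exact hg.bdd_smul C hφ.aestronglyMeasurable (Eventually.of_forall hC)

theorem HasWeakDeriv.ae_unique (hg : MemLp g 2 (dom L)) (hg' : MemLp g' 2 (dom L))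
    (h : HasWeakDeriv L f g) (h' : HasWeakDeriv L f g') : g =ᵐ[dom L] g' := by
  have : (fun x => g x - g' x) =ᵐ[dom L] 0 := by
    refine ae_eq_zero_of_integral_smul (integrable_of_memLp (hg.sub hg')) ?_
    intro φ h1 h2 h3
    simp only [smul_sub]
    rw [integral_sub (integrable_smul_of_test h1.continuous h2 (integrable_of_memLp hg))
      (integrable_smul_of_test h1.continuous h2 (integrable_of_memLp hg')), sub_eq_zero]
    have := (h φ h1 h2 h3).symm.trans (h' φ h1 h2 h3)
    exact neg_injective this
  filter_upwards [this] with x hx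
  exact sub_eq_zero.1 hx

end

noncomputable section

variable {L : ℝ} {f g f' g' u : ℝ → E3}

/-! ### The lemma of du Bois-Reymond -/

theorem integral_dom_eq_integral {F : Type*} [NormedAddCommGroup F] [NormedSpace ℝ F] {φ : ℝ → F}
    (h : tsupport φ ⊆ Set.Ioo 0 L) : ∫ x, φ x ∂(dom L) = ∫ x, φ x :=
  setIntegral_eq_integral_of_forall_compl_eq_zero fun _ hx =>
    image_eq_zero_of_notMem_tsupport fun h' => hx (h h')

/-- A test function with vanishing integral is the derivative of a test function. -/
theorem exists_test_primitive {ψ : ℝ → ℝ} (hψ : ContDiff ℝ ∞ ψ) (hc : HasCompactSupport ψ)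
    (hs : tsupport ψ ⊆ Set.Ioo 0 L) (h0 : ∫ x, ψ x = 0) :
    ∃ Φ : ℝ → ℝ, ContDiff ℝ ∞ Φ ∧ HasCompactSupport Φ ∧ tsupport Φ ⊆ Set.Ioo 0 L ∧
      deriv Φ = ψ := by
  rcases (tsupport ψ).eq_empty_or_nonempty with he | hne
  · have hz : ψ = 0 := tsupport_eq_empty_iff.1 he
    refine ⟨0, contDiff_const, HasCompactSupport.zero, ?_, ?_⟩
    · rw [show (0 : ℝ → ℝ) = ψ from hz.symm, he]; exact Set.empty_subset _
    · rw [hz]; ext x; simp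
  have hK : IsCompact (tsupport ψ) := hc
  set a := sInf (tsupport ψ)
  set b := sSup (tsupport ψ)
  have ha : a ∈ tsupport ψ := hK.sInf_mem hne
  have hb : b ∈ tsupport ψ := hK.sSup_mem hne
  have hsub : tsupport ψ ⊆ Set.Icc a b := fun x hx =>
    ⟨csInf_le hK.bddBelow hx, le_csSup hK.bddAbove hx⟩
  have hzero : ∀ x, x ∉ Set.Icc a b → ψ x = 0 := fun x hx =>
    image_eq_zero_of_notMem_tsupport fun h' => hx (hsub h')
  set Φ : ℝ → ℝ := fun x => ∫ t in (0 : ℝ)..x, ψ t with hΦ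
  have hder : ∀ x, HasDerivAt Φ (ψ x) x := fun x =>
    intervalIntegral.integral_hasDerivAt_right (hψ.continuous.intervalIntegrable _ _)
      hψ.continuous.stronglyMeasurable.stronglyMeasurableAtFilter hψ.continuous.continuousAt
  have hderiv : deriv Φ = ψ := funext fun x => (hder x).deriv
  have hsuppΦ : tsupport Φ ⊆ Set.Icc a b := by
    refine closure_minimal ?_ isClosed_Icc
    intro x hx
    by_contra hxab
    refine hx ?_
    rcases lt_or_ge x a with h | h
    · refine (intervalIntegral.integral_congr (g := fun _ => (0 : ℝ)) ?_).trans (by simp)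
      intro t ht
      have : t ≤ max 0 x := ht.2
      refine hzero t fun hmem => ?_
      have := max_lt (hs ha).1 h
      linarith [hmem.1]
    · have hbx : b < x := by
        by_contra h'
        exact hxab ⟨h, not_lt.1 h'⟩
      rw [hΦ]
      simp only
      rw [intervalIntegral.integral_eq_integral_of_support_subset, h0]
      intro t ht
      have := hsub (subset_tsupport _ ht)
      exact ⟨(hs ha).1.trans_le this.1, this.2.trans hbx.le⟩
  refine ⟨Φ, ?_, ?_, ?_, hderiv⟩
  · rw [contDiff_infty_iff_deriv]
    exact ⟨fun x => (hder x).differentiableAt, hderiv ▸ hψ⟩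
  · exact HasCompactSupport.of_support_subset_isCompact isCompact_Icc
      ((subset_tsupport _).trans hsuppΦ)
  · exact hsuppΦ.trans fun x hx => ⟨(hs ha).1.trans_le hx.1, hx.2.trans_lt (hs hb).2⟩

/-- The lemma of du Bois-Reymond: a continuous function with vanishing weak derivative is
constant. -/
theorem HasWeakDeriv.eq_const (hL : 0 < L) (hu : ContinuousOn u (Set.Icc 0 L))
    (h : HasWeakDeriv L u 0) : ∀ x ∈ Set.Icc 0 L, u x = u 0 := by
  have hui : Integrable u (dom L) := by
    have : IntegrableOn u (Set.Icc 0 L) := hu.integrableOn_compact isCompact_Icc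
    exact this.mono_set Set.Ioo_subset_Icc_self
  let B : ContDiffBump (L / 2) := ⟨L / 8, L / 4, by linarith, by linarith⟩
  set ρ : ℝ → ℝ := B.normed volume with hρ
  have hρ1 : ContDiff ℝ ∞ ρ := B.contDiff_normed
  have hρ2 : HasCompactSupport ρ := B.hasCompactSupport_normed
  have hρ3 : tsupport ρ ⊆ Set.Ioo 0 L := by
    rw [hρ, B.tsupport_normed_eq, Real.closedBall_eq_Icc]
    intro x hx
    have h1 : L / 2 - L / 4 ≤ x := hx.1
    have h2 : x ≤ L / 2 + L / 4 := hx.2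
    constructor <;> linarith
  have hρ4 : ∫ x, ρ x = 1 := B.integral_normed
  set c : E3 := ∫ x, ρ x • u x ∂(dom L) with hcdef
  have hae : (fun x => u x - c) =ᵐ[dom L] 0 := by
    refine ae_eq_zero_of_integral_smul (hui.sub (integrable_const c)) ?_
    intro φ h1 h2 h3
    set I : ℝ := ∫ x, φ x
    have hψs : tsupport (fun x => φ x - I * ρ x) ⊆ tsupport φ ∪ tsupport ρ := by
      refine closure_minimal ?_ ((isClosed_tsupport _).union (isClosed_tsupport _))
      intro x hx
      by_contra hx'
      rw [Set.mem_union, not_or] at hx'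
      refine hx ?_
      simp [image_eq_zero_of_notMem_tsupport hx'.1, image_eq_zero_of_notMem_tsupport hx'.2]
    have hφi : Integrable φ := h1.continuous.integrable_of_hasCompactSupport h2
    have hρi : Integrable ρ := hρ1.continuous.integrable_of_hasCompactSupport hρ2
    obtain ⟨Φ, hΦ1, hΦ2, hΦ3, hΦ4⟩ := exists_test_primitive (L := L)
      (ψ := fun x => φ x - I * ρ x)
      (h1.sub (contDiff_const.mul hρ1))
      (HasCompactSupport.of_support_subset_isCompact (h2.isCompact.union hρ2.isCompact)
        ((subset_tsupport _).trans hψs))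
      (hψs.trans (Set.union_subset h3 hρ3))
      (by rw [integral_sub hφi (hρi.const_mul I), integral_const_mul, hρ4, mul_one, sub_self])
    have h4 := h Φ hΦ1 hΦ2 hΦ3
    rw [hΦ4] at h4
    simp only [Pi.zero_apply, smul_zero, integral_zero, neg_zero, sub_smul, mul_smul] at h4
    have hIi : Integrable (fun x => I • ρ x • u x) (dom L) :=
      (integrable_smul_of_test hρ1.continuous hρ2 hui).smul I
    rw [integral_sub (integrable_smul_of_test h1.continuous h2 hui) hIi, integral_smul,
      ← hcdef] at h4
    simp only [smul_sub]
    rw [integral_sub (integrable_smul_of_test h1.continuous h2 hui)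
      (integrable_smul_of_test h1.continuous h2 (integrable_const c)), integral_smul_const,
      integral_dom_eq_integral h3]
    exact h4
  have hEq : Set.EqOn u (fun _ => c) (Set.Icc 0 L) := by
    refine Measure.eqOn_Icc_of_ae_eq volume hL.ne ?_ hu continuousOn_const
    have : u =ᵐ[volume.restrict (Set.Ioo 0 L)] fun _ => c := by
      filter_upwards [hae] with x hx using sub_eq_zero.1 hx
    rwa [Measure.restrict_congr_set Ioo_ae_eq_Icc] at this
  intro x hx
  rw [hEq hx, hEq ⟨le_rfl, hL.le⟩]

theorem isPrimitive_integral (hg : MemLp g 2 (dom L)) :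
    IsPrimitive L (fun x => ∫ t in (0 : ℝ)..x, g t) g :=
  ⟨hg, fun x _ => by simp⟩

theorem HasWeakDeriv.isPrimitive (hL : 0 < L) (hf : ContinuousOn f (Set.Icc 0 L))
    (hg : MemLp g 2 (dom L)) (h : HasWeakDeriv L f g) : IsPrimitive L f g := by
  set G : ℝ → E3 := fun x => ∫ t in (0 : ℝ)..x, g t
  have hG : IsPrimitive L G g := isPrimitive_integral hg
  have hfi : Integrable f (dom L) :=
    IntegrableOn.mono_set (hf.integrableOn_compact isCompact_Icc) Set.Ioo_subset_Icc_self
  have hz : HasWeakDeriv L (fun x => f x - G x) 0 := by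
    intro φ h1 h2 h3
    have hd : Continuous (deriv φ) := h1.continuous_deriv (by simp)
    simp only [Pi.zero_apply, smul_zero, integral_zero, neg_zero, smul_sub]
    rw [integral_sub (integrable_smul_of_test hd h2.deriv hfi)
      (integrable_smul_of_test hd h2.deriv (integrable_of_memLp hG.memLp_fun)),
      h φ h1 h2 h3, hG.hasWeakDeriv hL φ h1 h2 h3, sub_self]
  have := hz.eq_const hL (hf.sub hG.continuousOn)
  refine ⟨hg, fun x hx => ?_⟩
  have h2 := this x hx
  simp only [Pi.sub_apply, G, intervalIntegral.integral_same, sub_zero] at h2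
  rw [← h2]; abel

/-! ### The Sobolev spaces in terms of primitives -/

theorem MemH1.isPrimitive (hL : 0 < L) (h : MemH1 L f) : IsPrimitive L f (weakDeriv L f) := by
  have h2 := h.2
  have hw : weakDeriv L f = h2.choose := by unfold weakDeriv; rw [dif_pos h2]
  rw [hw]
  exact h2.choose_spec.2.isPrimitive hL h.1 h2.choose_spec.1

theorem IsPrimitive.memH1 (h : IsPrimitive L f g) (hL : 0 < L) : MemH1 L f :=
  ⟨h.continuousOn, g, h.memLp, h.hasWeakDeriv hL⟩

theorem IsPrimitive.weakDeriv_ae (h : IsPrimitive L f g) (hL : 0 < L) :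
    weakDeriv L f =ᵐ[dom L] g :=
  HasWeakDeriv.ae_unique ((h.memH1 hL).isPrimitive hL).memLp h.memLp
    (((h.memH1 hL).isPrimitive hL).hasWeakDeriv hL) (h.hasWeakDeriv hL)

theorem hasDerivAt_cderiv (hf : ContDiffOn ℝ 1 f (Set.Icc 0 L)) {x : ℝ} (hx : x ∈ Set.Ioo 0 L) :
    HasDerivAt f (cderiv L f x) x :=
  ((hf.differentiableOn one_ne_zero) x (Set.Ioo_subset_Icc_self hx)).hasDerivWithinAt.hasDerivAt
    (Icc_mem_nhds hx.1 hx.2)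

theorem continuousOn_cderiv (hL : 0 < L) (hf : ContDiffOn ℝ 1 f (Set.Icc 0 L)) :
    ContinuousOn (cderiv L f) (Set.Icc 0 L) :=
  hf.continuousOn_derivWithin (uniqueDiffOn_Icc hL) le_rfl

theorem isPrimitive_cderiv (hL : 0 < L) (hf : ContDiffOn ℝ 1 f (Set.Icc 0 L)) :
    IsPrimitive L f (cderiv L f) := by
  have hc := continuousOn_cderiv hL hf
  refine ⟨memLp_of_continuousOn hc, fun x hx => ?_⟩
  rw [intervalIntegral.integral_eq_sub_of_hasDerivAt_of_le hx.1
    (hf.continuousOn.mono (Set.Icc_subset_Icc le_rfl hx.2))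
    (fun t ht => hasDerivAt_cderiv hf ⟨ht.1, ht.2.trans_le hx.2⟩)]
  · abel
  · exact intervalIntegrable_of_dom (integrable_of_memLp (memLp_of_continuousOn hc))
      ⟨le_rfl, hL.le⟩ hx

theorem MemH2.isPrimitive (hL : 0 < L) (h : MemH2 L f) : IsPrimitive L f (cderiv L f) :=
  isPrimitive_cderiv hL h.1

theorem MemH2.isPrimitive_cderiv (hL : 0 < L) (h : MemH2 L f) :
    IsPrimitive L (cderiv L f) (deriv2 L f) :=
  h.2.isPrimitive hL

theorem MemH2.memH1 (hL : 0 < L) (h : MemH2 L f) : MemH1 L f := (h.isPrimitive hL).memH1 hL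

theorem MemH3.memH2 (hL : 0 < L) (h : MemH3 L f) : MemH2 L f := ⟨h.1, MemH2.memH1 hL h.2⟩

theorem cderiv_sub (hf : ContDiffOn ℝ 1 f (Set.Icc 0 L))
    (hg : ContDiffOn ℝ 1 g (Set.Icc 0 L)) :
    Set.EqOn (cderiv L (f - g)) (cderiv L f - cderiv L g) (Set.Icc 0 L) := by
  intro x hx
  exact derivWithin_sub ((hf.differentiableOn one_ne_zero) x hx)
    ((hg.differentiableOn one_ne_zero) x hx)

theorem h1Sq_sub (hL : 0 < L) (hf : MemH1 L f) (hg : MemH1 L g) :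
    h1Sq L (f - g) = l2Sq L (f - g) + l2Sq L (weakDeriv L f - weakDeriv L g) := by
  unfold h1Sq
  rw [l2Sq_congr (((hf.isPrimitive hL).sub (hg.isPrimitive hL)).weakDeriv_ae hL)]

theorem h2Sq_sub (hL : 0 < L) (hf : MemH2 L f) (hg : MemH2 L g) :
    h2Sq L (f - g) = l2Sq L (f - g) + (l2Sq L (cderiv L f - cderiv L g)
      + l2Sq L (deriv2 L f - deriv2 L g)) := by
  unfold h2Sq h1Sq
  have h := ((hf.isPrimitive_cderiv hL).sub (hg.isPrimitive_cderiv hL)).congr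
    (cderiv_sub hf.1 hg.1) ae_eq_rfl
  rw [l2Sq_congr (h.weakDeriv_ae hL), l2Sq_congr_Icc (cderiv_sub hf.1 hg.1)]

theorem h1Sq_nonneg (L : ℝ) (f : ℝ → E3) : 0 ≤ h1Sq L f :=
  add_nonneg (l2Sq_nonneg _ _) (l2Sq_nonneg _ _)

theorem h2Sq_nonneg (L : ℝ) (f : ℝ → E3) : 0 ≤ h2Sq L f :=
  add_nonneg (l2Sq_nonneg _ _) (h1Sq_nonneg _ _)

theorem h3Sq_nonneg (L : ℝ) (f : ℝ → E3) : 0 ≤ h3Sq L f :=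
  add_nonneg (l2Sq_nonneg _ _) (h2Sq_nonneg _ _)

end

noncomputable section

variable {L : ℝ} {A B A' B' : ℝ → E3}

/-! ### The energy density -/

/-- The square root of `Qbar`, written for nonnegative arguments. It is the support function
`max_{0 ≤ μ ≤ 1} (1 - μ²) α + 2 μ β`; the maximum is attained at `rootArg α β`. -/
def rootQ (α β : ℝ) : ℝ := if α ≤ β then 2 * β else α + β ^ 2 / α

/-- The parameter at which the maximum that represents `rootQ` is attained. -/
def rootArg (α β : ℝ) : ℝ := if α ≤ β then 1 else β / α

theorem rootQ_nonneg {α β : ℝ} (hα : 0 ≤ α) (hβ : 0 ≤ β) : 0 ≤ rootQ α β := by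
  unfold rootQ; split_ifs <;> positivity

theorem rootArg_mem {α β : ℝ} (hα : 0 ≤ α) (hβ : 0 ≤ β) : rootArg α β ∈ Set.Icc (0 : ℝ) 1 := by
  unfold rootArg
  split_ifs with h
  · simp
  · exact ⟨by positivity, div_le_one_of_le₀ (not_le.1 h).le hα⟩

theorem rootQ_eq {α β : ℝ} (hα : 0 ≤ α) :
    rootQ α β = (1 - rootArg α β ^ 2) * α + 2 * rootArg α β * β := by
  unfold rootQ rootArg
  split_ifs with h
  · ring
  · rcases hα.eq_or_lt with rfl | h0
    · simp
    · field_simp; ring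

theorem le_rootQ {α β μ : ℝ} (hα : 0 ≤ α) (hβ : 0 ≤ β) (hμ : μ ∈ Set.Icc (0 : ℝ) 1) :
    (1 - μ ^ 2) * α + 2 * μ * β ≤ rootQ α β := by
  obtain ⟨h0, h1⟩ := hμ
  unfold rootQ
  split_ifs with h
  · have : (1 - μ ^ 2) * α ≤ (1 - μ ^ 2) * β := mul_le_mul_of_nonneg_left h (by nlinarith)
    nlinarith [mul_nonneg hβ (sq_nonneg (1 - μ))]
  · have hpos : 0 < α := hβ.trans_lt (not_le.1 h)
    have : α + β ^ 2 / α - ((1 - μ ^ 2) * α + 2 * μ * β) = α * (μ - β / α) ^ 2 := by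
      field_simp; ring
    nlinarith [mul_nonneg hα (sq_nonneg (μ - β / α))]

theorem Qbar_eq_sq {α β : ℝ} (hα : 0 ≤ α) (hβ : 0 ≤ β) : Qbar α β = rootQ α β ^ 2 := by
  unfold Qbar rootQ
  rw [abs_of_nonneg hα, abs_of_nonneg hβ]
  split_ifs with h
  · ring
  · have hpos : 0 < α := hβ.trans_lt (not_le.1 h)
    field_simp

theorem rootQ_le {α β : ℝ} (hα : 0 ≤ α) (hβ : 0 ≤ β) : rootQ α β ≤ α + 2 * β := by
  rw [rootQ_eq hα]
  obtain ⟨h0, h1⟩ := rootArg_mem hα hβ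
  nlinarith [mul_nonneg hα (sq_nonneg (rootArg α β)), mul_nonneg hβ (sub_nonneg.2 h1)]

theorem rootQ_sub_le {α β α' β' : ℝ} (hα : 0 ≤ α) (hβ : 0 ≤ β) (hα' : 0 ≤ α') (hβ' : 0 ≤ β') :
    rootQ α β - rootQ α' β' ≤ |α - α'| + 2 * |β - β'| := by
  have hm := rootArg_mem hα hβ
  have h1 := le_rootQ hα' hβ' hm
  rw [rootQ_eq hα]
  set μ := rootArg α β
  obtain ⟨h0, h2⟩ := hm
  have h3 : (1 - μ ^ 2) * (α - α') ≤ 1 * |α - α'| :=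
    (mul_le_mul_of_nonneg_left (le_abs_self _) (by nlinarith)).trans
      (mul_le_mul_of_nonneg_right (by nlinarith) (abs_nonneg _))
  have h4 : μ * (β - β') ≤ 1 * |β - β'| :=
    (mul_le_mul_of_nonneg_left (le_abs_self _) h0).trans
      (mul_le_mul_of_nonneg_right h2 (abs_nonneg _))
  nlinarith

theorem abs_rootQ_sub_le {α β α' β' : ℝ} (hα : 0 ≤ α) (hβ : 0 ≤ β) (hα' : 0 ≤ α')
    (hβ' : 0 ≤ β') : |rootQ α β - rootQ α' β'| ≤ |α - α'| + 2 * |β - β'| := by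
  refine abs_le.2 ⟨?_, rootQ_sub_le hα hβ hα' hβ'⟩
  have := rootQ_sub_le hα' hβ' hα hβ
  rw [abs_sub_comm α', abs_sub_comm β'] at this
  linarith

theorem measurable_rootArg : Measurable fun p : ℝ × ℝ => rootArg p.1 p.2 :=
  Measurable.ite (measurableSet_le measurable_fst measurable_snd) measurable_const
    (measurable_snd.div measurable_fst)

theorem measurable_rootQ : Measurable fun p : ℝ × ℝ => rootQ p.1 p.2 :=
  Measurable.ite (measurableSet_le measurable_fst measurable_snd) (measurable_snd.const_mul 2)
    (measurable_fst.add ((measurable_snd.pow_const 2).div measurable_fst))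

theorem aemeasurable_norm_prod (hA : MemLp A 2 (dom L)) (hB : MemLp B 2 (dom L)) :
    AEMeasurable (fun x => (‖A x‖, ‖B x‖)) (dom L) :=
  hA.1.norm.aemeasurable.prodMk hB.1.norm.aemeasurable

theorem memLp_rootQ (hA : MemLp A 2 (dom L)) (hB : MemLp B 2 (dom L)) :
    MemLp (fun x => rootQ ‖A x‖ ‖B x‖) 2 (dom L) := by
  refine (hA.norm.add (hB.norm.const_mul 2)).mono
    (measurable_rootQ.comp_aemeasurable (aemeasurable_norm_prod hA hB)).aestronglyMeasurable ?_
  refine Eventually.of_forall fun x => ?_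
  rw [Real.norm_of_nonneg (rootQ_nonneg (norm_nonneg _) (norm_nonneg _))]
  exact (rootQ_le (norm_nonneg _) (norm_nonneg _)).trans (le_abs_self _)

theorem integrable_Qbar (hA : MemLp A 2 (dom L)) (hB : MemLp B 2 (dom L)) :
    Integrable (fun x => Qbar ‖A x‖ ‖B x‖) (dom L) := by
  simp_rw [Qbar_eq_sq (norm_nonneg _) (norm_nonneg _)]
  exact (memLp_rootQ hA hB).integrable_sq

/-- Weak lower semicontinuity of the energy. Linearizing the convex density at the limit gives
functionals which bound the energy from below and are continuous for the weak convergence. -/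
theorem exists_le_integral_Qbar {An Bn : ℕ → ℝ → E3} (hA : MemLp A 2 (dom L))
    (hB : MemLp B 2 (dom L)) (hAn : ∀ n, MemLp (An n) 2 (dom L))
    (hBn : ∀ n, MemLp (Bn n) 2 (dom L)) (hwA : WeakL2 L An A) (hwB : WeakL2 L Bn B) :
    ∃ l : ℕ → ℝ, (∀ n, l n ≤ ∫ x, Qbar ‖An n x‖ ‖Bn n x‖ ∂(dom L)) ∧
      Tendsto l atTop (𝓝 (∫ x, Qbar ‖A x‖ ‖B x‖ ∂(dom L))) := by
  set g : ℝ → ℝ := fun x => rootQ ‖A x‖ ‖B x‖ with hg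
  set μ : ℝ → ℝ := fun x => rootArg ‖A x‖ ‖B x‖ with hμ
  have hgL : MemLp g 2 (dom L) := memLp_rootQ hA hB
  have hg0 : ∀ x, 0 ≤ g x := fun x => rootQ_nonneg (norm_nonneg _) (norm_nonneg _)
  have hμ0 : ∀ x, μ x ∈ Set.Icc (0 : ℝ) 1 := fun x => rootArg_mem (norm_nonneg _) (norm_nonneg _)
  have hμm : AEMeasurable μ (dom L) :=
    measurable_rootArg.comp_aemeasurable (aemeasurable_norm_prod hA hB)
  have hgm : AEMeasurable g (dom L) := hgL.1.aemeasurable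
  have hsq : ∀ x, μ x ^ 2 ≤ 1 := fun x => pow_le_one₀ (hμ0 x).1 (hμ0 x).2
  have hinv : ∀ v : E3, ‖v‖⁻¹ * ‖v‖ ≤ 1 := fun v => inv_mul_le_one
  have hinv2 : ∀ v : E3, ‖v‖⁻¹ * (‖v‖ * ‖v‖) = ‖v‖ := fun v => by
    rcases eq_or_ne ‖v‖ 0 with h | h
    · simp [h]
    · field_simp
  set φ : ℝ → E3 := fun x => (2 * g x * (1 - μ x ^ 2) * ‖A x‖⁻¹) • A x with hφ
  set ψ : ℝ → E3 := fun x => (2 * g x * (2 * μ x) * ‖B x‖⁻¹) • B x with hψ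
  have hφL : MemLp φ 2 (dom L) := by
    refine (hgL.const_mul 2).mono ?_ (Eventually.of_forall fun x => ?_)
    · exact (((hgm.const_mul 2).mul ((hμm.pow_const 2).const_sub 1)).mul
        hA.1.norm.aemeasurable.inv).aestronglyMeasurable.smul hA.1
    · have h1 : 0 ≤ 1 - μ x ^ 2 := sub_nonneg.2 (hsq x)
      have h2 := hg0 x
      rw [hφ, norm_smul, Real.norm_of_nonneg (by positivity), Real.norm_of_nonneg (by positivity)]
      calc 2 * g x * (1 - μ x ^ 2) * ‖A x‖⁻¹ * ‖A x‖
          = 2 * g x * (1 - μ x ^ 2) * (‖A x‖⁻¹ * ‖A x‖) := by ring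
        _ ≤ 2 * g x * 1 * 1 := by
            gcongr
            · nlinarith [sq_nonneg (μ x)]
            · exact hinv _
        _ = 2 * g x := by ring
  have hψL : MemLp ψ 2 (dom L) := by
    refine (hgL.const_mul 4).mono ?_ (Eventually.of_forall fun x => ?_)
    · exact (((hgm.const_mul 2).mul (hμm.const_mul 2)).mul
        hB.1.norm.aemeasurable.inv).aestronglyMeasurable.smul hB.1
    · have h1 := (hμ0 x).1
      have h2 := hg0 x
      rw [hψ, norm_smul, Real.norm_of_nonneg (by positivity), Real.norm_of_nonneg (by positivity)]
      calc 2 * g x * (2 * μ x) * ‖B x‖⁻¹ * ‖B x‖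
          = 2 * g x * (2 * μ x) * (‖B x‖⁻¹ * ‖B x‖) := by ring
        _ ≤ 2 * g x * (2 * 1) * 1 := by
            gcongr
            · exact (hμ0 x).2
            · exact hinv _
        _ = 4 * g x := by ring
  refine ⟨fun n => ∫ x, inner ℝ (An n x) (φ x) ∂(dom L) + ∫ x, inner ℝ (Bn n x) (ψ x) ∂(dom L)
    - ∫ x, g x ^ 2 ∂(dom L), fun n => ?_, ?_⟩
  · have hi : Integrable (fun x => inner ℝ (An n x) (φ x) + inner ℝ (Bn n x) (ψ x)) (dom L) :=
      (integrable_inner (hAn n) hφL).add (integrable_inner (hBn n) hψL)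
    simp only
    rw [← integral_add (integrable_inner (hAn n) hφL) (integrable_inner (hBn n) hψL),
      ← integral_sub hi hgL.integrable_sq]
    refine integral_mono (hi.sub hgL.integrable_sq) (integrable_Qbar (hAn n) (hBn n)) fun x => ?_
    simp only [hφ, hψ, inner_smul_right]
    rw [Qbar_eq_sq (norm_nonneg _) (norm_nonneg _)]
    have h1 := le_rootQ (norm_nonneg (An n x)) (norm_nonneg (Bn n x)) (hμ0 x)
    have h2 : ‖A x‖⁻¹ * inner ℝ (An n x) (A x) ≤ ‖An n x‖ := by
      calc _ ≤ ‖A x‖⁻¹ * (‖An n x‖ * ‖A x‖) :=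
            mul_le_mul_of_nonneg_left (real_inner_le_norm _ _) (by positivity)
        _ = ‖An n x‖ * (‖A x‖⁻¹ * ‖A x‖) := by ring
        _ ≤ ‖An n x‖ := mul_le_of_le_one_right (norm_nonneg _) (hinv _)
    have h3 : ‖B x‖⁻¹ * inner ℝ (Bn n x) (B x) ≤ ‖Bn n x‖ := by
      calc _ ≤ ‖B x‖⁻¹ * (‖Bn n x‖ * ‖B x‖) :=
            mul_le_mul_of_nonneg_left (real_inner_le_norm _ _) (by positivity)
        _ = ‖Bn n x‖ * (‖B x‖⁻¹ * ‖B x‖) := by ring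
        _ ≤ ‖Bn n x‖ := mul_le_of_le_one_right (norm_nonneg _) (hinv _)
    have h4 := mul_le_mul_of_nonneg_left h2 (sub_nonneg.2 (hsq x))
    have h5 := mul_le_mul_of_nonneg_left h3 (mul_nonneg zero_le_two (hμ0 x).1)
    have h6 := mul_le_mul_of_nonneg_left ((add_le_add h4 h5).trans h1)
      (mul_nonneg zero_le_two (hg0 x))
    nlinarith [sq_nonneg (rootQ ‖An n x‖ ‖Bn n x‖ - g x)]
  · have hlim := ((hwA φ hφL).add (hwB ψ hψL)).sub_const (∫ x, g x ^ 2 ∂(dom L))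
    convert hlim using 2
    have hi : Integrable (fun x => inner ℝ (A x) (φ x) + inner ℝ (B x) (ψ x)) (dom L) :=
      (integrable_inner hA hφL).add (integrable_inner hB hψL)
    rw [← integral_add (integrable_inner hA hφL) (integrable_inner hB hψL), ← integral_sub hi hgL.integrable_sq]
    refine integral_congr_ae (Eventually.of_forall fun x => ?_)
    simp only [hφ, hψ, inner_smul_right, real_inner_self_eq_norm_mul_norm]
    rw [Qbar_eq_sq (norm_nonneg _) (norm_nonneg _)]
    have h1 : g x = (1 - μ x ^ 2) * ‖A x‖ + 2 * μ x * ‖B x‖ := rootQ_eq (norm_nonneg _)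
    change g x ^ 2 = _
    have h2 : 2 * g x * (1 - μ x ^ 2) * ‖A x‖⁻¹ * (‖A x‖ * ‖A x‖)
        = 2 * g x * (1 - μ x ^ 2) * ‖A x‖ := by rw [mul_assoc, hinv2]
    have h3 : 2 * g x * (2 * μ x) * ‖B x‖⁻¹ * (‖B x‖ * ‖B x‖)
        = 2 * g x * (2 * μ x) * ‖B x‖ := by rw [mul_assoc, hinv2]
    rw [h2, h3]
    linear_combination (2 * g x) * h1

theorem abs_integral_Qbar_sub_le (hA : MemLp A 2 (dom L)) (hB : MemLp B 2 (dom L))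
    (hA' : MemLp A' 2 (dom L)) (hB' : MemLp B' 2 (dom L)) {d : ℝ}
    (hd : 2 * l2Sq L (A' - A) + 8 * l2Sq L (B' - B) ≤ d) :
    |∫ x, Qbar ‖A' x‖ ‖B' x‖ ∂(dom L) - ∫ x, Qbar ‖A x‖ ‖B x‖ ∂(dom L)|
      ≤ d + 2 * (√(∫ x, Qbar ‖A x‖ ‖B x‖ ∂(dom L)) * √d) := by
  simp_rw [Qbar_eq_sq (norm_nonneg _) (norm_nonneg _)]
  set R : ℝ → ℝ := fun x => rootQ ‖A x‖ ‖B x‖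
  set R' : ℝ → ℝ := fun x => rootQ ‖A' x‖ ‖B' x‖
  have hR : MemLp R 2 (dom L) := memLp_rootQ hA hB
  have hR' : MemLp R' 2 (dom L) := memLp_rootQ hA' hB'
  have hD : MemLp (fun x => R' x - R x) 2 (dom L) := hR'.sub hR
  have h1 : ∫ x, (R' x - R x) ^ 2 ∂(dom L) ≤ d := by
    refine le_trans ?_ hd
    unfold l2Sq
    have hi1 := (integrable_norm_sq (hA'.sub hA)).const_mul 2
    have hi2 := (integrable_norm_sq (hB'.sub hB)).const_mul 8
    rw [← integral_const_mul, ← integral_const_mul, ← integral_add hi1 hi2]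
    refine integral_mono hD.integrable_sq (hi1.add hi2) fun x => ?_
    have h2 := abs_rootQ_sub_le (norm_nonneg (A' x)) (norm_nonneg (B' x)) (norm_nonneg (A x))
      (norm_nonneg (B x))
    have h3 := abs_norm_sub_norm_le (A' x) (A x)
    have h4 := abs_norm_sub_norm_le (B' x) (B x)
    have h5 : |R' x - R x| ≤ ‖(A' - A) x‖ + 2 * ‖(B' - B) x‖ := by
      simp only [Pi.sub_apply]; exact h2.trans (by linarith)
    have h6 : (R' x - R x) ^ 2 ≤ (‖(A' - A) x‖ + 2 * ‖(B' - B) x‖) ^ 2 :=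
      sq_le_sq' (by linarith [neg_abs_le (R' x - R x)]) ((le_abs_self _).trans h5)
    refine h6.trans ?_
    nlinarith [sq_nonneg (‖(A' - A) x‖ - 2 * ‖(B' - B) x‖)]
  have hRD : Integrable (fun x => 2 * (R x * (R' x - R x))) (dom L) :=
    (hR.integrable_mul hD).const_mul 2
  have h2 : ∫ x, R' x ^ 2 ∂(dom L) - ∫ x, R x ^ 2 ∂(dom L)
      = ∫ x, (R' x - R x) ^ 2 ∂(dom L) + 2 * ∫ x, R x * (R' x - R x) ∂(dom L) := by
    rw [← integral_const_mul, ← integral_add hD.integrable_sq hRD, ← integral_sub hR'.integrable_sq hR.integrable_sq]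
    congr 1; ext x; ring
  have h3 := abs_integral_mul_le hR hD
  have h0 : 0 ≤ ∫ x, (R' x - R x) ^ 2 ∂(dom L) := integral_nonneg fun _ => sq_nonneg _
  change |∫ x, R' x ^ 2 ∂(dom L) - ∫ x, R x ^ 2 ∂(dom L)| ≤ _
  rw [h2]
  refine (abs_add_le _ _).trans (add_le_add ?_ ?_)
  · rwa [abs_of_nonneg h0]
  · rw [abs_mul, abs_two]
    refine mul_le_mul_of_nonneg_left (h3.trans ?_) zero_le_two
    exact mul_le_mul_of_nonneg_left (Real.sqrt_le_sqrt h1) (Real.sqrt_nonneg _)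

/-- Strong continuity of the energy. -/
theorem tendsto_integral_Qbar {An Bn : ℕ → ℝ → E3} (hA : MemLp A 2 (dom L))
    (hB : MemLp B 2 (dom L)) (hAn : ∀ n, MemLp (An n) 2 (dom L))
    (hBn : ∀ n, MemLp (Bn n) 2 (dom L))
    (hcA : Tendsto (fun n => l2Sq L (An n - A)) atTop (𝓝 0))
    (hcB : Tendsto (fun n => l2Sq L (Bn n - B)) atTop (𝓝 0)) :
    Tendsto (fun n => ∫ x, Qbar ‖An n x‖ ‖Bn n x‖ ∂(dom L)) atTop
      (𝓝 (∫ x, Qbar ‖A x‖ ‖B x‖ ∂(dom L))) := by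
  have hd : Tendsto (fun n => 2 * l2Sq L (An n - A) + 8 * l2Sq L (Bn n - B)) atTop (𝓝 0) := by
    simpa using (hcA.const_mul 2).add (hcB.const_mul 8)
  rw [tendsto_iff_norm_sub_tendsto_zero]
  refine squeeze_zero (fun _ => norm_nonneg _)
    (fun n => abs_integral_Qbar_sub_le hA hB (hAn n) (hBn n) le_rfl) ?_
  have := hd.add ((hd.sqrt.const_mul (√(∫ x, Qbar ‖A x‖ ‖B x‖ ∂(dom L)))).const_mul 2)
  simpa using this

/-! ### Regularization of the energy density -/

variable {m : ℝ → ℝ → ℝ} {c₀ c₁ c₂ cuni : ℝ}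

theorem psi_abs_eq {α β : ℝ} (hα : 0 ≤ α) (hβ : 0 ≤ β) :
    1 / 2 * (α ^ 2 + 5 * β ^ 2 + psi abs (α ^ 2) (β ^ 2)) = Qbar α β := by
  rw [Qbar_eq_sq hα hβ]
  unfold psi rootQ
  split_ifs with h
  · have h1 : α ^ 2 ≤ β ^ 2 := by gcongr
    rw [abs_of_nonpos (by linarith)]
    rcases hβ.eq_or_lt with rfl | hb
    · have : α = 0 := le_antisymm h hα
      simp [this]
    · have : α ^ 2 + β ^ 2 + -(α ^ 2 - β ^ 2) = 2 * β ^ 2 := by ring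
      rw [this]; field_simp; ring
  · have hpos : 0 < α := hβ.trans_lt (not_le.1 h)
    have h1 : β ^ 2 ≤ α ^ 2 := by
      have := (not_le.1 h).le
      gcongr
    rw [abs_of_nonneg (by linarith)]
    have : α ^ 2 + β ^ 2 + (α ^ 2 - β ^ 2) = 2 * α ^ 2 := by ring
    rw [this]; field_simp; ring

theorem abs_psi_sub_le {M : ℝ → ℝ} {e s t : ℝ} (hM : 0 ≤ M (s - t))
    (he : |M (s - t) - (|s - t|)| ≤ e) (hs : 0 ≤ s) (ht : 0 ≤ t) :
    |psi M s t - psi abs s t| ≤ 3 * e := by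
  have he0 : 0 ≤ e := (abs_nonneg _).trans he
  unfold psi
  have h1 : |4 * t ^ 2 / (s + t + M (s - t)) - 4 * t ^ 2 / (s + t + |s - t|)| ≤ 2 * e := by
    rcases ht.eq_or_lt with rfl | htp
    · simpa using he0
    have hD : t ≤ s + t + M (s - t) := by linarith
    have hD0 : 2 * t ≤ s + t + |s - t| := by linarith [neg_abs_le (s - t)]
    have hDp : 0 < s + t + M (s - t) := htp.trans_le hD
    have hD0p : 0 < s + t + |s - t| := by linarith
    have h2 : 4 * t ^ 2 / (s + t + M (s - t)) - 4 * t ^ 2 / (s + t + |s - t|)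
        = 4 * t ^ 2 * (|s - t| - M (s - t)) / ((s + t + M (s - t)) * (s + t + |s - t|)) := by
      field_simp; ring
    rw [h2, abs_div, abs_of_pos (mul_pos hDp hD0p), div_le_iff₀ (mul_pos hDp hD0p), abs_mul,
      abs_of_nonneg (by positivity : 0 ≤ 4 * t ^ 2), abs_sub_comm]
    calc 4 * t ^ 2 * |M (s - t) - (|s - t|)| ≤ 4 * t ^ 2 * e := by gcongr
      _ = 2 * e * (t * (2 * t)) := by ring
      _ ≤ 2 * e * ((s + t + M (s - t)) * (s + t + |s - t|)) := by gcongr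
  calc _ = |(M (s - t) - |s - t|)
        + (4 * t ^ 2 / (s + t + M (s - t)) - 4 * t ^ 2 / (s + t + |s - t|))| := by
          congr 1; ring
    _ ≤ e + 2 * e := (abs_add_le _ _).trans (add_le_add he h1)
    _ = 3 * e := by ring

theorem IsRegModulus.measurable (hm : IsRegModulus m c₀ c₁ c₂ cuni) {δ : ℝ} (hδ : 0 ≤ δ) :
    Measurable (m δ) := by
  rcases hδ.eq_or_lt with rfl | h
  · have : m 0 = abs := by
      ext x
      have := hm.uniform 0 le_rfl x
      rw [mul_zero] at this
      exact sub_eq_zero.1 (abs_nonpos_iff.1 this)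
    rw [this]; exact measurable_norm
  · exact (hm.contDiff δ h).continuous.measurable

theorem psi_nonneg {M : ℝ → ℝ} {s t : ℝ} (hM : 0 ≤ M (s - t)) (hs : 0 ≤ s) (ht : 0 ≤ t) :
    0 ≤ psi M s t := by unfold psi; positivity

/-- The regularization changes the energy by at most a multiple of `δ`. -/
theorem abs_regularized_sub_le (hL : 0 < L) (hm : IsRegModulus m c₀ c₁ c₂ cuni) {δ : ℝ}
    (hδ : 0 ≤ δ) (hA : MemLp A 2 (dom L)) (hB : MemLp B 2 (dom L)) :
    |1 / 2 * ∫ x, (‖A x‖ ^ 2 + 5 * ‖B x‖ ^ 2 + psi (m δ) (‖A x‖ ^ 2) (‖B x‖ ^ 2)) ∂(dom L)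
      - ∫ x, Qbar ‖A x‖ ‖B x‖ ∂(dom L)| ≤ L * (3 / 2 * (cuni * δ)) := by
  set F : ℝ → ℝ := fun x => ‖A x‖ ^ 2 + 5 * ‖B x‖ ^ 2 + psi (m δ) (‖A x‖ ^ 2) (‖B x‖ ^ 2)
  have hpt : ∀ x, |1 / 2 * F x - Qbar ‖A x‖ ‖B x‖| ≤ 3 / 2 * (cuni * δ) := by
    intro x
    rw [← psi_abs_eq (norm_nonneg _) (norm_nonneg _)]
    have h := abs_psi_sub_le (hm.nonneg δ hδ _) (hm.uniform δ hδ _) (sq_nonneg ‖A x‖)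
      (sq_nonneg ‖B x‖)
    calc _ = |1 / 2 * (psi (m δ) (‖A x‖ ^ 2) (‖B x‖ ^ 2) - psi abs (‖A x‖ ^ 2) (‖B x‖ ^ 2))| := by
          congr 1; simp only [F]; ring
      _ ≤ _ := by rw [abs_mul, abs_of_pos (by norm_num : (0 : ℝ) < 1 / 2)]; linarith
  have hFm : AEMeasurable F (dom L) := by
    have hmm := hm.measurable hδ
    have ha := hA.1.norm.aemeasurable.pow_const 2
    have hb := hB.1.norm.aemeasurable.pow_const 2
    have hM := hmm.comp_aemeasurable (ha.sub hb)
    exact (ha.add (hb.const_mul 5)).add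
      (hM.add (((hb.pow_const 2).const_mul 4).div ((ha.add hb).add hM)))
  have hQ := integrable_Qbar hA hB
  have hdiff : Integrable (fun x => 1 / 2 * F x - Qbar ‖A x‖ ‖B x‖) (dom L) :=
    (integrable_const (3 / 2 * (cuni * δ))).mono
      ((hFm.const_mul _).aestronglyMeasurable.sub hQ.1) (Eventually.of_forall fun x => by
        rw [Real.norm_eq_abs]
        exact (hpt x).trans (le_abs_self _))
  have hF : Integrable (fun x => 1 / 2 * F x) (dom L) := by
    refine (hdiff.add hQ).congr (Eventually.of_forall fun x => ?_)
    simp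
  rw [← integral_const_mul, ← integral_sub hF hQ, ← integral_dom_const hL]
  exact norm_integral_le_of_norm_le (f := fun x => 1 / 2 * F x - Qbar ‖A x‖ ‖B x‖)
    (integrable_const _) (Eventually.of_forall fun x => hpt x)

end

noncomputable section

variable {L : ℝ} {f g v w : ℝ → E3}

/-! ### Partitions and splines -/

namespace Partition

variable (T : Partition L)

/-- The closed element number `j`. -/
abbrev elt (j : Fin T.N) : Set ℝ := Set.Icc (T.node j.castSucc) (T.node j.succ)

theorem node_lt (j : Fin T.N) : T.node j.castSucc < T.node j.succ :=
  T.strictMono (Fin.castSucc_lt_succ)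

theorem size_pos (j : Fin T.N) : 0 < T.size j := sub_pos.2 (T.node_lt j)

theorem size_le_mesh (j : Fin T.N) : T.size j ≤ T.mesh :=
  le_ciSup (Set.finite_range T.size).bddAbove j

theorem node_mem (k : Fin (T.N + 1)) : T.node k ∈ Set.Icc 0 L :=
  ⟨T.node_zero ▸ T.strictMono.monotone (Fin.zero_le k),
    (T.strictMono.monotone (Fin.le_last k)).trans_eq T.node_last⟩

theorem elt_subset (j : Fin T.N) : T.elt j ⊆ Set.Icc 0 L :=
  Set.Icc_subset_Icc (T.node_mem _).1 (T.node_mem _).2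

theorem N_pos (hL : 0 < L) : 0 < T.N := by
  rcases Nat.eq_zero_or_pos T.N with h | h
  · have : T.node 0 = T.node (Fin.last T.N) := by
      congr 1; ext; simp [h]
    rw [T.node_zero, T.node_last] at this
    exact absurd this hL.ne
  · exact h

theorem mesh_pos (hL : 0 < L) : 0 < T.mesh :=
  (T.size_pos ⟨0, T.N_pos hL⟩).trans_le (T.size_le_mesh _)

theorem exists_mem_elt (hL : 0 < L) {x : ℝ} (hx : x ∈ Set.Icc 0 L) : ∃ j, x ∈ T.elt j := by
  have key : ∀ k : Fin (T.N + 1), x ≤ T.node k → x = 0 ∨ ∃ j, x ∈ T.elt j := by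
    intro k
    induction k using Fin.induction with
    | zero => intro h; left; rw [T.node_zero] at h; exact le_antisymm h hx.1
    | succ i ih =>
      intro h
      rcases le_total x (T.node i.castSucc) with h' | h'
      · exact ih h'
      · exact Or.inr ⟨i, h', h⟩
  rcases key (Fin.last _) (T.node_last.symm ▸ hx.2) with h | h
  · refine ⟨⟨0, T.N_pos hL⟩, ?_⟩
    have h0 : T.node (Fin.castSucc ⟨0, T.N_pos hL⟩) = 0 := T.node_zero
    have h1 := T.node_lt ⟨0, T.N_pos hL⟩
    rw [h0] at h1
    exact ⟨by rw [h0, h], by rw [h]; exact h1.le⟩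
  · exact h

theorem ae_exists_mem_Ioo (hL : 0 < L) :
    ∀ᵐ x ∂(dom L), ∃ j, x ∈ Set.Ioo (T.node (Fin.castSucc j)) (T.node (Fin.succ j)) := by
  have hfin : (Set.range T.node).Finite := Set.finite_range _
  have h0 : ∀ᵐ x ∂(dom L), x ∉ Set.range T.node :=
    ae_restrict_of_ae (hfin.countable.ae_notMem volume)
  filter_upwards [h0, ae_dom_mem L] with x hx hx'
  obtain ⟨j, hj⟩ := T.exists_mem_elt hL (Set.Ioo_subset_Icc_self hx')
  exact ⟨j, lt_of_le_of_ne hj.1 fun h => hx ⟨_, h⟩, lt_of_le_of_ne hj.2 fun h => hx ⟨_, h.symm⟩⟩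

theorem integral_le_of_elements (hL : 0 < L) {F G : ℝ → ℝ} (hF : Integrable F (dom L))
    (hG : Integrable G (dom L))
    (h : ∀ j : Fin T.N, ∫ x in (T.node j.castSucc)..(T.node j.succ), F x
      ≤ ∫ x in (T.node j.castSucc)..(T.node j.succ), G x) :
    ∫ x, F x ∂(dom L) ≤ ∫ x, G x ∂(dom L) := by
  have h0 : (0 : ℝ) ∈ Set.Icc 0 L := ⟨le_rfl, hL.le⟩
  have key : ∀ k : Fin (T.N + 1), ∫ x in (0 : ℝ)..(T.node k), F x
      ≤ ∫ x in (0 : ℝ)..(T.node k), G x := by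
    intro k
    induction k using Fin.induction with
    | zero => simp [T.node_zero]
    | succ i ih =>
      rw [← intervalIntegral.integral_add_adjacent_intervals
        (intervalIntegrable_of_dom hF h0 (T.node_mem i.castSucc))
        (intervalIntegrable_of_dom hF (T.node_mem i.castSucc) (T.node_mem i.succ)),
        ← intervalIntegral.integral_add_adjacent_intervals
        (intervalIntegrable_of_dom hG h0 (T.node_mem i.castSucc))
        (intervalIntegrable_of_dom hG (T.node_mem i.castSucc) (T.node_mem i.succ))]
      exact add_le_add ih (h i)
  have := key (Fin.last _)
  rwa [T.node_last, ← integral_dom hL, ← integral_dom hL] at this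

/-- Elementwise bounds by integrals over the elements gain a factor `h` in the `L²` norm. -/
theorem integral_sq_le_of_elements (hL : 0 < L) {D : ℝ → ℝ} {G₁ G₂ : ℝ → E3}
    (hD : Integrable (fun x => D x ^ 2) (dom L)) (hG₁ : MemLp G₁ 2 (dom L))
    (hG₂ : MemLp G₂ 2 (dom L)) {κ₁ κ₂ : ℝ} (hκ₁ : 0 ≤ κ₁) (hκ₂ : 0 ≤ κ₂)
    (h : ∀ j : Fin T.N, ∀ x ∈ Set.Ioo (T.node j.castSucc) (T.node j.succ),
      D x ^ 2 ≤ κ₁ * (∫ t in (T.node j.castSucc)..(T.node j.succ), ‖G₁ t‖) ^ 2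
        + κ₂ * (∫ t in (T.node j.castSucc)..(T.node j.succ), ‖G₂ t‖) ^ 2) :
    ∫ x, D x ^ 2 ∂(dom L) ≤ T.mesh ^ 2 * (κ₁ * l2Sq L G₁ + κ₂ * l2Sq L G₂) := by
  have hi₁ := (integrable_norm_sq hG₁).const_mul κ₁
  have hi₂ := (integrable_norm_sq hG₂).const_mul κ₂
  have hi : Integrable (fun x => T.mesh ^ 2 * (κ₁ * ‖G₁ x‖ ^ 2 + κ₂ * ‖G₂ x‖ ^ 2)) (dom L) :=
    (hi₁.add hi₂).const_mul _
  have e : T.mesh ^ 2 * (κ₁ * l2Sq L G₁ + κ₂ * l2Sq L G₂)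
      = ∫ x, T.mesh ^ 2 * (κ₁ * ‖G₁ x‖ ^ 2 + κ₂ * ‖G₂ x‖ ^ 2) ∂(dom L) := by
    unfold l2Sq
    rw [integral_const_mul, integral_add hi₁ hi₂, integral_const_mul, integral_const_mul]
  rw [e]
  refine T.integral_le_of_elements hL hD hi fun j => ?_
  have hp := T.node_mem j.castSucc
  have hq := T.node_mem j.succ
  have hlt := T.node_lt j
  have hsz : T.node j.succ - T.node j.castSucc = T.size j := rfl
  have hs0 := (T.size_pos j).le
  have hsm := T.size_le_mesh j
  set p := T.node j.castSucc
  set q := T.node j.succ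
  set M₁ := ∫ t in p..q, ‖G₁ t‖
  set M₂ := ∫ t in p..q, ‖G₂ t‖
  set S₁ := ∫ t in p..q, ‖G₁ t‖ ^ 2
  set S₂ := ∫ t in p..q, ‖G₂ t‖ ^ 2
  have h1 : M₁ ^ 2 ≤ T.size j * S₁ := hsz ▸ sq_integral_norm_le hG₁ hp.1 hlt.le hq.2
  have h2 : M₂ ^ 2 ≤ T.size j * S₂ := hsz ▸ sq_integral_norm_le hG₂ hp.1 hlt.le hq.2
  have hS₁ : 0 ≤ S₁ := intervalIntegral.integral_nonneg hlt.le fun _ _ => sq_nonneg _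
  have hS₂ : 0 ≤ S₂ := intervalIntegral.integral_nonneg hlt.le fun _ _ => sq_nonneg _
  have hi₁' := intervalIntegrable_of_dom hi₁ hp hq
  have hi₂' := intervalIntegrable_of_dom hi₂ hp hq
  have hr : ∫ x in p..q, T.mesh ^ 2 * (κ₁ * ‖G₁ x‖ ^ 2 + κ₂ * ‖G₂ x‖ ^ 2)
      = T.mesh ^ 2 * (κ₁ * S₁ + κ₂ * S₂) := by
    rw [intervalIntegral.integral_const_mul, intervalIntegral.integral_add hi₁' hi₂',
      intervalIntegral.integral_const_mul, intervalIntegral.integral_const_mul]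
  rw [hr]
  calc ∫ x in p..q, D x ^ 2 ≤ ∫ _ in p..q, (κ₁ * M₁ ^ 2 + κ₂ * M₂ ^ 2) :=
        intervalIntegral.integral_mono_on_of_le_Ioo hlt.le (intervalIntegrable_of_dom hD hp hq)
          intervalIntegrable_const fun x hx => h j x hx
    _ = T.size j * (κ₁ * M₁ ^ 2 + κ₂ * M₂ ^ 2) := by
        rw [intervalIntegral.integral_const, smul_eq_mul, hsz]
    _ ≤ T.size j * (κ₁ * (T.size j * S₁) + κ₂ * (T.size j * S₂)) := by gcongr
    _ = T.size j ^ 2 * (κ₁ * S₁ + κ₂ * S₂) := by ring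
    _ ≤ T.mesh ^ 2 * (κ₁ * S₁ + κ₂ * S₂) := by gcongr

/-- Continuous, piecewise `C¹` functions are primitives of their classical derivative, which is
defined off the nodes. -/
theorem isPrimitive_deriv (hL : 0 < L) (hv : ContinuousOn v (Set.Icc 0 L))
    (hp : ∀ j : Fin T.N, ∃ P : ℝ → E3, ContDiff ℝ 1 P ∧
      Set.EqOn v P (Set.Ioo (T.node j.castSucc) (T.node j.succ))) :
    IsPrimitive L v (deriv v) := by
  choose P hP hvP using hp
  have hnear : ∀ j, ∀ x ∈ Set.Ioo (T.node (Fin.castSucc j)) (T.node (Fin.succ j)),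
      HasDerivAt v (deriv (P j) x) x := by
    intro j x hx
    have h1 := ((hP j).differentiable one_ne_zero x).hasDerivAt
    exact h1.congr_of_eventuallyEq ((hvP j).eventuallyEq_of_mem (Ioo_mem_nhds hx.1 hx.2))
  have hbd : ∀ j, ∃ C, ∀ x ∈ T.elt j, ‖deriv (P j) x‖ ≤ C := fun j =>
    isCompact_Icc.exists_bound_of_continuousOn ((hP j).continuous_deriv le_rfl).continuousOn
  choose C hC using hbd
  have hmem : MemLp (deriv v) 2 (dom L) := by
    refine MemLp.of_bound (stronglyMeasurable_deriv v).aestronglyMeasurable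
      (∑ j, |C j|) ?_
    filter_upwards [T.ae_exists_mem_Ioo hL] with x ⟨j, hj⟩
    rw [(hnear j x hj).deriv]
    exact ((hC j x (Set.Ioo_subset_Icc_self hj)).trans (le_abs_self _)).trans
      (Finset.single_le_sum (f := fun j => |C j|) (fun _ _ => abs_nonneg _) (Finset.mem_univ j))
  refine ⟨hmem, fun x hx => ?_⟩
  have hcount : (Set.range T.node).Countable := (Set.finite_range _).countable
  rw [MeasureTheory.integral_eq_of_hasDerivAt_off_countable_of_le v (deriv v) hx.1 hcount
    (hv.mono (Set.Icc_subset_Icc le_rfl hx.2))]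
  · abel
  · rintro t ⟨ht, htn⟩
    have ht' : t ∈ Set.Icc 0 L := ⟨ht.1.le, ht.2.le.trans hx.2⟩
    obtain ⟨j, hj⟩ := T.exists_mem_elt hL ht'
    have hjo : t ∈ Set.Ioo (T.node j.castSucc) (T.node j.succ) :=
      ⟨lt_of_le_of_ne hj.1 fun h => htn ⟨_, h⟩, lt_of_le_of_ne hj.2 fun h => htn ⟨_, h.symm⟩⟩
    have := hnear j t hjo
    rwa [this.deriv]
  · exact intervalIntegrable_of_dom (integrable_of_memLp hmem) ⟨le_rfl, hL.le⟩ hx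

variable {T} in
theorem IsSpline.exists_contDiff {p k : ℕ} (hv : T.IsSpline p k v) (j : Fin T.N) :
    ∃ P : ℝ → E3, ContDiff ℝ ∞ P ∧ Set.EqOn v P (T.elt j) := by
  choose q _ hq using hv.2 j
  refine ⟨fun x => WithLp.toLp 2 fun i => (q i).eval x, ?_, fun x hx => ?_⟩
  · rw [contDiff_euclidean]
    intro i
    simpa only [Polynomial.coe_aeval_eq_eval] using (q i).contDiff_aeval (𝕜 := ℝ) ∞
  · ext i; exact hq i x hx

variable {T} in
theorem IsSpline.memH1 (hL : 0 < L) {p : ℕ} (hv : T.IsSpline p 0 v) : MemH1 L v := by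
  refine (T.isPrimitive_deriv hL hv.1.continuousOn fun j => ?_).memH1 hL
  obtain ⟨P, hP, hvP⟩ := hv.exists_contDiff j
  exact ⟨P, hP.of_le (mod_cast le_top), hvP.mono Set.Ioo_subset_Icc_self⟩

variable {T} in
theorem IsSpline.memH2 (hL : 0 < L) {p : ℕ} (hv : T.IsSpline p 1 v) : MemH2 L v := by
  have hv1 : ContDiffOn ℝ 1 v (Set.Icc 0 L) := mod_cast hv.1
  refine ⟨hv1, (T.isPrimitive_deriv hL (continuousOn_cderiv hL hv1) fun j => ?_).memH1 hL⟩
  obtain ⟨P, hP, hvP⟩ := hv.exists_contDiff j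
  refine ⟨deriv P, (contDiff_infty_iff_deriv.1 hP).2.of_le (mod_cast le_top), fun x hx => ?_⟩
  have h1 : HasDerivAt v (cderiv L v x) x := hasDerivAt_cderiv hv1
    ⟨(T.node_mem j.castSucc).1.trans_lt hx.1, hx.2.trans_le (T.node_mem j.succ).2⟩
  rw [← h1.deriv]
  exact Filter.EventuallyEq.deriv_eq
    (hvP.eventuallyEq_of_mem (mem_of_superset (Ioo_mem_nhds hx.1 hx.2) Set.Ioo_subset_Icc_self))

/-! ### Nodal interpolation -/

/-- The part of the element number `j` to the left of `x`, as a length. -/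
def clamp (j : Fin T.N) (x : ℝ) : ℝ :=
  max (T.node j.castSucc) (min (T.node j.succ) x) - T.node j.castSucc

/-- The difference quotient of `f` on the element number `j`. -/
def slope (f : ℝ → E3) (j : Fin T.N) : E3 :=
  (T.size j)⁻¹ • (f (T.node j.succ) - f (T.node j.castSucc))

/-- The continuous, piecewise linear nodal interpolant of `f`. -/
def interp (f : ℝ → E3) (x : ℝ) : E3 := f 0 + ∑ j, T.clamp j x • T.slope f j

theorem continuous_interp (f : ℝ → E3) : Continuous (T.interp f) := by
  unfold interp clamp; fun_prop

theorem node_le_or {i j : Fin T.N} (h : i ≠ j) :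
    T.node i.succ ≤ T.node j.castSucc ∨ T.node j.succ ≤ T.node i.castSucc := by
  rcases lt_or_gt_of_ne h with h | h
  · exact Or.inl (T.strictMono.monotone (Fin.succ_le_castSucc_iff.2 h))
  · exact Or.inr (T.strictMono.monotone (Fin.succ_le_castSucc_iff.2 h))

theorem clamp_eq_of_ne {i j : Fin T.N} (h : i ≠ j) {x z : ℝ} (hx : x ∈ T.elt j)
    (hz : z ∈ T.elt j) : T.clamp i x = T.clamp i z := by
  have h3 := (T.node_lt i).le
  unfold clamp
  rcases T.node_le_or h with h | h
  · rw [min_eq_left (h.trans hx.1), min_eq_left (h.trans hz.1)]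
  · rw [max_eq_left ((min_le_right _ _).trans (hx.2.trans h)),
      max_eq_left ((min_le_right _ _).trans (hz.2.trans h))]

theorem clamp_self {j : Fin T.N} {x : ℝ} (hx : x ∈ T.elt j) :
    T.clamp j x = x - T.node j.castSucc := by
  unfold clamp; rw [min_eq_right hx.2, max_eq_right hx.1]

theorem interp_sub (f : ℝ → E3) {j : Fin T.N} {x z : ℝ} (hx : x ∈ T.elt j) (hz : z ∈ T.elt j) :
    T.interp f x - T.interp f z = (x - z) • T.slope f j := by
  unfold interp
  rw [add_sub_add_left_eq_sub, ← Finset.sum_sub_distrib, Finset.sum_eq_single j]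
  · rw [T.clamp_self hx, T.clamp_self hz, ← sub_smul]; congr 1; ring
  · intro i _ hi
    rw [T.clamp_eq_of_ne hi hx hz, sub_self]
  · simp

theorem left_mem_elt (j : Fin T.N) : T.node j.castSucc ∈ T.elt j := ⟨le_rfl, (T.node_lt j).le⟩

theorem right_mem_elt (j : Fin T.N) : T.node j.succ ∈ T.elt j := ⟨(T.node_lt j).le, le_rfl⟩

theorem size_smul_slope (f : ℝ → E3) (j : Fin T.N) :
    T.size j • T.slope f j = f (T.node j.succ) - f (T.node j.castSucc) :=
  smul_inv_smul₀ (T.size_pos j).ne' _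

theorem interp_zero (f : ℝ → E3) : T.interp f 0 = f 0 := by
  have : ∀ j, T.clamp j 0 = 0 := fun j => by
    have := (T.node_mem j.castSucc).1
    unfold clamp
    rw [max_eq_left ((min_le_right _ _).trans this), sub_self]
  simp [interp, this]

theorem interp_node (f : ℝ → E3) (k : Fin (T.N + 1)) : T.interp f (T.node k) = f (T.node k) := by
  induction k using Fin.induction with
  | zero => rw [T.node_zero, T.interp_zero]
  | succ i ih =>
    have h := T.interp_sub f (T.right_mem_elt i) (T.left_mem_elt i)
    rw [ih, show T.node i.succ - T.node i.castSucc = T.size i from rfl, T.size_smul_slope] at h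
    exact sub_left_injective h

theorem interp_eq (f : ℝ → E3) {j : Fin T.N} {x : ℝ} (hx : x ∈ T.elt j) :
    T.interp f x = f (T.node j.castSucc) + (x - T.node j.castSucc) • T.slope f j := by
  rw [← T.interp_node f, ← T.interp_sub f hx (T.left_mem_elt j)]; abel

theorem isSpline_interp (f : ℝ → E3) : T.IsSpline 1 0 (T.interp f) := by
  refine ⟨?_, fun j i => ?_⟩
  · exact (contDiff_zero.2 (T.continuous_interp f)).contDiffOn
  · refine ⟨Polynomial.C (f (T.node j.castSucc) i) + Polynomial.C (T.slope f j i) *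
      (Polynomial.X - Polynomial.C (T.node j.castSucc)), by compute_degree, fun x hx => ?_⟩
    rw [T.interp_eq f hx]
    simp [mul_comm]

theorem isPrimitive_interp (hL : 0 < L) (f : ℝ → E3) :
    IsPrimitive L (T.interp f) (weakDeriv L (T.interp f)) :=
  ((T.isSpline_interp f).memH1 hL).isPrimitive hL

theorem hasDerivAt_interp (f : ℝ → E3) {j : Fin T.N} {x : ℝ}
    (hx : x ∈ Set.Ioo (T.node j.castSucc) (T.node j.succ)) :
    HasDerivAt (T.interp f) (T.slope f j) x := by
  have h : HasDerivAt (fun x => f (T.node j.castSucc) + (x - T.node j.castSucc) • T.slope f j)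
      ((1 : ℝ) • T.slope f j) x :=
    (((hasDerivAt_id x).sub_const _).smul_const _).const_add _
  rw [one_smul] at h
  exact h.congr_of_eventuallyEq (Filter.eventually_of_mem (Ioo_mem_nhds hx.1 hx.2)
    fun z hz => T.interp_eq f (Set.Ioo_subset_Icc_self hz))

end Partition

end

noncomputable section

variable {L : ℝ} {f g v w : ℝ → E3}

/-! ### Deviation from mean values -/

theorem IsPrimitive.intervalIntegrable (h : IsPrimitive L f g) {a b : ℝ} (ha : a ∈ Set.Icc 0 L)
    (hb : b ∈ Set.Icc 0 L) : IntervalIntegrable f volume a b :=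
  intervalIntegrable_of_dom (integrable_of_memLp h.memLp_fun) ha hb

theorem IsPrimitive.norm_sub_le_of_mem (h : IsPrimitive L f g) {p q x z : ℝ} (hp : 0 ≤ p)
    (hq : q ≤ L) (hx : x ∈ Set.Icc p q) (hz : z ∈ Set.Icc p q) :
    ‖f x - f z‖ ≤ ∫ t in p..q, ‖g t‖ := by
  wlog hzx : z ≤ x generalizing x z
  · rw [norm_sub_rev]; exact this hz hx (le_of_not_ge hzx)
  refine (h.norm_sub_le (hp.trans hz.1) hzx (hx.2.trans hq)).trans ?_
  exact intervalIntegral.integral_mono_interval hz.1 hzx hx.2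
    (Eventually.of_forall fun _ => norm_nonneg _)
    (intervalIntegrable_of_dom h.integrable.norm ⟨hp, (hz.1.trans hz.2).trans hq⟩
      ⟨hp.trans (hz.1.trans hz.2), hq⟩)

/-- The deviation of a function from its mean value. -/
theorem IsPrimitive.norm_sub_mean_le (h : IsPrimitive L f g) {p q x : ℝ} (hp : 0 ≤ p)
    (hpq : p < q) (hq : q ≤ L) (hx : x ∈ Set.Icc p q) :
    ‖f x - (q - p)⁻¹ • ∫ t in p..q, f t‖ ≤ ∫ t in p..q, ‖g t‖ := by
  have hpos : 0 < q - p := sub_pos.2 hpq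
  have hfi : IntervalIntegrable f volume p q :=
    h.intervalIntegrable ⟨hp, hpq.le.trans hq⟩ ⟨hp.trans hpq.le, hq⟩
  have e : f x - (q - p)⁻¹ • ∫ t in p..q, f t = (q - p)⁻¹ • ∫ t in p..q, (f x - f t) := by
    rw [intervalIntegral.integral_sub intervalIntegrable_const hfi,
      intervalIntegral.integral_const, smul_sub, inv_smul_smul₀ hpos.ne']
  have hb : ‖∫ t in p..q, (f x - f t)‖ ≤ (∫ t in p..q, ‖g t‖) * |q - p| := by
    refine intervalIntegral.norm_integral_le_of_norm_le_const fun t ht => ?_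
    rw [Set.uIoc_of_le hpq.le] at ht
    exact h.norm_sub_le_of_mem hp hq hx ⟨ht.1.le, ht.2⟩
  rw [e, norm_smul, norm_inv, Real.norm_of_nonneg hpos.le]
  rw [abs_of_pos hpos] at hb
  rw [inv_mul_le_iff₀ hpos]
  linarith

namespace Partition

variable (T : Partition L)

theorem slope_eq_mean (hL : 0 < L) (hf : ContDiffOn ℝ 1 f (Set.Icc 0 L)) (j : Fin T.N) :
    T.slope f j = (T.node j.succ - T.node j.castSucc)⁻¹ •
      ∫ t in (T.node j.castSucc)..(T.node j.succ), cderiv L f t := by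
  rw [← (isPrimitive_cderiv hL hf).sub_eq (T.node_mem _) (T.node_mem _)]
  rfl

theorem norm_cderiv_sub_slope_le (hL : 0 < L) (hf : MemH2 L f) {j : Fin T.N} {x : ℝ}
    (hx : x ∈ T.elt j) : ‖cderiv L f x - T.slope f j‖
      ≤ ∫ t in (T.node j.castSucc)..(T.node j.succ), ‖deriv2 L f t‖ := by
  rw [T.slope_eq_mean hL hf.1]
  exact (hf.isPrimitive_cderiv hL).norm_sub_mean_le (T.node_mem _).1 (T.node_lt j)
    (T.node_mem _).2 hx

theorem weakDeriv_interp_ae (hL : 0 < L) (f : ℝ → E3) :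
    weakDeriv L (T.interp f) =ᵐ[dom L] deriv (T.interp f) := by
  refine (T.isPrimitive_deriv hL (T.continuous_interp f).continuousOn fun j => ?_).weakDeriv_ae hL
  obtain ⟨P, hP, hvP⟩ := (T.isSpline_interp f).exists_contDiff j
  exact ⟨P, hP.of_le (mod_cast le_top), hvP.mono Set.Ioo_subset_Icc_self⟩

theorem memLp_deriv_interp (hL : 0 < L) (f : ℝ → E3) : MemLp (deriv (T.interp f)) 2 (dom L) :=
  (T.isPrimitive_interp hL f).memLp.ae_eq (T.weakDeriv_interp_ae hL f)

theorem l2Sq_weakDeriv_interp_sub_le (hL : 0 < L) (hf : MemH2 L f) :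
    l2Sq L (weakDeriv L (T.interp f) - weakDeriv L f) ≤ T.mesh ^ 2 * l2Sq L (deriv2 L f) := by
  have h1 : weakDeriv L (T.interp f) - weakDeriv L f
      =ᵐ[dom L] deriv (T.interp f) - cderiv L f :=
    (T.weakDeriv_interp_ae hL f).sub ((hf.isPrimitive hL).weakDeriv_ae hL)
  have hd := (T.memLp_deriv_interp hL f).sub (hf.isPrimitive hL).memLp
  have h2 := (hf.isPrimitive_cderiv hL).memLp
  rw [l2Sq_congr h1]
  refine (T.integral_sq_le_of_elements hL (integrable_norm_sq hd) h2 h2 (κ₁ := 1) (κ₂ := 0)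
    zero_le_one le_rfl fun j x hx => ?_).trans_eq (by ring)
  rw [Pi.sub_apply, (T.hasDerivAt_interp f hx).deriv, norm_sub_rev, zero_mul, add_zero, one_mul]
  gcongr
  exact T.norm_cderiv_sub_slope_le hL hf (Set.Ioo_subset_Icc_self hx)

/-! ### Hermite interpolation -/

/-- The quadratic bubble function of the element number `j`, which is zero off the element. -/
def bubble (j : Fin T.N) (x : ℝ) : ℝ :=
  max 0 ((x - T.node j.castSucc) * (T.node j.succ - x))

/-- The coefficient of the bubble function that makes the mean value of the interpolant of `w` on
the element number `j` agree with that of `w`. -/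
def bubbleCoeff (w : ℝ → E3) (j : Fin T.N) : E3 :=
  (6 / T.size j ^ 3) • ∫ t in (T.node j.castSucc)..(T.node j.succ), (w t - T.interp w t)

/-- The continuous, piecewise quadratic function which agrees with `w` at the nodes and has the
same mean values on the elements. -/
def quadInterp (w : ℝ → E3) (x : ℝ) : E3 :=
  T.interp w x + ∑ j, T.bubble j x • T.bubbleCoeff w j

/-- The cubic Hermite interpolant of `y`: the primitive of the quadratic interpolant of `y'` which
preserves nodal values and mean values. -/
def hermite (y : ℝ → E3) (x : ℝ) : E3 :=
  y 0 + ∫ t in (0 : ℝ)..x, T.quadInterp (cderiv L y) t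

theorem continuous_quadInterp (w : ℝ → E3) : Continuous (T.quadInterp w) := by
  have := T.continuous_interp w
  unfold quadInterp bubble; fun_prop

theorem bubble_self {j : Fin T.N} {x : ℝ} (hx : x ∈ T.elt j) :
    T.bubble j x = (x - T.node j.castSucc) * (T.node j.succ - x) :=
  max_eq_right (mul_nonneg (sub_nonneg.2 hx.1) (sub_nonneg.2 hx.2))

theorem bubble_eq_zero_of_ne {i j : Fin T.N} (h : i ≠ j) {x : ℝ} (hx : x ∈ T.elt j) :
    T.bubble i x = 0 := by
  refine max_eq_left ?_
  have h3 := (T.node_lt i).le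
  rcases T.node_le_or h with h | h
  · exact mul_nonpos_of_nonneg_of_nonpos (sub_nonneg.2 (h3.trans (h.trans hx.1)))
      (sub_nonpos.2 (h.trans hx.1))
  · exact mul_nonpos_of_nonpos_of_nonneg (sub_nonpos.2 (hx.2.trans h))
      (sub_nonneg.2 ((hx.2.trans h).trans h3))

theorem quadInterp_eq (w : ℝ → E3) {j : Fin T.N} {x : ℝ} (hx : x ∈ T.elt j) :
    T.quadInterp w x = T.interp w x
      + ((x - T.node j.castSucc) * (T.node j.succ - x)) • T.bubbleCoeff w j := by
  unfold quadInterp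
  rw [Finset.sum_eq_single j, T.bubble_self hx]
  · intro i _ hi
    rw [T.bubble_eq_zero_of_ne hi hx, zero_smul]
  · simp

theorem quadInterp_node (hL : 0 < L) (w : ℝ → E3) (k : Fin (T.N + 1)) :
    T.quadInterp w (T.node k) = w (T.node k) := by
  obtain ⟨j, hj⟩ := T.exists_mem_elt hL (T.node_mem k)
  have h1 : T.bubble j (T.node k) = 0 := by
    rcases eq_or_ne k j.castSucc with rfl | h
    · simp [bubble]
    rcases eq_or_ne k j.succ with rfl | h'
    · simp [bubble]
    exfalso
    have h2 := T.strictMono.le_iff_le.1 hj.1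
    have h3 := T.strictMono.le_iff_le.1 hj.2
    have h4 : j.castSucc < k := lt_of_le_of_ne h2 h.symm
    have h5 : k < j.succ := lt_of_le_of_ne h3 h'
    rw [Fin.lt_def] at h4 h5
    simp at h4 h5
    omega
  rw [T.quadInterp_eq w hj, ← T.bubble_self hj, h1, zero_smul, add_zero, T.interp_node]

theorem integral_bubble (p q : ℝ) : ∫ t in p..q, (t - p) * (q - t) = (q - p) ^ 3 / 6 := by
  have : ∀ t, HasDerivAt (fun t : ℝ => (q - p) * (t - p) ^ 2 / 2 - (t - p) ^ 3 / 3)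
      ((t - p) * (q - t)) t := by
    intro t
    have h := (hasDerivAt_id t).sub_const p
    have h2 := (((h.pow 2).const_mul (q - p)).div_const 2).sub ((h.pow 3).div_const 3)
    refine h2.congr_deriv ?_
    simp only [id, Nat.cast_ofNat]
    ring
  rw [intervalIntegral.integral_eq_sub_of_hasDerivAt (fun t _ => this t)
    (Continuous.intervalIntegrable (by fun_prop) _ _)]
  ring

theorem integral_quadInterp (hw : ContinuousOn w (Set.Icc 0 L)) (j : Fin T.N) :
    ∫ t in (T.node j.castSucc)..(T.node j.succ), T.quadInterp w t
      = ∫ t in (T.node j.castSucc)..(T.node j.succ), w t := by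
  have hle := (T.node_lt j).le
  have hs := T.size_pos j
  have hwi : IntervalIntegrable w volume (T.node j.castSucc) (T.node j.succ) := by
    refine ContinuousOn.intervalIntegrable (hw.mono ?_)
    rw [Set.uIcc_of_le hle]; exact T.elt_subset j
  have hii : IntervalIntegrable (T.interp w) volume (T.node j.castSucc) (T.node j.succ) :=
    (T.continuous_interp w).intervalIntegrable _ _
  have h1 : ∫ t in (T.node j.castSucc)..(T.node j.succ), T.quadInterp w t
      = ∫ t in (T.node j.castSucc)..(T.node j.succ), (T.interp w t
      + ((t - T.node j.castSucc) * (T.node j.succ - t)) • T.bubbleCoeff w j) := by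
    refine intervalIntegral.integral_congr fun t ht => ?_
    rw [Set.uIcc_of_le hle] at ht
    exact T.quadInterp_eq w ht
  rw [h1, intervalIntegral.integral_add hii (Continuous.intervalIntegrable (by fun_prop) _ _),
    intervalIntegral.integral_smul_const, integral_bubble, bubbleCoeff,
    intervalIntegral.integral_sub hwi hii, smul_smul,
    show T.node j.succ - T.node j.castSucc = T.size j from rfl]
  have : T.size j ^ 3 / 6 * (6 / T.size j ^ 3) = 1 := by field_simp
  rw [this, one_smul]
  abel

theorem hasDerivAt_hermite (y : ℝ → E3) (x : ℝ) :
    HasDerivAt (T.hermite y) (T.quadInterp (cderiv L y) x) x :=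
  (intervalIntegral.integral_hasDerivAt_right
    ((T.continuous_quadInterp _).intervalIntegrable _ _)
    (T.continuous_quadInterp _).stronglyMeasurable.stronglyMeasurableAtFilter
    (T.continuous_quadInterp _).continuousAt).const_add _

theorem contDiff_hermite (y : ℝ → E3) : ContDiff ℝ 1 (T.hermite y) := by
  rw [contDiff_one_iff_deriv]
  refine ⟨fun x => (T.hasDerivAt_hermite y x).differentiableAt, ?_⟩
  have : deriv (T.hermite y) = T.quadInterp (cderiv L y) :=
    funext fun x => (T.hasDerivAt_hermite y x).deriv
  rw [this]
  exact T.continuous_quadInterp _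

theorem cderiv_hermite (hL : 0 < L) (y : ℝ → E3) :
    Set.EqOn (cderiv L (T.hermite y)) (T.quadInterp (cderiv L y)) (Set.Icc 0 L) := fun x hx =>
  (T.hasDerivAt_hermite y x).hasDerivWithinAt.derivWithin (uniqueDiffOn_Icc hL x hx)

theorem hermite_sub (y : ℝ → E3) (x z : ℝ) :
    T.hermite y x - T.hermite y z = ∫ t in z..x, T.quadInterp (cderiv L y) t := by
  unfold hermite
  rw [add_sub_add_left_eq_sub, intervalIntegral.integral_interval_sub_left] <;>
  exact (T.continuous_quadInterp _).intervalIntegrable _ _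

theorem hermite_node (hL : 0 < L) {y : ℝ → E3} (hy : ContDiffOn ℝ 1 y (Set.Icc 0 L))
    (k : Fin (T.N + 1)) : T.hermite y (T.node k) = y (T.node k) := by
  induction k using Fin.induction with
  | zero => simp [T.node_zero, hermite]
  | succ i ih =>
    have h := T.hermite_sub y (T.node i.succ) (T.node i.castSucc)
    rw [T.integral_quadInterp (continuousOn_cderiv hL hy), ih,
      ← (isPrimitive_cderiv hL hy).sub_eq (T.node_mem _) (T.node_mem _)] at h
    exact sub_left_injective h

/-- The cubic polynomial that represents the Hermite interpolant on an element. -/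
theorem hermite_eq (y : ℝ → E3) {j : Fin T.N} {x : ℝ} (hx : x ∈ T.elt j) :
    T.hermite y x = T.hermite y (T.node j.castSucc)
      + ((x - T.node j.castSucc) • cderiv L y (T.node j.castSucc)
      + ((x - T.node j.castSucc) ^ 2 / 2) • T.slope (cderiv L y) j
      + (T.size j * (x - T.node j.castSucc) ^ 2 / 2 - (x - T.node j.castSucc) ^ 3 / 3) •
        T.bubbleCoeff (cderiv L y) j) := by
  set p := T.node j.castSucc with hp
  set c := T.bubbleCoeff (cderiv L y) j
  set s := T.slope (cderiv L y) j
  set a := cderiv L y p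
  have hder : ∀ t ∈ Set.uIcc p x, HasDerivAt (fun t : ℝ => (t - p) • a + ((t - p) ^ 2 / 2) • s
      + (T.size j * (t - p) ^ 2 / 2 - (t - p) ^ 3 / 3) • c)
      (T.quadInterp (cderiv L y) t) t := by
    intro t ht
    rw [Set.uIcc_of_le hx.1] at ht
    have ht' : t ∈ T.elt j := ⟨ht.1, ht.2.trans hx.2⟩
    rw [T.quadInterp_eq _ ht', T.interp_eq _ ht']
    have h := (hasDerivAt_id t).sub_const p
    have h1 := (h.smul_const a).add (((h.pow 2).div_const 2).smul_const s)
    have h2 := (((h.pow 2).const_mul (T.size j)).div_const 2).sub ((h.pow 3).div_const 3)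
    have h3 := h1.add (h2.smul_const c)
    refine h3.congr_deriv ?_
    simp only [id, Nat.cast_ofNat]
    congr 1
    · congr 1
      · simp [a, hp]
      · congr 1; ring
    · congr 1; simp only [size, ← hp]; ring
  have h := T.hermite_sub y x p
  rw [intervalIntegral.integral_eq_sub_of_hasDerivAt hder
    ((T.continuous_quadInterp _).intervalIntegrable _ _)] at h
  rw [sub_eq_iff_eq_add] at h
  rw [h]
  simp only [sub_self]
  norm_num
  abel

theorem isSpline_hermite (y : ℝ → E3) : T.IsSpline 3 1 (T.hermite y) := by
  refine ⟨mod_cast (T.contDiff_hermite y).contDiffOn, fun j i => ?_⟩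
  set u : Polynomial ℝ := Polynomial.X - Polynomial.C (T.node j.castSucc) with hu
  refine ⟨Polynomial.C (T.hermite y (T.node j.castSucc) i)
    + (u * Polynomial.C (cderiv L y (T.node j.castSucc) i)
      + (u ^ 2 * Polynomial.C (1 / 2)) * Polynomial.C (T.slope (cderiv L y) j i)
      + (Polynomial.C (T.size j / 2) * u ^ 2 - u ^ 3 * Polynomial.C (1 / 3)) *
        Polynomial.C (T.bubbleCoeff (cderiv L y) j i)), ?_, fun x hx => ?_⟩
  · rw [hu]; compute_degree
  · rw [T.hermite_eq y hx]
    simp [hu]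
    ring

theorem memH2_hermite (hL : 0 < L) (y : ℝ → E3) : MemH2 L (T.hermite y) :=
  (T.isSpline_hermite y).memH2 hL

theorem deriv2_hermite_eq (hL : 0 < L) {y : ℝ → E3} :
    deriv2 L (T.hermite y) =ᵐ[dom L] deriv (T.quadInterp (cderiv L y)) := by
  have h : IsPrimitive L (T.quadInterp (cderiv L y)) (deriv (T.quadInterp (cderiv L y))) := by
    refine T.isPrimitive_deriv hL (T.continuous_quadInterp _).continuousOn fun j => ?_
    refine ⟨fun x => cderiv L y (T.node j.castSucc)
      + (x - T.node j.castSucc) • T.slope (cderiv L y) j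
      + ((x - T.node j.castSucc) * (T.node j.succ - x)) • T.bubbleCoeff (cderiv L y) j,
      by fun_prop, fun x hx => ?_⟩
    rw [T.quadInterp_eq _ (Set.Ioo_subset_Icc_self hx),
      T.interp_eq _ (Set.Ioo_subset_Icc_self hx)]
  exact (h.congr (T.cderiv_hermite hL y) ae_eq_rfl).weakDeriv_ae hL

theorem hasDerivAt_quadInterp (w : ℝ → E3) {j : Fin T.N} {x : ℝ}
    (hx : x ∈ Set.Ioo (T.node j.castSucc) (T.node j.succ)) :
    HasDerivAt (T.quadInterp w) (T.slope w j
      + ((T.node j.succ - x) - (x - T.node j.castSucc)) • T.bubbleCoeff w j) x := by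
  have h1 := ((hasDerivAt_id x).sub_const (T.node j.castSucc)).mul
    ((hasDerivAt_id x).const_sub (T.node j.succ))
  have h2 := (T.hasDerivAt_interp w hx).add (h1.smul_const (T.bubbleCoeff w j))
  have h3 := h2.congr_of_eventuallyEq (Filter.eventually_of_mem (Ioo_mem_nhds hx.1 hx.2)
    fun z hz => T.quadInterp_eq w (Set.Ioo_subset_Icc_self hz))
  refine h3.congr_deriv ?_
  simp only [id]
  congr 2
  ring

/-- The nodal interpolation error of `w` on an element is at most its length times the integral of
`|w''|`; this bounds the correction by the bubble function. -/
theorem norm_bubbleCoeff_le (hL : 0 < L) (hw : MemH2 L w) (j : Fin T.N) :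
    T.size j * ‖T.bubbleCoeff w j‖
      ≤ 6 * ∫ t in (T.node j.castSucc)..(T.node j.succ), ‖deriv2 L w t‖ := by
  set M := ∫ t in (T.node j.castSucc)..(T.node j.succ), ‖deriv2 L w t‖
  have hs := T.size_pos j
  have hlt := T.node_lt j
  have hsz : T.node j.succ - T.node j.castSucc = T.size j := rfl
  have hM : 0 ≤ M := intervalIntegral.integral_nonneg hlt.le fun _ _ => norm_nonneg _
  have hr : ∀ t ∈ T.elt j, ‖w t - T.interp w t‖ ≤ T.size j * M := by
    intro t ht
    have hp := T.node_mem j.castSucc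
    have htL := T.elt_subset j ht
    have hci : IntervalIntegrable (cderiv L w) volume (T.node j.castSucc) t :=
      (hw.isPrimitive_cderiv hL).intervalIntegrable hp htL
    have e : w t - T.interp w t
        = ∫ x in (T.node j.castSucc)..t, (cderiv L w x - T.slope w j) := by
      rw [intervalIntegral.integral_sub hci intervalIntegrable_const,
        ← (hw.isPrimitive hL).sub_eq htL hp, intervalIntegral.integral_const, T.interp_eq w ht]
      abel
    rw [e]
    refine (intervalIntegral.norm_integral_le_of_norm_le_const (C := M) fun x hx => ?_).trans ?_
    · rw [Set.uIoc_of_le ht.1] at hx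
      exact T.norm_cderiv_sub_slope_le hL hw ⟨hx.1.le, hx.2.trans ht.2⟩
    · rw [abs_of_nonneg (sub_nonneg.2 ht.1), mul_comm]
      exact mul_le_mul_of_nonneg_right (by rw [← hsz]; linarith [ht.2]) hM
  have hI : ‖∫ t in (T.node j.castSucc)..(T.node j.succ), (w t - T.interp w t)‖
      ≤ T.size j * M * T.size j := by
    refine (intervalIntegral.norm_integral_le_of_norm_le_const (C := T.size j * M)
      fun x hx => ?_).trans_eq ?_
    · rw [Set.uIoc_of_le hlt.le] at hx
      exact hr x ⟨hx.1.le, hx.2⟩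
    · rw [hsz, abs_of_pos hs]
  rw [bubbleCoeff, norm_smul, Real.norm_of_nonneg (by positivity)]
  calc T.size j * (6 / T.size j ^ 3 * ‖∫ t in (T.node j.castSucc)..(T.node j.succ),
        (w t - T.interp w t)‖)
      ≤ T.size j * (6 / T.size j ^ 3 * (T.size j * M * T.size j)) := by gcongr
    _ = 6 * M := by field_simp

/-- The factor is `49 = (1 + 6)²`: the piecewise linear interpolant of `y'` contributes `1` and the
bubble functions contribute `6`. -/
theorem l2Sq_deriv2_hermite_sub_le (hL : 0 < L) {y : ℝ → E3} (hy : MemH3 L y) :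
    l2Sq L (deriv2 L (T.hermite y) - deriv2 L y)
      ≤ T.mesh ^ 2 * (49 * l2Sq L (deriv2 L (cderiv L y))) := by
  have hw : MemH2 L (cderiv L y) := hy.2
  have h1 : deriv2 L (T.hermite y) - deriv2 L y
      =ᵐ[dom L] deriv (T.quadInterp (cderiv L y)) - cderiv L (cderiv L y) :=
    (T.deriv2_hermite_eq hL).sub ((hw.isPrimitive hL).weakDeriv_ae hL)
  have hd : MemLp (deriv (T.quadInterp (cderiv L y)) - cderiv L (cderiv L y)) 2 (dom L) :=
    (((T.memH2_hermite hL y).isPrimitive_cderiv hL).memLp.ae_eq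
      (T.deriv2_hermite_eq hL)).sub (hw.isPrimitive hL).memLp
  have h2 := (hw.isPrimitive_cderiv hL).memLp
  rw [l2Sq_congr h1]
  refine (T.integral_sq_le_of_elements hL (integrable_norm_sq hd) h2 h2 (κ₁ := 49) (κ₂ := 0)
    (by norm_num) le_rfl fun j x hx => ?_).trans_eq (by ring)
  have hM := T.norm_cderiv_sub_slope_le hL hw (Set.Ioo_subset_Icc_self hx)
  have hc := T.norm_bubbleCoeff_le hL hw j
  set M := ∫ t in (T.node j.castSucc)..(T.node j.succ), ‖deriv2 L (cderiv L y) t‖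
  rw [Pi.sub_apply, (T.hasDerivAt_quadInterp _ hx).deriv]
  have h3 : |T.node j.succ - x - (x - T.node j.castSucc)| ≤ T.size j := by
    unfold size
    rw [abs_le]; constructor <;> linarith [hx.1, hx.2]
  have h4 : ‖T.slope (cderiv L y) j + ((T.node j.succ - x) - (x - T.node j.castSucc)) •
      T.bubbleCoeff (cderiv L y) j - cderiv L (cderiv L y) x‖ ≤ 7 * M := by
    calc _ = ‖-(cderiv L (cderiv L y) x - T.slope (cderiv L y) j)
          + ((T.node j.succ - x) - (x - T.node j.castSucc)) •
            T.bubbleCoeff (cderiv L y) j‖ := by congr 1; abel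
      _ ≤ M + T.size j * ‖T.bubbleCoeff (cderiv L y) j‖ := by
          refine (norm_add_le _ _).trans (add_le_add (by rwa [norm_neg]) ?_)
          rw [norm_smul]
          exact mul_le_mul_of_nonneg_right h3 (norm_nonneg _)
      _ ≤ 7 * M := by linarith
  calc _ ≤ (7 * M) ^ 2 := by gcongr
    _ = _ := by ring

end Partition

end

noncomputable section

variable {L : ℝ} {f g u v w : ℝ → E3}

/-! ### Frames -/

theorem frameMatrix_mem_iff {t b : E3} :
    frameMatrix t b ∈ Matrix.specialOrthogonalGroup (Fin 3) ℝ ↔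
      ‖t‖ = 1 ∧ ‖b‖ = 1 ∧ inner ℝ t b = 0 := by
  have hn : ∀ v : E3, ‖v‖ = 1 ↔ v 0 ^ 2 + v 1 ^ 2 + v 2 ^ 2 = 1 := by
    intro v
    have h := EuclideanSpace.real_norm_sq_eq v
    rw [Fin.sum_univ_three] at h
    rw [← h]
    exact ⟨fun h => by rw [h]; norm_num, fun h => by nlinarith [norm_nonneg v]⟩
  have hi : inner ℝ t b = t 0 * b 0 + t 1 * b 1 + t 2 * b 2 := by
    simp [PiLp.inner_apply, Fin.sum_univ_three, mul_comm]
  rw [hn, hn, hi, Matrix.mem_specialOrthogonalGroup_iff, Matrix.mem_orthogonalGroup_iff']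
  have hcross : t.ofLp ⨯₃ b.ofLp = ![t 1 * b 2 - t 2 * b 1, t 2 * b 0 - t 0 * b 2,
      t 0 * b 1 - t 1 * b 0] := cross_apply _ _
  constructor
  · rintro ⟨h, -⟩
    have h00 := congrFun (congrFun h 0) 0
    have h11 := congrFun (congrFun h 1) 1
    have h01 := congrFun (congrFun h 0) 1
    simp [frameMatrix, Matrix.mul_apply, Fin.sum_univ_three] at h00 h11 h01
    exact ⟨by linarith, by linarith, by linarith⟩
  · rintro ⟨h1, h2, h3⟩
    have h4 : (t 1 * b 2 - t 2 * b 1) ^ 2 + (t 2 * b 0 - t 0 * b 2) ^ 2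
        + (t 0 * b 1 - t 1 * b 0) ^ 2 = 1 := by
      have : (t 1 * b 2 - t 2 * b 1) ^ 2 + (t 2 * b 0 - t 0 * b 2) ^ 2
        + (t 0 * b 1 - t 1 * b 0) ^ 2 = (t 0 ^ 2 + t 1 ^ 2 + t 2 ^ 2)
          * (b 0 ^ 2 + b 1 ^ 2 + b 2 ^ 2) - (t 0 * b 0 + t 1 * b 1 + t 2 * b 2) ^ 2 := by ring
      rw [this, h1, h2, h3]; norm_num
    constructor
    · ext i j
      fin_cases i <;> fin_cases j <;>
      simp [frameMatrix, hcross, Matrix.mul_apply, Fin.sum_univ_three] <;> linarith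
    · rw [Matrix.det_fin_three]
      simp [frameMatrix, hcross]
      linarith

variable {W : Type*} [NormedAddCommGroup W] [NormedSpace ℝ W] {Λ : BdryData →L[ℝ] W} {ell : W}
  {y b : ℝ → E3}

theorem eqOn_Icc_of_ae_dom {X : Type*} [TopologicalSpace X] [T2Space X] (hL : 0 < L) {f g : ℝ → X}
    (h : ∀ᵐ x ∂(dom L), f x = g x) (hf : ContinuousOn f (Set.Icc 0 L))
    (hg : ContinuousOn g (Set.Icc 0 L)) : Set.EqOn f g (Set.Icc 0 L) := by
  refine Measure.eqOn_Icc_of_ae_eq volume hL.ne ?_ hf hg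
  rwa [dom, Measure.restrict_congr_set Ioo_ae_eq_Icc] at h

theorem IsFrame.norm_cderiv (hL : 0 < L) (h : IsFrame L Λ ell y b) {x : ℝ}
    (hx : x ∈ Set.Icc 0 L) : ‖cderiv L y x‖ = 1 := by
  refine eqOn_Icc_of_ae_dom (f := fun x => ‖cderiv L y x‖) (g := fun _ => 1) hL ?_
    h.memH2.2.1.norm continuousOn_const hx
  filter_upwards [h.frame] with x hx using (frameMatrix_mem_iff.1 hx).1

theorem IsFrame.norm_b (hL : 0 < L) (h : IsFrame L Λ ell y b) {x : ℝ}
    (hx : x ∈ Set.Icc 0 L) : ‖b x‖ = 1 := by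
  refine eqOn_Icc_of_ae_dom (f := fun x => ‖b x‖) (g := fun _ => 1) hL ?_
    h.memH1.1.norm continuousOn_const hx
  filter_upwards [h.frame] with x hx using (frameMatrix_mem_iff.1 hx).2.1

theorem IsFrame.inner_eq_zero (hL : 0 < L) (h : IsFrame L Λ ell y b) {x : ℝ}
    (hx : x ∈ Set.Icc 0 L) : inner ℝ (cderiv L y x) (b x) = 0 := by
  refine eqOn_Icc_of_ae_dom (f := fun x => inner ℝ (cderiv L y x) (b x)) (g := fun _ => (0 : ℝ))
    hL ?_ (h.memH2.2.1.inner h.memH1.1) continuousOn_const hx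
  filter_upwards [h.frame] with x hx using (frameMatrix_mem_iff.1 hx).2.2

theorem IsFrame.l2Sq_cderiv (hL : 0 < L) (h : IsFrame L Λ ell y b) : l2Sq L (cderiv L y) = L := by
  calc l2Sq L (cderiv L y) = ∫ _, (1 : ℝ) ∂(dom L) := by
        refine integral_congr_ae ?_
        filter_upwards [ae_dom_mem L] with x hx
        rw [h.norm_cderiv hL (Set.Ioo_subset_Icc_self hx), one_pow]
    _ = L := by rw [integral_dom_const hL, mul_one]

namespace Partition

variable (T : Partition L)

theorem isAdmissible_interp (hL : 0 < L) (h : IsFrame L Λ ell y b) :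
    T.IsAdmissible Λ ell (T.hermite y) (T.interp b) where
  spline_y := T.isSpline_hermite y
  spline_b := T.isSpline_interp b
  unit_y j := by
    rw [T.cderiv_hermite hL y (T.node_mem j), T.quadInterp_node hL,
      h.norm_cderiv hL (T.node_mem j), one_pow]
  unit_b j := by rw [T.interp_node, h.norm_b hL (T.node_mem j), one_pow]
  bc := by
    rw [← h.bc]
    have h0 := T.node_zero
    have h1 := T.node_last
    have e : ∀ k, T.hermite y (T.node k) = y (T.node k) ∧
        cderiv L (T.hermite y) (T.node k) = cderiv L y (T.node k) ∧
        T.interp b (T.node k) = b (T.node k) := fun k =>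
      ⟨T.hermite_node hL h.memH2.1 k, by
        rw [T.cderiv_hermite hL y (T.node_mem k), T.quadInterp_node hL], T.interp_node b k⟩
    have e0 := e 0
    have e1 := e (Fin.last _)
    rw [h0] at e0
    rw [h1] at e1
    unfold bdry
    rw [e0.1, e0.2.1, e0.2.2, e1.1, e1.2.1, e1.2.2]

/-- The violation of the orthogonality relation between the nodes, where it holds exactly. -/
theorem integral_sq_inner_le (hL : 0 < L) {t b t' b' : ℝ → E3} (ht : IsPrimitive L t t')
    (hb : IsPrimitive L b b') (h0 : ∀ k, inner ℝ (t (T.node k)) (b (T.node k)) = 0)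
    (ht1 : ∀ k, ‖t (T.node k)‖ = 1) {B : ℝ} (hB : ∀ x ∈ Set.Icc 0 L, ‖b x‖ ^ 2 ≤ B) :
    ∫ x, (inner ℝ (t x) (b x)) ^ 2 ∂(dom L)
      ≤ T.mesh ^ 2 * (2 * B * l2Sq L t' + 2 * l2Sq L b') := by
  have hB0 : 0 ≤ B := (sq_nonneg _).trans (hB 0 ⟨le_rfl, hL.le⟩)
  have hc : ContinuousOn (fun x => (inner ℝ (t x) (b x)) ^ 2) (Set.Icc 0 L) :=
    (ht.continuousOn.inner hb.continuousOn).pow 2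
  have hint : Integrable (fun x => (inner ℝ (t x) (b x)) ^ 2) (dom L) :=
    IntegrableOn.mono_set (hc.integrableOn_compact isCompact_Icc) Set.Ioo_subset_Icc_self
  refine T.integral_sq_le_of_elements hL hint ht.memLp hb.memLp (by positivity) zero_le_two
    fun j x hx => ?_
  have hxe := Set.Ioo_subset_Icc_self hx
  have h1 := ht.norm_sub_le_of_mem (T.node_mem _).1 (T.node_mem _).2 hxe (T.left_mem_elt j)
  have h2 := hb.norm_sub_le_of_mem (T.node_mem _).1 (T.node_mem _).2 hxe (T.left_mem_elt j)
  set z := T.node j.castSucc with hz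
  set M₁ := ∫ s in z..(T.node j.succ), ‖t' s‖
  set M₂ := ∫ s in z..(T.node j.succ), ‖b' s‖
  have e : inner ℝ (t x) (b x) = inner ℝ (t x - t z) (b x) + inner ℝ (t z) (b x - b z) := by
    rw [inner_sub_left, inner_sub_right, h0]; ring
  have h3 : |inner ℝ (t x) (b x)| ≤ M₁ * ‖b x‖ + M₂ := by
    rw [e]
    refine (abs_add_le _ _).trans (add_le_add ?_ ?_)
    · exact (abs_real_inner_le_norm _ _).trans (by gcongr)
    · refine (abs_real_inner_le_norm _ _).trans ?_
      rw [ht1, one_mul]; exact h2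
  have h4 : (inner ℝ (t x) (b x)) ^ 2 ≤ (M₁ * ‖b x‖ + M₂) ^ 2 := by
    rw [← sq_abs]; gcongr
  have h5 : M₁ ^ 2 * ‖b x‖ ^ 2 ≤ M₁ ^ 2 * B :=
    mul_le_mul_of_nonneg_left (hB x (T.elt_subset j hxe)) (sq_nonneg _)
  nlinarith [sq_nonneg (M₁ * ‖b x‖ - M₂)]

end Partition

theorem memLp_inner (hu : ContinuousOn u (Set.Icc 0 L)) (hv : MemLp v 2 (dom L)) :
    MemLp (fun x => inner ℝ (u x) (v x)) 2 (dom L) := by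
  obtain ⟨C, hC⟩ := isCompact_Icc.exists_bound_of_continuousOn hu
  refine MemLp.mono (hv.norm.const_mul C) ?_ ?_
  · exact ((hu.mono Set.Ioo_subset_Icc_self).aestronglyMeasurable measurableSet_Ioo).inner hv.1
  · filter_upwards [ae_dom_mem L] with x hx
    have h1 := hC x (Set.Ioo_subset_Icc_self hx)
    refine (norm_inner_le_norm _ _).trans ?_
    refine le_trans ?_ (le_abs_self _)
    gcongr

/-- Perturbation of the constraint `y' · b' = 0`. -/
theorem integral_sq_inner_perturb_le {t t' s s' : ℝ → E3}
    (ht : ContinuousOn t (Set.Icc 0 L)) (ht' : ContinuousOn t' (Set.Icc 0 L))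
    (hs : MemLp s 2 (dom L)) (hs' : MemLp s' 2 (dom L)) {S : ℝ}
    (ht1 : ∀ x ∈ Set.Icc 0 L, ‖t x‖ = 1) (hS : ∀ x ∈ Set.Icc 0 L, ‖t' x - t x‖ ^ 2 ≤ S) :
    ∫ x, (inner ℝ (t' x) (s' x)) ^ 2 ∂(dom L)
      ≤ 3 * (∫ x, (inner ℝ (t x) (s x)) ^ 2 ∂(dom L) + S * l2Sq L s' + l2Sq L (s' - s)) := by
  have i0 := (memLp_inner ht hs).integrable_sq
  have i1 := (integrable_norm_sq hs').const_mul S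
  have i2 := integrable_norm_sq (hs'.sub hs)
  have i3 : Integrable (fun x => (inner ℝ (t x) (s x)) ^ 2 + S * ‖s' x‖ ^ 2) (dom L) := i0.add i1
  have e : 3 * (∫ x, (inner ℝ (t x) (s x)) ^ 2 ∂(dom L) + S * l2Sq L s' + l2Sq L (s' - s))
      = ∫ x, 3 * ((inner ℝ (t x) (s x)) ^ 2 + S * ‖s' x‖ ^ 2 + ‖(s' - s) x‖ ^ 2) ∂(dom L) := by
    unfold l2Sq
    rw [integral_const_mul, integral_add i3 i2, integral_add i0 i1, integral_const_mul]
  rw [e]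
  refine integral_mono_ae (memLp_inner ht' hs').integrable_sq ((i3.add i2).const_mul 3) ?_
  filter_upwards [ae_dom_mem L] with x hx
  have hx' := Set.Ioo_subset_Icc_self hx
  have e2 : inner ℝ (t' x) (s' x) = inner ℝ (t x) (s x) + inner ℝ (t' x - t x) (s' x)
      + inner ℝ (t x) ((s' - s) x) := by
    rw [inner_sub_left, Pi.sub_apply, inner_sub_right]; ring
  have h1 : (inner ℝ (t' x - t x) (s' x)) ^ 2 ≤ S * ‖s' x‖ ^ 2 := by
    rw [← sq_abs]
    calc |inner ℝ (t' x - t x) (s' x)| ^ 2 ≤ (‖t' x - t x‖ * ‖s' x‖) ^ 2 := by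
          gcongr; exact abs_real_inner_le_norm _ _
      _ = ‖t' x - t x‖ ^ 2 * ‖s' x‖ ^ 2 := by ring
      _ ≤ _ := by gcongr; exact hS x hx'
  have h2 : (inner ℝ (t x) ((s' - s) x)) ^ 2 ≤ ‖(s' - s) x‖ ^ 2 := by
    rw [← sq_abs]
    gcongr
    have := abs_real_inner_le_norm (t x) ((s' - s) x)
    rwa [ht1 x hx', one_mul] at this
  rw [e2]
  set a := (inner ℝ (t x) (s x) : ℝ)
  set c := (inner ℝ (t' x - t x) (s' x) : ℝ)
  set d := (inner ℝ (t x) ((s' - s) x) : ℝ)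
  nlinarith [sq_nonneg (a - c), sq_nonneg (a - d), sq_nonneg (c - d)]

/-! ### Norm estimates -/

theorem l2Sq_sub_comm (L : ℝ) (f g : ℝ → E3) : l2Sq L (f - g) = l2Sq L (g - f) := by
  unfold l2Sq
  congr 1; ext x; rw [Pi.sub_apply, Pi.sub_apply, norm_sub_rev]

theorem l2Sq_sub_le (hf : MemLp f 2 (dom L)) (hg : MemLp g 2 (dom L)) (hw : MemLp w 2 (dom L)) :
    l2Sq L (f - g) ≤ 2 * l2Sq L (f - w) + 2 * l2Sq L (g - w) := by
  rw [l2Sq_sub_comm L g]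
  have := l2Sq_add_le (hf.sub hw) (hw.sub hg)
  refine le_of_eq_of_le ?_ this
  congr 1; ext x; simp

theorem l2Sq_le_of_sub (hf : MemLp f 2 (dom L)) (hg : MemLp g 2 (dom L)) :
    l2Sq L f ≤ 2 * l2Sq L (f - g) + 2 * l2Sq L g := by
  have := l2Sq_add_le (hf.sub hg) hg
  refine le_of_eq_of_le ?_ this
  congr 1; ext x; simp

theorem h1Sq_sub_le (hL : 0 < L) (hf : MemH1 L f) (hg : MemH1 L g) (hw : MemH1 L w) :
    h1Sq L (f - g) ≤ 2 * h1Sq L (f - w) + 2 * h1Sq L (g - w) := by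
  rw [h1Sq_sub hL hf hg, h1Sq_sub hL hf hw, h1Sq_sub hL hg hw]
  have pf := hf.isPrimitive hL
  have pg := hg.isPrimitive hL
  have pw := hw.isPrimitive hL
  have h1 := l2Sq_sub_le pf.memLp_fun pg.memLp_fun pw.memLp_fun
  have h2 := l2Sq_sub_le pf.memLp pg.memLp pw.memLp
  linarith

theorem h2Sq_sub_le (hL : 0 < L) (hf : MemH2 L f) (hg : MemH2 L g) (hw : MemH2 L w) :
    h2Sq L (f - g) ≤ 2 * h2Sq L (f - w) + 2 * h2Sq L (g - w) := by
  rw [h2Sq_sub hL hf hg, h2Sq_sub hL hf hw, h2Sq_sub hL hg hw]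
  have pf := hf.isPrimitive hL
  have pg := hg.isPrimitive hL
  have pw := hw.isPrimitive hL
  have h1 := l2Sq_sub_le pf.memLp_fun pg.memLp_fun pw.memLp_fun
  have h2 := l2Sq_sub_le pf.memLp pg.memLp pw.memLp
  have h3 := l2Sq_sub_le (hf.isPrimitive_cderiv hL).memLp (hg.isPrimitive_cderiv hL).memLp
    (hw.isPrimitive_cderiv hL).memLp
  linarith

theorem h1Sq_sub_le_of_zero (hL : 0 < L) (hf : MemH1 L f) (hg : MemH1 L g) (h0 : f 0 = g 0) :
    h1Sq L (f - g) ≤ (1 + L ^ 2) * l2Sq L (weakDeriv L f - weakDeriv L g) := by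
  rw [h1Sq_sub hL hf hg]
  have := ((hf.isPrimitive hL).sub (hg.isPrimitive hL)).l2Sq_le_of_zero hL (by simp [h0])
  linarith

theorem h2Sq_sub_le_of_zero (hL : 0 < L) (hf : MemH2 L f) (hg : MemH2 L g) (h0 : f 0 = g 0)
    (h1 : cderiv L f 0 = cderiv L g 0) :
    h2Sq L (f - g) ≤ (1 + L ^ 2 + L ^ 4) * l2Sq L (deriv2 L f - deriv2 L g) := by
  rw [h2Sq_sub hL hf hg]
  have h2 := ((hf.isPrimitive hL).sub (hg.isPrimitive hL)).l2Sq_le_of_zero hL (by simp [h0])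
  have h3 := ((hf.isPrimitive_cderiv hL).sub (hg.isPrimitive_cderiv hL)).l2Sq_le_of_zero hL
    (by simp [h1])
  have h4 := mul_le_mul_of_nonneg_left h3 (sq_nonneg L)
  linarith

end

noncomputable section

variable {L : ℝ} {W : Type*} [NormedAddCommGroup W] [NormedSpace ℝ W] {Λ : BdryData →L[ℝ] W}
  {ell : W} {y b yσ bσ : ℝ → E3} {σ : ℝ}

/-! ### Recovery sequences -/

namespace IsSmoothApprox

/-- The norm of a frame is bounded below since `y'` has unit length. -/
theorem sqrt_le_norm (hL : 0 < L) (h : IsSmoothApprox L Λ ell y b σ yσ bσ) :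
    √L ≤ h3Norm L yσ + h2Norm L bσ := by
  have h1 : L ≤ h3Sq L yσ := by
    have := h.isFrame.l2Sq_cderiv hL
    unfold h3Sq h2Sq
    linarith [l2Sq_nonneg L yσ, h1Sq_nonneg L (cderiv L (cderiv L yσ))]
  exact (Real.sqrt_le_sqrt h1).trans (le_add_of_nonneg_right (Real.sqrt_nonneg _))

theorem h2Sq_le (h : IsSmoothApprox L Λ ell y b σ yσ bσ) : h2Sq L (y - yσ) ≤ σ ^ 2 := by
  have h0 := h.close
  have h1 : h2Norm L (y - yσ) ≤ σ := by
    have : 0 ≤ h1Norm L (b - bσ) := Real.sqrt_nonneg _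
    linarith [Real.sqrt_nonneg (∫ x, (inner ℝ (cderiv L yσ x) (weakDeriv L bσ x)) ^ 2 ∂(dom L))]
  exact (Real.sqrt_le_iff.1 h1).2

theorem h1Sq_le (h : IsSmoothApprox L Λ ell y b σ yσ bσ) : h1Sq L (b - bσ) ≤ σ ^ 2 := by
  have h0 := h.close
  have h1 : h1Norm L (b - bσ) ≤ σ := by
    have : 0 ≤ h2Norm L (y - yσ) := Real.sqrt_nonneg _
    linarith [Real.sqrt_nonneg (∫ x, (inner ℝ (cderiv L yσ x) (weakDeriv L bσ x)) ^ 2 ∂(dom L))]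
  exact (Real.sqrt_le_iff.1 h1).2

theorem integral_sq_inner_le (h : IsSmoothApprox L Λ ell y b σ yσ bσ) :
    ∫ x, (inner ℝ (cderiv L yσ x) (weakDeriv L bσ x)) ^ 2 ∂(dom L) ≤ σ ^ 2 := by
  have h0 := h.close
  have h1 : √(∫ x, (inner ℝ (cderiv L yσ x) (weakDeriv L bσ x)) ^ 2 ∂(dom L)) ≤ σ := by
    have : 0 ≤ h2Norm L (y - yσ) := Real.sqrt_nonneg _
    have : 0 ≤ h1Norm L (b - bσ) := Real.sqrt_nonneg _
    linarith
  exact (Real.sqrt_le_iff.1 h1).2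

theorem l2Sq_deriv3_le (_ : IsSmoothApprox L Λ ell y b σ yσ bσ) :
    l2Sq L (deriv2 L (cderiv L yσ)) ≤ (h3Norm L yσ + h2Norm L bσ) ^ 2 := by
  have h1 : l2Sq L (deriv2 L (cderiv L yσ)) ≤ h3Norm L yσ ^ 2 := by
    rw [h3Norm, Real.sq_sqrt (h3Sq_nonneg _ _)]
    unfold h3Sq h2Sq h1Sq deriv2
    linarith [l2Sq_nonneg L yσ, l2Sq_nonneg L (cderiv L yσ),
      l2Sq_nonneg L (cderiv L (cderiv L yσ))]
  have h2 : 0 ≤ h3Norm L yσ := Real.sqrt_nonneg _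
  have h3 : 0 ≤ h2Norm L bσ := Real.sqrt_nonneg _
  nlinarith

theorem l2Sq_deriv2_le (_ : IsSmoothApprox L Λ ell y b σ yσ bσ) :
    l2Sq L (deriv2 L bσ) ≤ (h3Norm L yσ + h2Norm L bσ) ^ 2 := by
  have h1 : l2Sq L (deriv2 L bσ) ≤ h2Norm L bσ ^ 2 := by
    rw [h2Norm, Real.sq_sqrt (h2Sq_nonneg _ _)]
    unfold h2Sq h1Sq deriv2
    linarith [l2Sq_nonneg L bσ, l2Sq_nonneg L (cderiv L bσ)]
  have h2 : 0 ≤ h3Norm L yσ := Real.sqrt_nonneg _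
  have h3 : 0 ≤ h2Norm L bσ := Real.sqrt_nonneg _
  nlinarith

variable (T : Partition L)

theorem l2Sq_deriv2_hermite_sub_le (hL : 0 < L) (h : IsSmoothApprox L Λ ell y b σ yσ bσ) :
    l2Sq L (deriv2 L (T.hermite yσ) - deriv2 L yσ)
      ≤ 49 * (T.mesh ^ 2 * (h3Norm L yσ + h2Norm L bσ) ^ 2) := by
  refine (T.l2Sq_deriv2_hermite_sub_le hL h.memH3).trans ?_
  have := mul_le_mul_of_nonneg_left h.l2Sq_deriv3_le (sq_nonneg T.mesh)
  linarith

theorem l2Sq_weakDeriv_interp_sub_le (hL : 0 < L) (h : IsSmoothApprox L Λ ell y b σ yσ bσ) :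
    l2Sq L (weakDeriv L (T.interp bσ) - weakDeriv L bσ)
      ≤ T.mesh ^ 2 * (h3Norm L yσ + h2Norm L bσ) ^ 2 :=
  (T.l2Sq_weakDeriv_interp_sub_le hL h.memH2).trans
    (mul_le_mul_of_nonneg_left h.l2Sq_deriv2_le (sq_nonneg T.mesh))

theorem cderiv_hermite_zero (hL : 0 < L) :
    cderiv L (T.hermite yσ) 0 = cderiv L yσ 0 := by
  have := T.quadInterp_node hL (cderiv L yσ) 0
  rw [T.node_zero] at this
  rw [T.cderiv_hermite hL yσ ⟨le_rfl, hL.le⟩, this]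

theorem h2Sq_hermite_sub_le (hL : 0 < L) (hy : MemH2 L y)
    (h : IsSmoothApprox L Λ ell y b σ yσ bσ) :
    h2Sq L (T.hermite yσ - y) ≤ 2 * ((1 + L ^ 2 + L ^ 4) *
      (49 * (T.mesh ^ 2 * (h3Norm L yσ + h2Norm L bσ) ^ 2))) + 2 * σ ^ 2 := by
  have h1 := h2Sq_sub_le hL (T.memH2_hermite hL yσ) hy h.isFrame.memH2
  have h2 := h2Sq_sub_le_of_zero hL (T.memH2_hermite hL yσ) h.isFrame.memH2
    (by simp [Partition.hermite]) (cderiv_hermite_zero T hL)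
  have h3 := mul_le_mul_of_nonneg_left (h.l2Sq_deriv2_hermite_sub_le T hL)
    (by positivity : 0 ≤ 1 + L ^ 2 + L ^ 4)
  linarith [h.h2Sq_le]

theorem h1Sq_interp_sub_le (hL : 0 < L) (hb : MemH1 L b)
    (h : IsSmoothApprox L Λ ell y b σ yσ bσ) :
    h1Sq L (T.interp bσ - b) ≤ 2 * ((1 + L ^ 2) *
      (T.mesh ^ 2 * (h3Norm L yσ + h2Norm L bσ) ^ 2)) + 2 * σ ^ 2 := by
  have hi := (T.isSpline_interp bσ).memH1 hL
  have h1 := h1Sq_sub_le hL hi hb h.isFrame.memH1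
  have h2 := h1Sq_sub_le_of_zero hL hi h.isFrame.memH1 (T.interp_zero bσ)
  have h3 := mul_le_mul_of_nonneg_left (h.l2Sq_weakDeriv_interp_sub_le T hL)
    (by positivity : 0 ≤ 1 + L ^ 2)
  linarith [h.h1Sq_le]

theorem integral_sq_inner_hermite_interp_le (hL : 0 < L)
    (h : IsSmoothApprox L Λ ell y b σ yσ bσ) :
    ∫ x, (inner ℝ (cderiv L (T.hermite yσ) x) (T.interp bσ x)) ^ 2 ∂(dom L)
      ≤ T.mesh ^ 2 * (2 * (2 + 2 * (L * l2Sq L (weakDeriv L (T.interp bσ))))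
          * l2Sq L (deriv2 L (T.hermite yσ)) + 2 * l2Sq L (weakDeriv L (T.interp bσ))) := by
  have hi := T.isPrimitive_interp hL bσ
  have e : ∀ k, cderiv L (T.hermite yσ) (T.node k) = cderiv L yσ (T.node k) := fun k => by
    rw [T.cderiv_hermite hL yσ (T.node_mem k), T.quadInterp_node hL]
  refine T.integral_sq_inner_le hL ((T.memH2_hermite hL yσ).isPrimitive_cderiv hL) hi
    (fun k => ?_) (fun k => ?_) fun x hx => ?_
  · rw [e, T.interp_node, h.isFrame.inner_eq_zero hL (T.node_mem k)]
  · rw [e, h.isFrame.norm_cderiv hL (T.node_mem k)]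
  · have h0 : (0 : ℝ) ∈ Set.Icc 0 L := ⟨le_rfl, hL.le⟩
    have h1 := hi.sq_norm_sub_le hx h0
    have h2 : ‖T.interp bσ 0‖ = 1 := by rw [T.interp_zero, h.isFrame.norm_b hL h0]
    have h3 : ‖T.interp bσ x‖ ≤ ‖T.interp bσ x - T.interp bσ 0‖ + 1 := by
      rw [← h2]; simpa using norm_add_le (T.interp bσ x - T.interp bσ 0) (T.interp bσ 0)
    have h4 : |x - 0| * l2Sq L (weakDeriv L (T.interp bσ))
        ≤ L * l2Sq L (weakDeriv L (T.interp bσ)) := by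
      rw [sub_zero, abs_of_nonneg hx.1]
      exact mul_le_mul_of_nonneg_right hx.2 (l2Sq_nonneg _ _)
    nlinarith [norm_nonneg (T.interp bσ x), sq_nonneg (‖T.interp bσ x - T.interp bσ 0‖ - 1)]

theorem integral_sq_inner_hermite_weakDeriv_le (hL : 0 < L)
    (h : IsSmoothApprox L Λ ell y b σ yσ bσ) :
    ∫ x, (inner ℝ (cderiv L (T.hermite yσ) x) (weakDeriv L (T.interp bσ) x)) ^ 2 ∂(dom L)
      ≤ 3 * (σ ^ 2 + T.mesh ^ 2 * (h3Norm L yσ + h2Norm L bσ) ^ 2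
        * (49 * L * l2Sq L (weakDeriv L (T.interp bσ)) + 1)) := by
  have hy := h.isFrame.memH2.isPrimitive_cderiv hL
  have hyh := (T.memH2_hermite hL yσ).isPrimitive_cderiv hL
  have h1 := integral_sq_inner_perturb_le hy.continuousOn hyh.continuousOn
    (h.isFrame.memH1.isPrimitive hL).memLp (T.isPrimitive_interp hL bσ).memLp
    (S := L * (49 * (T.mesh ^ 2 * (h3Norm L yσ + h2Norm L bσ) ^ 2)))
    (fun x hx => h.isFrame.norm_cderiv hL hx) (fun x hx => by
      refine ((hyh.sub hy).sq_norm_le_of_zero hL ?_ hx).trans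
        (mul_le_mul_of_nonneg_left (h.l2Sq_deriv2_hermite_sub_le T hL) hL.le)
      rw [Pi.sub_apply, cderiv_hermite_zero T hL, sub_self])
  have h2 := h.integral_sq_inner_le
  have h3 := h.l2Sq_weakDeriv_interp_sub_le T hL
  linarith

end IsSmoothApprox

/-- The infimum `[y, b]_σ` need not be attained; as it is positive, some approximation stays
below twice its value. -/
theorem exists_isSmoothApprox_le (hL : 0 < L) (h : regNorm L Λ ell y b σ ≠ ⊤) :
    ∃ yσ bσ, IsSmoothApprox L Λ ell y b σ yσ bσ ∧
      ENNReal.ofReal (h3Norm L yσ + h2Norm L bσ) ≤ 2 * regNorm L Λ ell y b σ := by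
  have hpos : 0 < regNorm L Λ ell y b σ := by
    refine (ENNReal.ofReal_pos.2 (Real.sqrt_pos.2 hL)).trans_le ?_
    exact le_iInf fun _ => le_iInf fun _ => le_iInf fun hs =>
      ENNReal.ofReal_le_ofReal (hs.sqrt_le_norm hL)
  have hlt : regNorm L Λ ell y b σ < 2 * regNorm L Λ ell y b σ := by
    rw [two_mul]
    exact ENNReal.lt_add_right h hpos.ne'
  nth_rewrite 1 [regNorm] at hlt
  simp only [iInf_lt_iff] at hlt
  obtain ⟨yσ, bσ, hs, hle⟩ := hlt
  exact ⟨yσ, bσ, hs, hle.le⟩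

variable {m : ℝ → ℝ → ℝ} {c₀ c₁ c₂ cuni : ℝ}

theorem tendsto_regularizedEnergy (hL : 0 < L) (hm : IsRegModulus m c₀ c₁ c₂ cuni)
    {δ : ℕ → ℝ} (hδ : ∀ n, 0 ≤ δ n) (hδ0 : Tendsto δ atTop (𝓝 0)) {A B : ℝ → E3}
    {An Bn : ℕ → ℝ → E3} (hA : MemLp A 2 (dom L))
    (hB : MemLp B 2 (dom L)) (hAn : ∀ n, MemLp (An n) 2 (dom L))
    (hBn : ∀ n, MemLp (Bn n) 2 (dom L))
    (hcA : Tendsto (fun n => l2Sq L (An n - A)) atTop (𝓝 0))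
    (hcB : Tendsto (fun n => l2Sq L (Bn n - B)) atTop (𝓝 0)) :
    Tendsto (fun n => 1 / 2 * ∫ x, (‖An n x‖ ^ 2 + 5 * ‖Bn n x‖ ^ 2
      + psi (m (δ n)) (‖An n x‖ ^ 2) (‖Bn n x‖ ^ 2)) ∂(dom L)) atTop
      (𝓝 (∫ x, Qbar ‖A x‖ ‖B x‖ ∂(dom L))) := by
  have h1 := tendsto_integral_Qbar hA hB hAn hBn hcA hcB
  have h2 : Tendsto (fun n => L * (3 / 2 * (cuni * δ n))) atTop (𝓝 0) := by
    simpa using ((hδ0.const_mul cuni).const_mul (3 / 2)).const_mul L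
  have h3 := squeeze_zero_norm (fun n => (Real.norm_eq_abs _).trans_le
    (abs_regularized_sub_le hL hm (hδ n) (hAn n) (hBn n))) h2
  simpa using h3.add h1

theorem tendsto_zero_of_ofReal {a : ℕ → ℝ} (h0 : ∀ n, 0 ≤ a n)
    (h : Tendsto (fun n => ENNReal.ofReal (a n)) atTop (𝓝 0)) : Tendsto a atTop (𝓝 0) := by
  have := (ENNReal.tendsto_toReal ENNReal.zero_ne_top).comp h
  simpa [Function.comp_def, ENNReal.toReal_ofReal (h0 _)] using this

theorem exists_recovery_sequence (hL : 0 < L) (hm : IsRegModulus m c₀ c₁ c₂ cuni)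
    {T : ℕ → Partition L} {ε₁ ε₂ δ σ : ℕ → ℝ} (hε₁ : ∀ n, 0 < ε₁ n) (hε₂ : ∀ n, 0 < ε₂ n)
    (hδ : ∀ n, 0 ≤ δ n) (hε₂0 : Tendsto ε₂ atTop (𝓝 0)) (hδ0 : Tendsto δ atTop (𝓝 0))
    (hy : MemH2 L y) (hb : MemH1 L b) (hσ0 : Tendsto σ atTop (𝓝 0))
    (hlim : Tendsto (fun n =>
        ENNReal.ofReal ((T n).mesh ^ 2 / ε₁ n) + ENNReal.ofReal (σ n ^ 2 / ε₂ n)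
          + ENNReal.ofReal ((T n).mesh ^ 2 / ε₂ n) * regNorm L Λ ell y b (σ n) ^ 2)
        atTop (𝓝 0)) :
    ∃ yh bh : ℕ → ℝ → E3,
      (∀ n, (T n).IsAdmissible Λ ell (yh n) (bh n)) ∧
      Tendsto (fun n => h2Norm L (yh n - y)) atTop (𝓝 0) ∧
      Tendsto (fun n => h1Norm L (bh n - b)) atTop (𝓝 0) ∧
      Tendsto (fun n => discreteEnergy L (m (δ n)) (ε₁ n) (ε₂ n) (yh n) (bh n)) atTop
        (𝓝 (energy L y b)) := by
  set R : ℕ → ℝ≥0∞ := fun n => regNorm L Λ ell y b (σ n) with hR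
  have hmesh : ∀ n, 0 < (T n).mesh := fun n => (T n).mesh_pos hL
  have hfin : ∀ᶠ n in atTop, R n ≠ ⊤ := by
    filter_upwards [hlim.eventually (gt_mem_nhds zero_lt_one)] with n hn htop
    have hpos : ENNReal.ofReal ((T n).mesh ^ 2 / ε₂ n) ≠ 0 :=
      (ENNReal.ofReal_pos.2 (div_pos (pow_pos (hmesh n) 2) (hε₂ n))).ne'
    change _ + _ + _ * R n ^ 2 < 1 at hn
    rw [htop, ENNReal.top_pow two_ne_zero, ENNReal.mul_top hpos, add_top] at hn
    exact not_top_lt hn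
  obtain ⟨n₀, hn₀⟩ := hfin.exists
  obtain ⟨y₀, b₀, hyb₀, -⟩ := exists_isSmoothApprox_le hL hn₀
  -- For the finitely many `n` without an approximation, any admissible frame can be interpolated.
  have hex : ∀ n, ∃ p : (ℝ → E3) × (ℝ → E3), IsFrame L Λ ell p.1 p.2 ∧
      (R n ≠ ⊤ → IsSmoothApprox L Λ ell y b (σ n) p.1 p.2 ∧
        ENNReal.ofReal (h3Norm L p.1 + h2Norm L p.2) ≤ 2 * R n) := by
    intro n
    by_cases h : R n = ⊤
    · exact ⟨(y₀, b₀), hyb₀.isFrame, fun h' => absurd h h'⟩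
    · obtain ⟨yσ, bσ, h1, h2⟩ := exists_isSmoothApprox_le hL h
      exact ⟨(yσ, bσ), h1.isFrame, fun _ => ⟨h1, h2⟩⟩
  choose p hpf hps using hex
  set r : ℕ → ℝ := fun n => h3Norm L (p n).1 + h2Norm L (p n).2
  have hr0 : ∀ n, 0 ≤ r n := fun n => add_nonneg (Real.sqrt_nonneg _) (Real.sqrt_nonneg _)
  set a : ℕ → ℝ := fun n => (T n).mesh ^ 2 / ε₁ n
  set s : ℕ → ℝ := fun n => σ n ^ 2 / ε₂ n
  set c : ℕ → ℝ := fun n => (T n).mesh ^ 2 * r n ^ 2 / ε₂ n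
  set q : ℕ → ℝ := fun n => (T n).mesh ^ 2 * r n ^ 2
  have ha : Tendsto a atTop (𝓝 0) := by
    refine tendsto_zero_of_ofReal (fun n => div_nonneg (sq_nonneg _) (hε₁ n).le) ?_
    exact tendsto_of_tendsto_of_tendsto_of_le_of_le tendsto_const_nhds hlim
      (fun _ => zero_le) fun n => by simp only [add_assoc]; exact le_self_add
  have hs : Tendsto s atTop (𝓝 0) := by
    refine tendsto_zero_of_ofReal (fun n => div_nonneg (sq_nonneg _) (hε₂ n).le) ?_
    exact tendsto_of_tendsto_of_tendsto_of_le_of_le tendsto_const_nhds hlim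
      (fun _ => zero_le) fun n => le_add_right le_add_self
  have hc : Tendsto c atTop (𝓝 0) := by
    refine tendsto_zero_of_ofReal (fun n => div_nonneg (by positivity) (hε₂ n).le) ?_
    have h4 : Tendsto (fun n => 4 * (ENNReal.ofReal ((T n).mesh ^ 2 / ε₂ n) * R n ^ 2)) atTop
        (𝓝 0) := by
      have h1 : Tendsto (fun n => ENNReal.ofReal ((T n).mesh ^ 2 / ε₂ n) * R n ^ 2) atTop
          (𝓝 0) := tendsto_of_tendsto_of_tendsto_of_le_of_le tendsto_const_nhds hlim
        (fun _ => zero_le) fun n => le_add_self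
      simpa using ENNReal.Tendsto.const_mul h1 (Or.inr (by norm_num : (4 : ℝ≥0∞) ≠ ⊤))
    refine tendsto_of_tendsto_of_tendsto_of_le_of_le' tendsto_const_nhds h4
      (Eventually.of_forall fun _ => zero_le) ?_
    filter_upwards [hfin] with n hn
    have h5 : c n = (T n).mesh ^ 2 / ε₂ n * r n ^ 2 := by simp only [c]; ring
    rw [h5, ENNReal.ofReal_mul (div_nonneg (sq_nonneg _) (hε₂ n).le),
      ENNReal.ofReal_pow (hr0 n)]
    calc _ ≤ ENNReal.ofReal ((T n).mesh ^ 2 / ε₂ n) * (2 * R n) ^ 2 := by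
          gcongr; exact (hps n hn).2
      _ = 4 * (ENNReal.ofReal ((T n).mesh ^ 2 / ε₂ n) * R n ^ 2) := by ring
  have hq : Tendsto q atTop (𝓝 0) := by
    have : q = fun n => c n * ε₂ n := by
      ext n; simp only [q, c]; rw [div_mul_cancel₀ _ (hε₂ n).ne']
    rw [this]
    simpa using hc.mul hε₂0
  have hσ2 : Tendsto (fun n => 2 * σ n ^ 2) atTop (𝓝 0) := by
    simpa using (hσ0.pow 2).const_mul 2
  set yh : ℕ → ℝ → E3 := fun n => (T n).hermite (p n).1
  set bh : ℕ → ℝ → E3 := fun n => (T n).interp (p n).2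
  have hyh : ∀ n, MemH2 L (yh n) := fun n => (T n).memH2_hermite hL _
  have hbh : ∀ n, MemH1 L (bh n) := fun n => ((T n).isSpline_interp _).memH1 hL
  have hY : Tendsto (fun n => h2Sq L (yh n - y)) atTop (𝓝 0) := by
    have h1 : Tendsto (fun n => 2 * ((1 + L ^ 2 + L ^ 4) * (49 * q n)) + 2 * σ n ^ 2) atTop
        (𝓝 0) := by
      simpa using (((hq.const_mul 49).const_mul (1 + L ^ 2 + L ^ 4)).const_mul 2).add hσ2
    refine tendsto_of_tendsto_of_tendsto_of_le_of_le' tendsto_const_nhds h1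
      (Eventually.of_forall fun _ => h2Sq_nonneg _ _) ?_
    filter_upwards [hfin] with n hn using (hps n hn).1.h2Sq_hermite_sub_le (T n) hL hy
  have hB : Tendsto (fun n => h1Sq L (bh n - b)) atTop (𝓝 0) := by
    have h1 : Tendsto (fun n => 2 * ((1 + L ^ 2) * q n) + 2 * σ n ^ 2) atTop (𝓝 0) := by
      simpa using ((hq.const_mul (1 + L ^ 2)).const_mul 2).add hσ2
    refine tendsto_of_tendsto_of_tendsto_of_le_of_le' tendsto_const_nhds h1
      (Eventually.of_forall fun _ => h1Sq_nonneg _ _) ?_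
    filter_upwards [hfin] with n hn using (hps n hn).1.h1Sq_interp_sub_le (T n) hL hb
  have hY2 : Tendsto (fun n => l2Sq L (deriv2 L (yh n) - deriv2 L y)) atTop (𝓝 0) := by
    refine squeeze_zero (fun _ => l2Sq_nonneg _ _) (fun n => ?_) hY
    rw [h2Sq_sub hL (hyh n) hy]
    linarith [l2Sq_nonneg L (yh n - y), l2Sq_nonneg L (cderiv L (yh n) - cderiv L y)]
  have hB1 : Tendsto (fun n => l2Sq L (weakDeriv L (bh n) - weakDeriv L b)) atTop (𝓝 0) := by
    refine squeeze_zero (fun _ => l2Sq_nonneg _ _) (fun n => ?_) hB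
    rw [h1Sq_sub hL (hbh n) hb]
    linarith [l2Sq_nonneg L (bh n - b)]
  have mY := fun n => ((hyh n).isPrimitive_cderiv hL).memLp
  have mB := fun n => ((hbh n).isPrimitive hL).memLp
  have mY0 := (hy.isPrimitive_cderiv hL).memLp
  have mB0 := (hb.isPrimitive hL).memLp
  refine ⟨yh, bh, fun n => (T n).isAdmissible_interp hL (hpf n), ?_, ?_, ?_⟩
  · simpa [h2Norm] using hY.sqrt
  · simpa [h1Norm] using hB.sqrt
  have hE := tendsto_regularizedEnergy hL hm hδ hδ0 mY0 mB0 mY mB hY2 hB1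
  suffices hP : Tendsto (fun n => penalty L (ε₁ n) (ε₂ n) (yh n) (bh n)) atTop (𝓝 0) by
    simpa [discreteEnergy, energy] using hE.add hP
  -- Convergent upper bounds for the squared norms of `yh''` and `bh'`.
  set α : ℕ → ℝ := fun n => 2 * l2Sq L (deriv2 L (yh n) - deriv2 L y) + 2 * l2Sq L (deriv2 L y)
  set β : ℕ → ℝ := fun n =>
    2 * l2Sq L (weakDeriv L (bh n) - weakDeriv L b) + 2 * l2Sq L (weakDeriv L b)
  have hαlim : Tendsto α atTop (𝓝 (2 * 0 + 2 * l2Sq L (deriv2 L y))) :=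
    (hY2.const_mul 2).add_const _
  have hβlim : Tendsto β atTop (𝓝 (2 * 0 + 2 * l2Sq L (weakDeriv L b))) :=
    (hB1.const_mul 2).add_const _
  have hα : ∀ n, l2Sq L (deriv2 L (yh n)) ≤ α n := fun n => l2Sq_le_of_sub (mY n) mY0
  have hβ : ∀ n, l2Sq L (weakDeriv L (bh n)) ≤ β n := fun n => l2Sq_le_of_sub (mB n) mB0
  have hbound : Tendsto (fun n => 1 / 2 * (a n * (2 * (2 + 2 * (L * β n)) * α n + 2 * β n))
      + 3 / 2 * (s n + c n * (49 * L * β n + 1))) atTop (𝓝 0) := by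
    have t1 := ha.mul ((((((hβlim.const_mul L).const_mul 2).const_add 2).const_mul 2).mul
      hαlim).add (hβlim.const_mul 2))
    have t2 := hs.add (hc.mul ((hβlim.const_mul (49 * L)).add_const 1))
    have t3 := (t1.const_mul (1 / 2)).add (t2.const_mul (3 / 2))
    simpa using t3
  refine tendsto_of_tendsto_of_tendsto_of_le_of_le' tendsto_const_nhds hbound
    (Eventually.of_forall fun n => ?_) ?_
  · have h1 := hε₁ n
    have h2 := hε₂ n
    exact add_nonneg (mul_nonneg (by positivity) (integral_nonneg fun _ => sq_nonneg _))
      (mul_nonneg (by positivity) (integral_nonneg fun _ => sq_nonneg _))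
  · filter_upwards [hfin] with n hn
    have h1 := (hps n hn).1.integral_sq_inner_hermite_interp_le (T n) hL
    have h2 := (hps n hn).1.integral_sq_inner_hermite_weakDeriv_le (T n) hL
    have e1 := hε₁ n
    have e2 := hε₂ n
    have b0 : 0 ≤ l2Sq L (weakDeriv L (bh n)) := l2Sq_nonneg _ _
    have a0 : 0 ≤ l2Sq L (deriv2 L (yh n)) := l2Sq_nonneg _ _
    have hαn := hα n
    have hβn := hβ n
    have hβ0 := b0.trans hβn
    refine add_le_add ?_ ?_
    · calc 1 / (2 * ε₁ n) * ∫ x, (inner ℝ (cderiv L (yh n) x) (bh n x)) ^ 2 ∂(dom L)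
          ≤ 1 / (2 * ε₁ n) * ((T n).mesh ^ 2 * (2 * (2 + 2 * (L * l2Sq L (weakDeriv L (bh n))))
            * l2Sq L (deriv2 L (yh n)) + 2 * l2Sq L (weakDeriv L (bh n)))) := by gcongr
        _ ≤ 1 / (2 * ε₁ n) * ((T n).mesh ^ 2 * (2 * (2 + 2 * (L * β n)) * α n + 2 * β n)) := by
            gcongr
        _ = 1 / 2 * (a n * (2 * (2 + 2 * (L * β n)) * α n + 2 * β n)) := by
            simp only [a]; field_simp
    · calc 1 / (2 * ε₂ n) * ∫ x, (inner ℝ (cderiv L (yh n) x) (weakDeriv L (bh n) x)) ^ 2 ∂(dom L)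
          ≤ 1 / (2 * ε₂ n) * (3 * (σ n ^ 2 + (T n).mesh ^ 2 * r n ^ 2
            * (49 * L * l2Sq L (weakDeriv L (bh n)) + 1))) := by gcongr
        _ ≤ 1 / (2 * ε₂ n) * (3 * (σ n ^ 2 + (T n).mesh ^ 2 * r n ^ 2
            * (49 * L * β n + 1))) := by gcongr
        _ = 3 / 2 * (s n + c n * (49 * L * β n + 1)) := by
            simp only [s, c]; field_simp

end

noncomputable section

variable {L : ℝ} {f g : ℝ → E3} {fn gn : ℕ → ℝ → E3}

/-! ### Weak convergence -/

theorem WeakL2.comp (h : WeakL2 L fn f) {φ : ℕ → ℕ} (hφ : Tendsto φ atTop atTop) :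
    WeakL2 L (fun n => fn (φ n)) f := fun ψ hψ => (h ψ hψ).comp hφ

/-- Weak sequential compactness of balls in `L²`, from the sequential Banach–Alaoglu theorem and the
Riesz representation. -/
theorem exists_subseq_weakL2 (hg : ∀ n, MemLp (gn n) 2 (dom L)) {C : ℝ}
    (hC : ∀ n, l2Sq L (gn n) ≤ C) :
    ∃ φ : ℕ → ℕ, StrictMono φ ∧ ∃ g, MemLp g 2 (dom L) ∧ WeakL2 L (fun n => gn (φ n)) g := by
  let H := Lp E3 2 (dom L)
  have : Fact ((2 : ℝ≥0∞) ≠ ⊤) := ⟨by norm_num⟩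
  let ℓ : ℕ → WeakDual ℝ H := fun n =>
    StrongDual.toWeakDual (InnerProductSpace.toDual ℝ H ((hg n).toLp (gn n)))
  have hin : ∀ {u v : ℝ → E3} (hu : MemLp u 2 (dom L)) (hv : MemLp v 2 (dom L)),
      inner ℝ (hu.toLp u) (hv.toLp v) = ∫ x, inner ℝ (u x) (v x) ∂(dom L) := by
    intro u v hu hv
    rw [L2.inner_def]
    refine integral_congr_ae ?_
    filter_upwards [hu.coeFn_toLp, hv.coeFn_toLp] with x h1 h2
    rw [h1, h2]
  have hmem : ∀ n, ℓ n ∈ (WeakDual.toStrongDual ⁻¹'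
      Metric.closedBall (0 : StrongDual ℝ H) (√C) : Set (WeakDual ℝ H)) := by
    intro n
    have h1 : ‖(hg n).toLp (gn n)‖ ^ 2 ≤ C := by
      rw [← real_inner_self_eq_norm_sq, hin (hg n) (hg n)]
      simp_rw [real_inner_self_eq_norm_sq]
      exact hC n
    simp only [Set.mem_preimage, mem_closedBall_zero_iff]
    change ‖InnerProductSpace.toDual ℝ H ((hg n).toLp (gn n))‖ ≤ √C
    rw [LinearIsometryEquiv.norm_map]
    exact Real.le_sqrt_of_sq_le h1
  obtain ⟨ℓ₀, -, φ, hφ, hlim⟩ := WeakDual.isSeqCompact_closedBall ℝ H 0 (√C) hmem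
  set g₀ : H := (InnerProductSpace.toDual ℝ H).symm (WeakDual.toStrongDual ℓ₀)
  refine ⟨φ, hφ, g₀, Lp.memLp g₀, fun ψ hψ => ?_⟩
  have h1 := ((WeakDual.eval_continuous (hψ.toLp ψ)).tendsto ℓ₀).comp hlim
  have h2 : ∀ n, (ℓ n) (hψ.toLp ψ) = ∫ x, inner ℝ (gn n x) (ψ x) ∂(dom L) := fun n =>
    (InnerProductSpace.toDual_apply_apply).trans (hin (hg n) hψ)
  have h3 : ℓ₀ (hψ.toLp ψ) = ∫ x, inner ℝ (g₀ x) (ψ x) ∂(dom L) := by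
    have h4 : ℓ₀ (hψ.toLp ψ) = inner ℝ g₀ (hψ.toLp ψ) :=
      InnerProductSpace.toDual_symm_apply.symm
    rw [h4, ← hin (Lp.memLp g₀) hψ, Lp.toLp_coeFn]
  rw [h3] at h1
  refine h1.congr fun n => ?_
  exact h2 (φ n)

theorem tendsto_E3 {X : Type*} {l : Filter X} {F : X → E3} {a : E3}
    (h : ∀ i, Tendsto (fun n => F n i) l (𝓝 (a i))) : Tendsto F l (𝓝 a) :=
  ((PiLp.continuous_toLp 2 (fun _ : Fin 3 => ℝ)).tendsto a.ofLp).comp (tendsto_pi_nhds.2 h)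

theorem WeakL2.tendsto_integral (h : WeakL2 L gn g) (hgn : ∀ n, MemLp (gn n) 2 (dom L))
    (hg : MemLp g 2 (dom L)) {x : ℝ} (hx : x ∈ Set.Icc 0 L) :
    Tendsto (fun n => ∫ t in (0 : ℝ)..x, gn n t) atTop (𝓝 (∫ t in (0 : ℝ)..x, g t)) := by
  have h0 : (0 : ℝ) ∈ Set.Icc 0 L := ⟨le_rfl, hx.1.trans hx.2⟩
  refine tendsto_E3 fun i => ?_
  set e : E3 := EuclideanSpace.single i 1
  have key : ∀ {u : ℝ → E3}, MemLp u 2 (dom L) →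
      ∫ t, inner ℝ (u t) ((Set.Ioo 0 x).indicator (fun _ => e) t) ∂(dom L)
        = (∫ t in (0 : ℝ)..x, u t) i := by
    intro u hu
    rw [integral_apply_E3 (intervalIntegrable_of_dom (integrable_of_memLp hu) h0 hx),
      intervalIntegral.integral_of_le hx.1, integral_Ioc_eq_integral_Ioo]
    have h1 : (fun t => inner ℝ (u t) ((Set.Ioo 0 x).indicator (fun _ => e) t))
        = (Set.Ioo 0 x).indicator (fun t => u t i) := by
      ext t
      by_cases ht : t ∈ Set.Ioo 0 x
      · simp [ht, e, EuclideanSpace.inner_single_right]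
      · simp [ht]
    rw [h1, integral_indicator measurableSet_Ioo, dom,
      Measure.restrict_restrict measurableSet_Ioo,
      Set.inter_eq_left.2 (Set.Ioo_subset_Ioo le_rfl hx.2)]
  have h2 := h ((Set.Ioo 0 x).indicator fun _ => e) ((memLp_const e).indicator measurableSet_Ioo)
  rw [key hg] at h2
  exact h2.congr fun n => key (hgn n)

theorem tendsto_l2Sq_sub_of_pointwise (hfn : ∀ n, ContinuousOn (fn n) (Set.Icc 0 L))
    (hf : ContinuousOn f (Set.Icc 0 L)) {C : ℝ} (hC : ∀ n, ∀ x ∈ Set.Icc 0 L, ‖fn n x‖ ≤ C)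
    (hlim : ∀ x ∈ Set.Icc 0 L, Tendsto (fun n => fn n x) atTop (𝓝 (f x))) :
    Tendsto (fun n => l2Sq L (fn n - f)) atTop (𝓝 0) := by
  have hfC : ∀ x ∈ Set.Icc 0 L, ‖f x‖ ≤ C := fun x hx =>
    le_of_tendsto (hlim x hx).norm (Eventually.of_forall fun n => hC n x hx)
  have h0 : ∫ _, (0 : ℝ) ∂(dom L) = 0 := integral_zero _ _
  rw [← h0]
  refine tendsto_integral_of_dominated_convergence (fun _ => (2 * C) ^ 2) (fun n => ?_)
    (integrable_const _) (fun n => ?_) ?_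
  · exact (((((hfn n).sub hf).norm).pow 2).mono Set.Ioo_subset_Icc_self).aestronglyMeasurable
      measurableSet_Ioo
  · filter_upwards [ae_dom_mem L] with x hx
    have hx' := Set.Ioo_subset_Icc_self hx
    rw [Real.norm_of_nonneg (sq_nonneg _)]
    have := norm_sub_le (fn n x) (f x)
    gcongr
    rw [Pi.sub_apply]
    linarith [hC n x hx', hfC x hx']
  · filter_upwards [ae_dom_mem L] with x hx
    have h1 := (hlim x (Set.Ioo_subset_Icc_self hx)).sub_const (f x)
    simpa using h1.norm.pow 2

theorem weakL2_of_tendsto_l2Sq (hfn : ∀ n, MemLp (fn n) 2 (dom L)) (hf : MemLp f 2 (dom L))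
    (h : Tendsto (fun n => l2Sq L (fn n - f)) atTop (𝓝 0)) : WeakL2 L fn f := by
  intro φ hφ
  rw [tendsto_iff_norm_sub_tendsto_zero]
  have h1 : Tendsto (fun n => √(l2Sq L (fn n - f)) * √(l2Sq L φ)) atTop (𝓝 0) := by
    simpa using h.sqrt.mul_const (√(l2Sq L φ))
  refine squeeze_zero (fun _ => norm_nonneg _) (fun n => ?_) h1
  rw [← integral_sub (integrable_inner (hfn n) hφ) (integrable_inner hf hφ), Real.norm_eq_abs]
  simp_rw [← inner_sub_left]
  exact abs_integral_inner_le ((hfn n).sub hf) hφ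

/-- Convergence of the initial values and weak convergence of the derivatives imply pointwise
convergence. -/
theorem tendsto_of_weakL2_deriv (h : ∀ n, IsPrimitive L (fn n) (gn n)) (h0 : IsPrimitive L f g)
    (hc : Tendsto (fun n => fn n 0) atTop (𝓝 (f 0))) (hw : WeakL2 L gn g) :
    ∀ x ∈ Set.Icc 0 L, Tendsto (fun n => fn n x) atTop (𝓝 (f x)) := by
  intro x hx
  rw [h0.eq x hx]
  exact (hc.add (hw.tendsto_integral (fun n => (h n).memLp) h0.memLp hx)).congr
    fun n => ((h n).eq x hx).symm

/-- Bounded, weakly convergent sequences in `H¹` converge pointwise. -/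
theorem tendsto_of_weakH1 (hL : 0 < L) (h : ∀ n, IsPrimitive L (fn n) (gn n))
    (h0 : IsPrimitive L f g) {C : ℝ} (hC : ∀ n, ∀ x ∈ Set.Icc 0 L, ‖fn n x‖ ≤ C)
    (hf : WeakL2 L fn f) (hg : WeakL2 L gn g) :
    ∀ x ∈ Set.Icc 0 L, Tendsto (fun n => fn n x) atTop (𝓝 (f x)) := by
  refine tendsto_of_weakL2_deriv h h0 ?_ hg
  have z0 : (0 : ℝ) ∈ Set.Icc 0 L := ⟨le_rfl, hL.le⟩
  have zL : L ∈ Set.Icc 0 L := ⟨hL.le, le_rfl⟩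
  have hd := fun n => (h n).sub_const (fn n 0)
  have hd0 := h0.sub_const (f 0)
  -- Subtracting the initial values gives sequences with trivially convergent initial values.
  have hp := tendsto_of_weakL2_deriv hd hd0 (by simp) hg
  have hs := tendsto_l2Sq_sub_of_pointwise (fun n => (hd n).continuousOn) hd0.continuousOn
    (C := 2 * C) (fun n x hx => by
      have := norm_sub_le (fn n x) (fn n 0)
      linarith [hC n x hx, hC n 0 z0]) hp
  have hw := weakL2_of_tendsto_l2Sq (fun n => (hd n).memLp_fun) hd0.memLp_fun hs
  have t1 := hw.tendsto_integral (fun n => (hd n).memLp_fun) hd0.memLp_fun zL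
  have t2 := hf.tendsto_integral (fun n => (h n).memLp_fun) h0.memLp_fun zL
  have e : ∀ {u v : ℝ → E3}, IsPrimitive L u v →
      L⁻¹ • ((∫ t in (0 : ℝ)..L, u t) - ∫ t in (0 : ℝ)..L, (u t - u 0)) = u 0 := by
    intro u v hu
    rw [intervalIntegral.integral_sub (hu.intervalIntegrable z0 zL) intervalIntegrable_const,
      sub_sub_cancel, intervalIntegral.integral_const, sub_zero, inv_smul_smul₀ hL.ne']
  have t3 := (t2.sub t1).const_smul L⁻¹
  rw [e h0] at t3
  exact t3.congr fun n => e (h n)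

theorem IsPrimitive.contDiffOn (hL : 0 < L) (h : IsPrimitive L f g)
    (hg : ContinuousOn g (Set.Icc 0 L)) :
    ContDiffOn ℝ 1 f (Set.Icc 0 L) ∧ Set.EqOn (cderiv L f) g (Set.Icc 0 L) := by
  set G : ℝ → E3 := Set.IccExtend hL.le ((Set.Icc 0 L).domRestrict g)
  have hGc : Continuous G := (continuousOn_iff_continuous_domRestrict.1 hg).Icc_extend'
  have hGg : Set.EqOn G g (Set.Icc 0 L) := fun x hx => Set.IccExtend_of_mem hL.le _ hx
  set F : ℝ → E3 := fun x => f 0 + ∫ t in (0 : ℝ)..x, G t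
  have hF : ∀ x, HasDerivAt F (G x) x := fun x =>
    (intervalIntegral.integral_hasDerivAt_right (hGc.intervalIntegrable _ _)
      hGc.stronglyMeasurable.stronglyMeasurableAtFilter hGc.continuousAt).const_add _
  have hfF : Set.EqOn f F (Set.Icc 0 L) := by
    intro x hx
    rw [h.eq x hx]
    simp only [F]
    congr 1
    refine intervalIntegral.integral_congr fun t ht => ?_
    rw [Set.uIcc_of_le hx.1] at ht
    exact (hGg ⟨ht.1, ht.2.trans hx.2⟩).symm
  have hFc : ContDiff ℝ 1 F := by
    rw [contDiff_one_iff_deriv]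
    refine ⟨fun x => (hF x).differentiableAt, ?_⟩
    rwa [show deriv F = G from funext fun x => (hF x).deriv]
  refine ⟨hFc.contDiffOn.congr hfF, fun x hx => ?_⟩
  rw [← hGg hx]
  exact (((hF x).hasDerivWithinAt).congr hfF (hfF hx)).derivWithin (uniqueDiffOn_Icc hL x hx)

/-! ### Weak compactness -/

theorem l2Sq_le_of_h1Norm {C : ℝ} (h : h1Norm L f ≤ C) :
    l2Sq L f ≤ C ^ 2 ∧ l2Sq L (weakDeriv L f) ≤ C ^ 2 := by
  have h1 : h1Sq L f ≤ C ^ 2 := (Real.sqrt_le_iff.1 h).2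
  unfold h1Sq at h1
  exact ⟨by linarith [l2Sq_nonneg L (weakDeriv L f)], by linarith [l2Sq_nonneg L f]⟩

theorem l2Sq_le_of_h2Norm {C : ℝ} (h : h2Norm L f ≤ C) :
    l2Sq L f ≤ C ^ 2 ∧ l2Sq L (cderiv L f) ≤ C ^ 2 ∧ l2Sq L (deriv2 L f) ≤ C ^ 2 := by
  have h1 : h2Sq L f ≤ C ^ 2 := (Real.sqrt_le_iff.1 h).2
  unfold h2Sq h1Sq at h1
  have h2 := l2Sq_nonneg L f
  have h3 := l2Sq_nonneg L (cderiv L f)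
  have h4 := l2Sq_nonneg L (weakDeriv L (cderiv L f))
  exact ⟨by linarith, by linarith, by unfold deriv2; linarith⟩

theorem IsPrimitive.norm_le (hL : 0 < L) (h : IsPrimitive L f g) {K : ℝ} (hf : l2Sq L f ≤ K)
    (hg : l2Sq L g ≤ K) {x : ℝ} (hx : x ∈ Set.Icc 0 L) :
    ‖f x‖ ≤ √(2 / L * K + 2 * L * K) := by
  refine Real.le_sqrt_of_sq_le ((h.sq_norm_le hL hx).trans ?_)
  gcongr

/-- The limit is built from weak limits of the highest derivatives and limits of the initial values;
lower derivatives then converge pointwise, boundedly, and hence strongly in `L²`. -/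
theorem exists_weak_limit (hL : 0 < L) {yh bh : ℕ → ℝ → E3} (hy : ∀ n, MemH2 L (yh n))
    (hb : ∀ n, MemH1 L (bh n)) {C : ℝ} (hyC : ∀ n, h2Norm L (yh n) ≤ C)
    (hbC : ∀ n, h1Norm L (bh n) ≤ C) :
    ∃ (φ : ℕ → ℕ) (y b : ℝ → E3), StrictMono φ ∧ MemH2 L y ∧ MemH1 L b ∧
      WeakH2 L (fun n => yh (φ n)) y ∧ WeakH1 L (fun n => bh (φ n)) b := by
  have z0 : (0 : ℝ) ∈ Set.Icc 0 L := ⟨le_rfl, hL.le⟩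
  have py := fun n => (hy n).isPrimitive hL
  have pt := fun n => (hy n).isPrimitive_cderiv hL
  have pb := fun n => (hb n).isPrimitive hL
  have hyK := fun n => l2Sq_le_of_h2Norm (hyC n)
  have hbK := fun n => l2Sq_le_of_h1Norm (hbC n)
  set D : ℝ := √(2 / L * C ^ 2 + 2 * L * C ^ 2)
  have sy : ∀ n, ∀ x ∈ Set.Icc 0 L, ‖yh n x‖ ≤ D := fun n x hx =>
    (py n).norm_le hL (hyK n).1 (hyK n).2.1 hx
  have st : ∀ n, ∀ x ∈ Set.Icc 0 L, ‖cderiv L (yh n) x‖ ≤ D := fun n x hx =>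
    (pt n).norm_le hL (hyK n).2.1 (hyK n).2.2 hx
  have sb : ∀ n, ∀ x ∈ Set.Icc 0 L, ‖bh n x‖ ≤ D := fun n x hx =>
    (pb n).norm_le hL (hbK n).1 (hbK n).2 hx
  obtain ⟨⟨cy, ct, cb⟩, -, φ₁, hφ₁, hlim₁⟩ := tendsto_subseq_of_bounded
    (Metric.isBounded_closedBall (x := (0 : E3 × E3 × E3)) (r := D))
    (x := fun n => (yh n 0, cderiv L (yh n) 0, bh n 0)) (fun n => by
      rw [mem_closedBall_zero_iff]
      exact max_le (sy n 0 z0) (max_le (st n 0 z0) (sb n 0 z0)))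
  obtain ⟨φ₂, hφ₂, κ, hκ, hκw⟩ := exists_subseq_weakL2 (fun n => (pt (φ₁ n)).memLp)
    fun n => (hyK (φ₁ n)).2.2
  obtain ⟨φ₃, hφ₃, τ, hτ, hτw⟩ := exists_subseq_weakL2 (fun n => (pb (φ₁ (φ₂ n))).memLp)
    fun n => (hbK (φ₁ (φ₂ n))).2
  set φ : ℕ → ℕ := fun n => φ₁ (φ₂ (φ₃ n))
  have hlim := hlim₁.comp (hφ₂.tendsto_atTop.comp hφ₃.tendsto_atTop)
  have ly : Tendsto (fun n => yh (φ n) 0) atTop (𝓝 cy) := (continuous_fst.tendsto _).comp hlim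
  have lt : Tendsto (fun n => cderiv L (yh (φ n)) 0) atTop (𝓝 ct) :=
    ((continuous_fst.comp continuous_snd).tendsto _).comp hlim
  have lb : Tendsto (fun n => bh (φ n) 0) atTop (𝓝 cb) :=
    ((continuous_snd.comp continuous_snd).tendsto _).comp hlim
  have hP : ∀ (c : E3) {u : ℝ → E3}, MemLp u 2 (dom L) →
      IsPrimitive L (fun x => c + ∫ s in (0 : ℝ)..x, u s) u := fun c u hu =>
    ⟨hu, fun x _ => by simp⟩
  set b : ℝ → E3 := fun x => cb + ∫ s in (0 : ℝ)..x, τ s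
  set t : ℝ → E3 := fun x => ct + ∫ s in (0 : ℝ)..x, κ s
  have hbP : IsPrimitive L b τ := hP cb hτ
  have htP : IsPrimitive L t κ := hP ct hκ
  set y : ℝ → E3 := fun x => cy + ∫ s in (0 : ℝ)..x, t s
  have hyP : IsPrimitive L y t := hP cy htP.memLp_fun
  have hy1 := hyP.contDiffOn hL htP.continuousOn
  have htP' : IsPrimitive L (cderiv L y) κ := htP.congr hy1.2 ae_eq_rfl
  have hκw' : WeakL2 L (fun n => deriv2 L (yh (φ n))) κ := hκw.comp hφ₃.tendsto_atTop
  have wb : WeakL2 L (fun n => bh (φ n)) b := by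
    refine weakL2_of_tendsto_l2Sq (fun n => (pb _).memLp_fun) hbP.memLp_fun
      (tendsto_l2Sq_sub_of_pointwise (fun n => (pb _).continuousOn) hbP.continuousOn
        (fun n => sb (φ n)) ?_)
    exact tendsto_of_weakL2_deriv (fun n => pb (φ n)) hbP (by simpa [b] using lb) hτw
  have wt : WeakL2 L (fun n => cderiv L (yh (φ n))) t := by
    refine weakL2_of_tendsto_l2Sq (fun n => (pt _).memLp_fun) htP.memLp_fun
      (tendsto_l2Sq_sub_of_pointwise (fun n => (pt _).continuousOn) htP.continuousOn
        (fun n => st (φ n)) ?_)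
    exact tendsto_of_weakL2_deriv (fun n => pt (φ n)) htP (by simpa [t] using lt) hκw'
  have wy : WeakL2 L (fun n => yh (φ n)) y := by
    refine weakL2_of_tendsto_l2Sq (fun n => (py _).memLp_fun) hyP.memLp_fun
      (tendsto_l2Sq_sub_of_pointwise (fun n => (py _).continuousOn) hyP.continuousOn
        (fun n => sy (φ n)) ?_)
    exact tendsto_of_weakL2_deriv (fun n => py (φ n)) hyP (by simpa [y] using ly) wt
  have hcongr : ∀ {u : ℕ → ℝ → E3} {v v' : ℝ → E3}, WeakL2 L u v → v' =ᵐ[dom L] v →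
      WeakL2 L u v' := by
    intro u v v' hw hv ψ hψ
    have e : ∫ x, inner ℝ (v' x) (ψ x) ∂(dom L) = ∫ x, inner ℝ (v x) (ψ x) ∂(dom L) :=
      integral_congr_ae (by filter_upwards [hv] with x hx; rw [hx])
    rw [e]
    exact hw ψ hψ
  refine ⟨φ, y, b, hφ₁.comp (hφ₂.comp hφ₃), ⟨hy1.1, htP'.memH1 hL⟩, hbP.memH1 hL,
    ⟨wy, ?_, ?_⟩, wb, ?_⟩
  · refine hcongr wt ?_
    filter_upwards [ae_dom_mem L] with x hx using hy1.2 (Set.Ioo_subset_Icc_self hx)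
  · exact hcongr hκw' (htP'.weakDeriv_ae hL)
  · exact hcongr hτw (hbP.weakDeriv_ae hL)

end

noncomputable section

variable {L : ℝ} {W : Type*} [NormedAddCommGroup W] [NormedSpace ℝ W] {Λ : BdryData →L[ℝ] W}
  {ell : W} {y b : ℝ → E3} {yh bh : ℕ → ℝ → E3} {m : ℝ → ℝ → ℝ} {c₀ c₁ c₂ cuni : ℝ}

/-! ### Passage to the limit in the constraints -/

/-- Unit length at the nodes implies approximate unit length between them. -/
theorem Partition.abs_norm_sub_one_le (T : Partition L) (hL : 0 < L) {t t' : ℝ → E3}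
    (ht : IsPrimitive L t t') (h1 : ∀ k, ‖t (T.node k)‖ ^ 2 = 1) {x : ℝ} (hx : x ∈ Set.Icc 0 L) :
    |‖t x‖ - 1| ≤ √(T.mesh * l2Sq L t') := by
  obtain ⟨j, hj⟩ := T.exists_mem_elt hL hx
  have h2 : ‖t (T.node j.castSucc)‖ = 1 := by
    have := h1 j.castSucc
    nlinarith [norm_nonneg (t (T.node j.castSucc))]
  have h3 : |x - T.node j.castSucc| ≤ T.mesh := by
    rw [abs_of_nonneg (sub_nonneg.2 hj.1)]
    refine le_trans ?_ (T.size_le_mesh j)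
    unfold size; linarith [hj.2]
  rw [← h2]
  refine (abs_norm_sub_norm_le _ _).trans (Real.le_sqrt_of_sq_le ?_)
  exact (ht.sq_norm_sub_le hx (T.node_mem _)).trans
    (mul_le_mul_of_nonneg_right h3 (l2Sq_nonneg _ _))

theorem norm_eq_one_of_tendsto (hL : 0 < L) {T : ℕ → Partition L}
    (hmesh : Tendsto (fun n => (T n).mesh) atTop (𝓝 0)) {tn tn' : ℕ → ℝ → E3} {t : ℝ → E3}
    (ht : ∀ n, IsPrimitive L (tn n) (tn' n)) {K : ℝ} (hK : ∀ n, l2Sq L (tn' n) ≤ K)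
    (h1 : ∀ n k, ‖tn n ((T n).node k)‖ ^ 2 = 1) {x : ℝ} (hx : x ∈ Set.Icc 0 L)
    (hlim : Tendsto (fun n => tn n x) atTop (𝓝 (t x))) : ‖t x‖ = 1 := by
  refine tendsto_nhds_unique hlim.norm ?_
  have h2 : Tendsto (fun n => √((T n).mesh * K)) atTop (𝓝 0) := by
    simpa using (hmesh.mul_const K).sqrt
  rw [tendsto_iff_norm_sub_tendsto_zero]
  refine squeeze_zero (fun _ => norm_nonneg _) (fun n => ?_) h2
  refine ((T n).abs_norm_sub_one_le hL (ht n) (h1 n) hx).trans (Real.sqrt_le_sqrt ?_)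
  exact mul_le_mul_of_nonneg_left (hK n) ((T n).mesh_pos hL).le

/-- If the products of a strongly convergent sequence with a bounded, weakly convergent sequence tend
to zero in `L²`, then the product of the limits vanishes. -/
theorem inner_ae_eq_zero_of_tendsto {tn sn : ℕ → ℝ → E3} {t s : ℝ → E3}
    (htn : ∀ n, ContinuousOn (tn n) (Set.Icc 0 L)) (ht : ContinuousOn t (Set.Icc 0 L))
    (hsn : ∀ n, MemLp (sn n) 2 (dom L)) (hs : MemLp s 2 (dom L))
    (hlt : Tendsto (fun n => l2Sq L (tn n - t)) atTop (𝓝 0)) (hws : WeakL2 L sn s) {K : ℝ}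
    (hK : ∀ n, l2Sq L (sn n) ≤ K)
    (h0 : Tendsto (fun n => ∫ x, (inner ℝ (tn n x) (sn n x)) ^ 2 ∂(dom L)) atTop (𝓝 0)) :
    ∀ᵐ x ∂(dom L), inner ℝ (t x) (s x) = 0 := by
  set p : ℝ → ℝ := fun x => inner ℝ (t x) (s x)
  have hp : MemLp p 2 (dom L) := memLp_inner ht hs
  -- The bounded test function `p / (1 + |p|)` detects whether `p` vanishes.
  set χ : ℝ → ℝ := fun x => p x / (1 + |p x|)
  have hpos : ∀ x, 0 < 1 + |p x| := fun x => by positivity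
  have hχ1 : ∀ x, |χ x| ≤ 1 := fun x => by
    rw [abs_div, abs_of_pos (hpos x), div_le_one (hpos x)]; linarith
  have hχm : AEStronglyMeasurable χ (dom L) :=
    (hp.1.aemeasurable.div (hp.1.norm.aemeasurable.const_add 1)).aestronglyMeasurable
  have hχL : MemLp χ 2 (dom L) := MemLp.of_bound hχm 1 (Eventually.of_forall hχ1)
  have hmul : ∀ {u : ℝ → E3}, MemLp u 2 (dom L) → MemLp (fun x => χ x • u x) 2 (dom L) := by
    intro u hu
    refine hu.mono (hχm.smul hu.1) (Eventually.of_forall fun x => ?_)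
    rw [norm_smul]
    exact mul_le_of_le_one_left (norm_nonneg _) (hχ1 x)
  have htL := memLp_of_continuousOn ht
  have htnL := fun n => memLp_of_continuousOn (htn n)
  have l1 : Tendsto (fun n => ∫ x, inner ℝ (sn n x) (χ x • t x) ∂(dom L)) atTop
      (𝓝 (∫ x, χ x * p x ∂(dom L))) := by
    have := hws _ (hmul htL)
    simpa only [inner_smul_right, real_inner_comm] using this
  have l2 : Tendsto (fun n => ∫ x, inner ℝ (sn n x) (χ x • (tn n - t) x) ∂(dom L)) atTop
      (𝓝 0) := by
    have h1 : Tendsto (fun n => √K * √(l2Sq L (tn n - t))) atTop (𝓝 0) := by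
      simpa using hlt.sqrt.const_mul (√K)
    refine squeeze_zero_norm (fun n => ?_) h1
    refine (abs_integral_inner_le (hsn n) (hmul ((htnL n).sub htL))).trans ?_
    refine mul_le_mul (Real.sqrt_le_sqrt (hK n)) (Real.sqrt_le_sqrt ?_) (Real.sqrt_nonneg _)
      (Real.sqrt_nonneg _)
    refine integral_mono (integrable_norm_sq (hmul ((htnL n).sub htL)))
      (integrable_norm_sq ((htnL n).sub htL)) fun x => ?_
    simp only
    rw [norm_smul]
    exact pow_le_pow_left₀ (by positivity) (mul_le_of_le_one_left (norm_nonneg _) (hχ1 x)) 2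
  have l3 : Tendsto (fun n => ∫ x, χ x * inner ℝ (tn n x) (sn n x) ∂(dom L)) atTop (𝓝 0) := by
    have h1 : Tendsto (fun n => √(∫ x, χ x ^ 2 ∂(dom L))
        * √(∫ x, (inner ℝ (tn n x) (sn n x)) ^ 2 ∂(dom L))) atTop (𝓝 0) := by
      simpa using h0.sqrt.const_mul (√(∫ x, χ x ^ 2 ∂(dom L)))
    exact squeeze_zero_norm (fun n => abs_integral_mul_le hχL (memLp_inner (htn n) (hsn n))) h1
  have l4 : Tendsto (fun n => ∫ x, χ x * inner ℝ (tn n x) (sn n x) ∂(dom L)) atTop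
      (𝓝 (∫ x, χ x * p x ∂(dom L))) := by
    have := l1.add l2
    rw [add_zero] at this
    refine this.congr fun n => ?_
    rw [← integral_add (integrable_inner (hsn n) (hmul htL)) (integrable_inner (hsn n) (hmul ((htnL n).sub htL)))]
    refine integral_congr_ae (Eventually.of_forall fun x => ?_)
    simp only [inner_smul_right, Pi.sub_apply, inner_sub_right, real_inner_comm (sn n x)]
    ring
  have hz : ∫ x, χ x * p x ∂(dom L) = 0 := tendsto_nhds_unique l4 l3
  have hnn : ∀ x, 0 ≤ χ x * p x := fun x => by
    have : χ x * p x = p x ^ 2 / (1 + |p x|) := by simp only [χ]; ring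
    rw [this]
    exact div_nonneg (sq_nonneg _) (hpos x).le
  have := (integral_eq_zero_iff_of_nonneg hnn (hχL.integrable_mul hp)).1 hz
  filter_upwards [this] with x hx
  have h2 : χ x * p x = p x ^ 2 / (1 + |p x|) := by simp only [χ]; ring
  rw [Pi.zero_apply, h2, div_eq_zero_iff] at hx
  rcases hx with hx | hx
  · exact pow_eq_zero_iff two_ne_zero |>.1 hx
  · exact absurd hx (hpos x).ne'

theorem penalty_le_discreteEnergy (hm : IsRegModulus m c₀ c₁ c₂ cuni) {δ : ℝ} (hδ : 0 ≤ δ)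
    (ε₁ ε₂ : ℝ) (y b : ℝ → E3) : penalty L ε₁ ε₂ y b ≤ discreteEnergy L (m δ) ε₁ ε₂ y b := by
  unfold discreteEnergy
  refine le_add_of_nonneg_left (mul_nonneg (by norm_num) (integral_nonneg fun x => ?_))
  have := psi_nonneg (hm.nonneg δ hδ (‖deriv2 L y x‖ ^ 2 - ‖weakDeriv L b x‖ ^ 2))
    (sq_nonneg ‖deriv2 L y x‖) (sq_nonneg ‖weakDeriv L b x‖)
  positivity

theorem tendsto_zero_of_penalty {ε I P : ℕ → ℝ} (hε : ∀ n, 0 < ε n) (hε0 : Tendsto ε atTop (𝓝 0))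
    (hI : ∀ n, 0 ≤ I n) {C : ℝ} (hP : ∀ n, P n ≤ C) (h : ∀ n, 1 / (2 * ε n) * I n ≤ P n) :
    Tendsto I atTop (𝓝 0) := by
  have h1 : Tendsto (fun n => 2 * ε n * C) atTop (𝓝 0) := by
    simpa using (hε0.const_mul 2).mul_const C
  refine squeeze_zero hI (fun n => ?_) h1
  have h2 := (h n).trans (hP n)
  have h3 : 0 < 2 * ε n := by linarith [hε n]
  rw [one_div, inv_mul_le_iff₀ h3] at h2
  exact h2

/-- Limits of discrete admissible pairs with bounded energies are admissible frames. -/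
theorem isFrame_of_bounded_energy (hL : 0 < L) (hm : IsRegModulus m c₀ c₁ c₂ cuni)
    {T : ℕ → Partition L} (hmesh : Tendsto (fun n => (T n).mesh) atTop (𝓝 0))
    {ε₁ ε₂ δ : ℕ → ℝ} (hε₁ : ∀ n, 0 < ε₁ n) (hε₂ : ∀ n, 0 < ε₂ n) (hδ : ∀ n, 0 ≤ δ n)
    (hε₁0 : Tendsto ε₁ atTop (𝓝 0)) (hε₂0 : Tendsto ε₂ atTop (𝓝 0))
    (hadm : ∀ n, (T n).IsAdmissible Λ ell (yh n) (bh n)) {C : ℝ}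
    (hyC : ∀ n, h2Norm L (yh n) ≤ C) (hbC : ∀ n, h1Norm L (bh n) ≤ C)
    (hy : MemH2 L y) (hb : MemH1 L b) (hwy : WeakH2 L yh y) (hwb : WeakH1 L bh b) {M : ℝ}
    (hM : ∀ n, discreteEnergy L (m (δ n)) (ε₁ n) (ε₂ n) (yh n) (bh n) ≤ M) :
    IsFrame L Λ ell y b ∧ ∀ᵐ x ∂(dom L), inner ℝ (cderiv L y x) (weakDeriv L b x) = 0 := by
  have myh := fun n => (hadm n).spline_y.memH2 hL
  have mbh := fun n => (hadm n).spline_b.memH1 hL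
  have py := fun n => (myh n).isPrimitive hL
  have pt := fun n => (myh n).isPrimitive_cderiv hL
  have pb := fun n => (mbh n).isPrimitive hL
  have hyK := fun n => l2Sq_le_of_h2Norm (hyC n)
  have hbK := fun n => l2Sq_le_of_h1Norm (hbC n)
  set D : ℝ := √(2 / L * C ^ 2 + 2 * L * C ^ 2)
  have sy : ∀ n, ∀ x ∈ Set.Icc 0 L, ‖yh n x‖ ≤ D := fun n x hx =>
    (py n).norm_le hL (hyK n).1 (hyK n).2.1 hx
  have st : ∀ n, ∀ x ∈ Set.Icc 0 L, ‖cderiv L (yh n) x‖ ≤ D := fun n x hx =>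
    (pt n).norm_le hL (hyK n).2.1 (hyK n).2.2 hx
  have sb : ∀ n, ∀ x ∈ Set.Icc 0 L, ‖bh n x‖ ≤ D := fun n x hx =>
    (pb n).norm_le hL (hbK n).1 (hbK n).2 hx
  have ly := tendsto_of_weakH1 hL py (hy.isPrimitive hL) sy hwy.1 hwy.2.1
  have lt := tendsto_of_weakH1 hL pt (hy.isPrimitive_cderiv hL) st hwy.2.1 hwy.2.2
  have lb := tendsto_of_weakH1 hL pb (hb.isPrimitive hL) sb hwb.1 hwb.2
  have ct := (hy.isPrimitive_cderiv hL).continuousOn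
  have cb := (hb.isPrimitive hL).continuousOn
  have u1 : ∀ x ∈ Set.Icc 0 L, ‖cderiv L y x‖ = 1 := fun x hx =>
    norm_eq_one_of_tendsto hL hmesh pt (fun n => (hyK n).2.2) (fun n => (hadm n).unit_y) hx (lt x hx)
  have u2 : ∀ x ∈ Set.Icc 0 L, ‖b x‖ = 1 := fun x hx =>
    norm_eq_one_of_tendsto hL hmesh pb (fun n => (hbK n).2) (fun n => (hadm n).unit_b) hx (lb x hx)
  have hpen := fun n => (penalty_le_discreteEnergy hm (hδ n) (ε₁ n) (ε₂ n) (yh n) (bh n)).trans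
    (hM n)
  have n1 : ∀ n, 0 ≤ 1 / (2 * ε₁ n) * ∫ x, (inner ℝ (cderiv L (yh n) x) (bh n x)) ^ 2 ∂(dom L) :=
    fun n => mul_nonneg (by have := hε₁ n; positivity) (integral_nonneg fun _ => sq_nonneg _)
  have n2 : ∀ n, 0 ≤ 1 / (2 * ε₂ n) *
      ∫ x, (inner ℝ (cderiv L (yh n) x) (weakDeriv L (bh n) x)) ^ 2 ∂(dom L) :=
    fun n => mul_nonneg (by have := hε₂ n; positivity) (integral_nonneg fun _ => sq_nonneg _)
  have q1 : Tendsto (fun n => ∫ x, (inner ℝ (cderiv L (yh n) x) (bh n x)) ^ 2 ∂(dom L)) atTop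
      (𝓝 0) := tendsto_zero_of_penalty hε₁ hε₁0 (fun n => integral_nonneg fun _ => sq_nonneg _)
    hpen (fun n => le_add_of_nonneg_right (n2 n))
  have q2 : Tendsto (fun n =>
      ∫ x, (inner ℝ (cderiv L (yh n) x) (weakDeriv L (bh n) x)) ^ 2 ∂(dom L)) atTop
      (𝓝 0) := tendsto_zero_of_penalty hε₂ hε₂0 (fun n => integral_nonneg fun _ => sq_nonneg _)
    hpen (fun n => le_add_of_nonneg_left (n1 n))
  have st2 : Tendsto (fun n => l2Sq L (cderiv L (yh n) - cderiv L y)) atTop (𝓝 0) :=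
    tendsto_l2Sq_sub_of_pointwise (fun n => (pt n).continuousOn) ct st lt
  have r1 := inner_ae_eq_zero_of_tendsto (fun n => (pt n).continuousOn) ct
    (fun n => (pb n).memLp_fun) (hb.isPrimitive hL).memLp_fun st2 hwb.1 (fun n => (hbK n).1) q1
  have r2 := inner_ae_eq_zero_of_tendsto (fun n => (pt n).continuousOn) ct
    (fun n => (pb n).memLp) (hb.isPrimitive hL).memLp st2 hwb.2 (fun n => (hbK n).2) q2
  refine ⟨⟨hy, hb, ?_, ?_⟩, r2⟩
  · filter_upwards [r1, ae_dom_mem L] with x h1 hx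
    have hx' := Set.Ioo_subset_Icc_self hx
    exact frameMatrix_mem_iff.2 ⟨u1 x hx', u2 x hx', h1⟩
  · have z0 : (0 : ℝ) ∈ Set.Icc 0 L := ⟨le_rfl, hL.le⟩
    have zL : L ∈ Set.Icc 0 L := ⟨hL.le, le_rfl⟩
    have hpair : ∀ {u : ℕ → ℝ → E3} {v : ℝ → E3}, (∀ x ∈ Set.Icc 0 L,
        Tendsto (fun n => u n x) atTop (𝓝 (v x))) →
        Tendsto (fun n => ![u n 0, u n L]) atTop (𝓝 ![v 0, v L]) := by
      intro u v h
      rw [tendsto_pi_nhds]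
      intro i
      fin_cases i
      · exact h 0 z0
      · exact h L zL
    have hbd : Tendsto (fun n => bdry L (yh n) (bh n)) atTop (𝓝 (bdry L y b)) :=
      (hpair ly).prodMk_nhds ((hpair lt).prodMk_nhds (hpair lb))
    have h1 := (Λ.continuous.tendsto _).comp hbd
    refine tendsto_nhds_unique h1 ?_
    exact tendsto_const_nhds.congr fun n => ((hadm n).bc).symm

/-! ### The lower bound -/

theorem energy_le_liminf (hL : 0 < L) (hm : IsRegModulus m c₀ c₁ c₂ cuni)
    {ε₁ ε₂ δ : ℕ → ℝ} (hε₁ : ∀ n, 0 < ε₁ n) (hε₂ : ∀ n, 0 < ε₂ n) (hδ : ∀ n, 0 ≤ δ n)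
    (hδ0 : Tendsto δ atTop (𝓝 0)) (hyh : ∀ n, MemH2 L (yh n)) (hbh : ∀ n, MemH1 L (bh n))
    (hy : MemH2 L y) (hb : MemH1 L b) (hwy : WeakH2 L yh y) (hwb : WeakH1 L bh b) :
    ((energy L y b : ℝ) : EReal) ≤
      liminf (fun n => ((discreteEnergy L (m (δ n)) (ε₁ n) (ε₂ n) (yh n) (bh n) : ℝ) : EReal))
        atTop := by
  have mA := fun n => ((hyh n).isPrimitive_cderiv hL).memLp
  have mB := fun n => ((hbh n).isPrimitive hL).memLp
  obtain ⟨l, hl, hlim⟩ := exists_le_integral_Qbar (hy.isPrimitive_cderiv hL).memLp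
    (hb.isPrimitive hL).memLp mA mB hwy.2.2 hwb.2
  have h2 : Tendsto (fun n => L * (3 / 2 * (cuni * δ n))) atTop (𝓝 0) := by
    simpa using ((hδ0.const_mul cuni).const_mul (3 / 2)).const_mul L
  have h3 := hlim.sub h2
  rw [sub_zero] at h3
  have h4 : Tendsto (fun n => ((l n - L * (3 / 2 * (cuni * δ n)) : ℝ) : EReal)) atTop
      (𝓝 ((energy L y b : ℝ) : EReal)) := (continuous_coe_real_ereal.tendsto _).comp h3
  rw [← h4.liminf_eq]
  refine liminf_le_liminf (Eventually.of_forall fun n => ?_)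
  rw [EReal.coe_le_coe_iff]
  have h5 := (abs_le.1 (abs_regularized_sub_le hL hm (hδ n) (mA n) (mB n))).1
  have h6 : 0 ≤ penalty L (ε₁ n) (ε₂ n) (yh n) (bh n) := by
    have e1 := hε₁ n
    have e2 := hε₂ n
    exact add_nonneg (mul_nonneg (by positivity) (integral_nonneg fun _ => sq_nonneg _))
      (mul_nonneg (by positivity) (integral_nonneg fun _ => sq_nonneg _))
  have h7 := hl n
  unfold discreteEnergy
  linarith

end

end Ribbon

theorem proposition4p1 {W : Type*} [NormedAddCommGroup W] [NormedSpace ℝ W]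
    (L : ℝ) (hL : 0 < L) (Λ : Ribbon.BdryData →L[ℝ] W) (ell : W)
    (m : ℝ → ℝ → ℝ) (c₀ c₁ c₂ cuni : ℝ) (hm : Ribbon.IsRegModulus m c₀ c₁ c₂ cuni)
    (T : ℕ → Ribbon.Partition L) (cq : ℝ) (hcq : 0 < cq)
    (hquasi : ∀ n j, cq * (T n).mesh ≤ (T n).size j)
    (hmesh : Tendsto (fun n => (T n).mesh) atTop (𝓝 0))
    (ε₁ ε₂ δ : ℕ → ℝ) (hε₁ : ∀ n, 0 < ε₁ n) (hε₂ : ∀ n, 0 < ε₂ n) (hδ : ∀ n, 0 ≤ δ n)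
    (hε₁0 : Tendsto ε₁ atTop (𝓝 0)) (hε₂0 : Tendsto ε₂ atTop (𝓝 0))
    (hδ0 : Tendsto δ atTop (𝓝 0)) :
    -- (i) recovery sequences
    (∀ (y b : ℝ → Ribbon.E3) (σ : ℕ → ℝ), Ribbon.MemH2 L y → Ribbon.MemH1 L b →
      (∀ n, 0 < σ n) → Tendsto σ atTop (𝓝 0) →
      Tendsto (fun n =>
        ENNReal.ofReal ((T n).mesh ^ 2 / ε₁ n) + ENNReal.ofReal (σ n ^ 2 / ε₂ n)
          + ENNReal.ofReal ((T n).mesh ^ 2 / ε₂ n) * Ribbon.regNorm L Λ ell y b (σ n) ^ 2)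
        atTop (𝓝 0) →
      ∃ yh bh : ℕ → ℝ → Ribbon.E3,
        (∀ n, (T n).IsAdmissible Λ ell (yh n) (bh n)) ∧
        Tendsto (fun n => Ribbon.h2Norm L (yh n - y)) atTop (𝓝 0) ∧
        Tendsto (fun n => Ribbon.h1Norm L (bh n - b)) atTop (𝓝 0) ∧
        Tendsto (fun n =>
          Ribbon.discreteEnergy L (m (δ n)) (ε₁ n) (ε₂ n) (yh n) (bh n)) atTop
          (𝓝 (Ribbon.energy L y b))) ∧
    -- (ii) weak compactness and lower bound
    (∀ yh bh : ℕ → ℝ → Ribbon.E3,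
      (∀ n, (T n).IsAdmissible Λ ell (yh n) (bh n)) →
      (∃ C : ℝ, ∀ n, Ribbon.h2Norm L (yh n) + Ribbon.h1Norm L (bh n) ≤ C) →
      (∃ (φ : ℕ → ℕ) (y b : ℝ → Ribbon.E3), StrictMono φ ∧
        Ribbon.MemH2 L y ∧ Ribbon.MemH1 L b ∧
        Ribbon.WeakH2 L (fun n => yh (φ n)) y ∧ Ribbon.WeakH1 L (fun n => bh (φ n)) b) ∧
      (∀ y b : ℝ → Ribbon.E3, Ribbon.MemH2 L y → Ribbon.MemH1 L b →
        Ribbon.WeakH2 L yh y → Ribbon.WeakH1 L bh b →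
        (liminf (fun n => ((Ribbon.discreteEnergy L (m (δ n)) (ε₁ n) (ε₂ n)
            (yh n) (bh n) : ℝ) : EReal)) atTop ≠ ⊤ →
          Ribbon.IsFrame L Λ ell y b ∧
          ∀ᵐ x ∂(Ribbon.dom L),
            inner ℝ (Ribbon.cderiv L y x) (Ribbon.weakDeriv L b x) = 0) ∧
        ((Ribbon.energy L y b : ℝ) : EReal) ≤
          liminf (fun n => ((Ribbon.discreteEnergy L (m (δ n)) (ε₁ n) (ε₂ n)
            (yh n) (bh n) : ℝ) : EReal)) atTop)) := by
  refine ⟨fun y b σ hy hb _ hσ0 hlim =>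
    Ribbon.exists_recovery_sequence hL hm hε₁ hε₂ hδ hε₂0 hδ0 hy hb hσ0 hlim, ?_⟩
  rintro yh bh hadm ⟨C, hC⟩
  have hyC : ∀ n, Ribbon.h2Norm L (yh n) ≤ C := fun n =>
    (le_add_of_nonneg_right (Real.sqrt_nonneg _)).trans (hC n)
  have hbC : ∀ n, Ribbon.h1Norm L (bh n) ≤ C := fun n =>
    (le_add_of_nonneg_left (Real.sqrt_nonneg _)).trans (hC n)
  have myh := fun n => (hadm n).spline_y.memH2 hL
  have mbh := fun n => (hadm n).spline_b.memH1 hL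
  refine ⟨Ribbon.exists_weak_limit hL myh mbh hyC hbC, fun y b hy hb hwy hwb =>
    ⟨fun hfin => ?_, Ribbon.energy_le_liminf hL hm hε₁ hε₂ hδ hδ0 myh mbh hy hb hwy hwb⟩⟩
  -- A finite lower limit provides a subsequence with bounded energies.
  obtain ⟨M, hM, -⟩ := EReal.lt_iff_exists_real_btwn.1 (lt_top_iff_ne_top.2 hfin)
  obtain ⟨φ, hφ, hφM⟩ := extraction_of_frequently_atTop (frequently_lt_of_liminf_lt (h := hM))
  have hφt := hφ.tendsto_atTop
  exact Ribbon.isFrame_of_bounded_energy hL hm (hmesh.comp hφt) (fun n => hε₁ (φ n))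
    (fun n => hε₂ (φ n)) (fun n => hδ (φ n)) (hε₁0.comp hφt) (hε₂0.comp hφt)
    (fun n => hadm (φ n)) (fun n => hyC (φ n)) (fun n => hbC (φ n)) hy hb
    ⟨hwy.1.comp hφt, hwy.2.1.comp hφt, hwy.2.2.comp hφt⟩ ⟨hwb.1.comp hφt, hwb.2.comp hφt⟩
    (fun n => (EReal.coe_lt_coe_iff.1 (hφM n)).le)
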